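/- Let $a>b>0$ be real numbers and, for $n\ge 1$, put $\gamma^n_1=n-\frac{a}{\sqrt n}+b\sqrt n$ and $\gamma^n_i=n-\frac{a}{\sqrt n}$ for $2\le i\le n$. The ordered queue lengths of the $n$-server system with pauses are the process $Y^n=(Y^n_1,\dots,Y^n_n)$ with values in $\mathbb N_0^n$ and right-continuous paths with left limits, solving, for all $t\ge 0$ and $1\le i\le n$, $$Y^n_i(t)=Y^n_i(0)+\int_{[0,t]\times\mathbb R_+}\mathbf 1_{[0,\gamma^n_i]}(r)\,\mathbf 1_{\{Y^n_i(s-)<Y^n_{i+1}(s-)\}}\,\mathcal A_i(ds\,dr)-\int_{[0,t]\times\mathbb R_+}\mathbf 1_{[0,n]}(r)\,\mathbf 1_{\{Y^n_i(s-)>Y^n_{i-1}(s-)\}}\,\mathcal D_i(ds\,dr),$$ where $Y^n_0\equiv 0$, $Y^n_{n+1}\equiv\infty$, the $\mathcal A_i,\mathcal D_i$ ($1\le i\le n$) are mutually independent Poisson random measures on $\mathbb R_+\times\mathbb R_+$ with Lebesgue intensity, and $Y^n_1(0)\le\dots\le Y^n_n(0)$ is independent of them. The scaled gap process is $\hat U^n=(\hat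 U^n_1,\dots,\hat U^n_n)$ with $\hat U^n_i=(Y^n_i-Y^n_{i-1})/\sqrt n$. A probability measure $\pi$ on $\mathbb N_0^n/\sqrt n$ is a stationary distribution of $\hat U^n$ if $\hat U^n(t)\sim\pi$ for all $t\ge0$ whenever $\hat U^n(0)\sim\pi$. For each $n\ge1$ such that $\gamma^n_i>0$ for all $1\le i\le n$ (this holds for all large $n$), $\hat U^n$ has a unique stationary distribution $\pi^{(n)}$ on $\mathbb N_0^n/\sqrt n$, and it is the product of geometric laws given by $$\pi^{(n)}\big([z_1,\infty)\times\cdots\times[z_n,\infty)\big)=\prod_{i=1}^n\big(\rho^{(n)}_i\big)^{\sqrt n\,z_i},\qquad z_i\in\mathbb N_0/\sqrt n,$$ where $$\rho^{(n)}_i=\prod_{j=i}^n\Big(1-\frac{a}{n^{3/2}}+\frac{b}{\sqrt n}\mathbf 1_{\{j=1\}}\Big),\qquad 1\le i\le n.$$ Furthermore, regarding $\pi^{(n)}$ as a probability measure on $\mathbb R_+^\infty$ (with the product topology) by appending zero coordinates, $\pi^{(n)}$ converges weakly, as $n\to\infty$, to $\mu_{a,b}=\mathrm{Exp}(a-b)\otimes\mathrm{Exp}(a)\otimes\mathrm{Exp}(a)\otimes\cdots$,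 where $\mathrm{Exp}(\theta)$ is the exponential law with mean $\theta^{-1}$. -/

import Mathlib

open MeasureTheory ProbabilityTheory Filter Topology
open scoped NNReal ENNReal

noncomputable section

/-! ### Poisson random measures -/

/-- `N` is a Poisson random measure on `E` with intensity `m`, defined on the probability space
`(Ω, P)`: a random point measure (its values on measurable sets are in `{0, 1, …, ∞}`) whose value
on a measurable set `B` of finite intensity is Poisson with parameter `m B`, and whose values on
disjoint measurable sets are independent. -/
structure IsPoissonRandomMeasure {Ω E : Type*} [MeasurableSpace Ω] [MeasurableSpace E]
    (P : Measure Ω) (N : Ω → Measure E) (m : Measure E) : Prop where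
  measurable : Measurable N
  integer_valued : ∀ ω, ∀ B, MeasurableSet B → ∃ k : ℕ∞, N ω B = (k : ℝ≥0∞)
  poisson : ∀ B, MeasurableSet B → m B ≠ ∞ →
    HasLaw (fun ω => N ω B)
      ((poissonMeasure (m B).toNNReal).map (Nat.cast : ℕ → ℝ≥0∞)) P
  indep : ∀ (k : ℕ) (B : Fin k → Set E), (∀ j, MeasurableSet (B j)) →
    Pairwise (fun j l => Disjoint (B j) (B l)) → iIndepFun (fun j ω => N ω (B j)) P

/-- Lebesgue measure on `ℝ₊`. -/
def lebesgueHalfLine : Measure ℝ≥0 := Measure.comap ((↑) : ℝ≥0 → ℝ) volume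

/-- Lebesgue measure `dt × dr` on `ℝ₊ × ℝ₊`. -/
def lebesgueQuadrant : Measure (ℝ≥0 × ℝ≥0) := lebesgueHalfLine.prod lebesgueHalfLine

/-! ### The system with pauses

Ranks `1, …, n` are the elements of `Fin n`, so that rank `1` is the element with value `0`. -/

/-- The arrival rate `γᵢⁿ` attached to rank `i`. -/
def arrivalRate (a b : ℝ) (n : ℕ) (i : Fin n) : ℝ :=
  n - a / √n + if i.val = 0 then b * √n else 0

/-- The queue length one rank below `i`, with the convention `y₀ = 0`. -/
def rankBelow {n : ℕ} (y : Fin n → ℕ) (i : Fin n) : ℕ :=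
  if i.val = 0 then 0 else y ⟨i.val - 1, lt_of_le_of_lt (Nat.sub_le _ _) i.isLt⟩

/-- The queue length one rank above `i`, with the convention `yₙ₊₁ = ∞`. -/
def rankAbove {n : ℕ} (y : Fin n → ℕ) (i : Fin n) : ℕ∞ :=
  if h : i.val + 1 < n then (y ⟨i.val + 1, h⟩ : ℕ∞) else ⊤

/-- `Y` is the process of ordered queue lengths of the `n`-server system with pauses with parameters
`a, b`, driven by the Poisson random measures `A i, D i` (arrivals and departures at rank `i`) on
`ℝ₊ × ℝ₊` with Lebesgue intensity, and started from a random ordered configuration that is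
independent of them. A point `(s, r)` of `A i` with `r ≤ γᵢⁿ` raises `Yᵢ` by one if
`Yᵢ(s-) < Yᵢ₊₁(s-)`; a point `(s, r)` of `D i` with `r ≤ n` lowers `Yᵢ` by one if
`Yᵢ(s-) > Yᵢ₋₁(s-)`. -/
structure IsPauseSystem {Ω : Type*} [MeasurableSpace Ω] (P : Measure Ω) (a b : ℝ) (n : ℕ)
    (A D : Fin n → Ω → Measure (ℝ≥0 × ℝ≥0)) (Y : ℝ≥0 → Ω → Fin n → ℕ) : Prop where
  poisson_arrivals : ∀ i, IsPoissonRandomMeasure P (A i) lebesgueQuadrant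
  poisson_departures : ∀ i, IsPoissonRandomMeasure P (D i) lebesgueQuadrant
  indep_drivers : iIndepFun (Sum.elim A D) P
  indep_initial : IndepFun (Y 0) (fun ω => (fun i => A i ω, fun i => D i ω)) P
  measurable : ∀ t, Measurable (Y t)
  ordered_initial : ∀ᵐ ω ∂P, Monotone (Y 0 ω)
  right_continuous : ∀ᵐ ω ∂P, ∀ t, ContinuousWithinAt (fun s => Y s ω) (Set.Ici t) t
  left_limits : ∀ᵐ ω ∂P, ∀ t, ∃ l, Tendsto (fun s => Y s ω) (𝓝[<] t) (𝓝 l)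
  equation : ∀ᵐ ω ∂P, ∀ t i,
    (Y t ω i : ℝ) = Y 0 ω i
      + (A i ω).real {p | p.1 ≤ t ∧ (p.2 : ℝ) ≤ arrivalRate a b n i ∧
          (Function.leftLim (fun s => Y s ω) p.1 i : ℕ∞)
            < rankAbove (Function.leftLim (fun s => Y s ω) p.1) i}
      - (D i ω).real {p | p.1 ≤ t ∧ (p.2 : ℝ) ≤ n ∧
          rankBelow (Function.leftLim (fun s => Y s ω) p.1) i
            < Function.leftLim (fun s => Y s ω) p.1 i}

/-- The vector of diffusion scaled gaps `(yᵢ - yᵢ₋₁) / √n` of an ordered configuration `y`. -/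
def scaledGaps (n : ℕ) (y : Fin n → ℕ) : Fin n → ℝ≥0 :=
  fun i => ((y i - rankBelow y i : ℕ) : ℝ≥0) / NNReal.sqrt n

/-- The state space `ℕ₀ⁿ / √n` of the scaled gap process. -/
def scaledLattice (n : ℕ) : Set (Fin n → ℝ≥0) :=
  {z | ∀ i, ∃ k : ℕ, z i = (k : ℝ≥0) / NNReal.sqrt n}

/-- `π` is a stationary distribution, on `ℕ₀ⁿ / √n`, of the scaled gap process: whenever the process
is started from `π`, its law at every time is `π`. -/
def IsStationaryGapLaw (a b : ℝ) (n : ℕ) (π : ProbabilityMeasure (Fin n → ℝ≥0)) : Prop :=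
  (π : Measure (Fin n → ℝ≥0)) (scaledLattice n)ᶜ = 0 ∧
  ∀ (Ω : Type) [MeasurableSpace Ω] (P : Measure Ω) [IsProbabilityMeasure P]
    (A D : Fin n → Ω → Measure (ℝ≥0 × ℝ≥0)) (Y : ℝ≥0 → Ω → Fin n → ℕ),
    IsPauseSystem P a b n A D Y →
    P.map (fun ω => scaledGaps n (Y 0 ω)) = (π : Measure (Fin n → ℝ≥0)) →
    ∀ t, P.map (fun ω => scaledGaps n (Y t ω)) = (π : Measure (Fin n → ℝ≥0))

/-- The parameters `ρᵢ⁽ⁿ⁾`. -/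
def gapRatio (a b : ℝ) (n : ℕ) (i : Fin n) : ℝ :=
  ∏ j ∈ Finset.Ici i,
    (1 - a / (n : ℝ) ^ (3 / 2 : ℝ) + b / √n * if j.val = 0 then 1 else 0)

/-! ### Laws on `ℝ₊^∞` -/

/-- `(z₁, …, zₙ) ↦ (z₁, …, zₙ, 0, 0, …)`. -/
def padZero (n : ℕ) (z : Fin n → ℝ≥0) : ℕ → ℝ≥0 :=
  fun k => if h : k < n then z ⟨k, h⟩ else 0

lemma measurable_padZero (n : ℕ) : Measurable (padZero n) := by
  refine measurable_pi_lambda _ fun k => ?_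
  by_cases h : k < n
  · simpa [padZero, h] using measurable_pi_apply _
  · simp [padZero, h]

/-- A law on `ℝ₊ⁿ` regarded as a law on `ℝ₊^∞`. -/
def padLaw (n : ℕ) (π : ProbabilityMeasure (Fin n → ℝ≥0)) : ProbabilityMeasure (ℕ → ℝ≥0) :=
  π.map (measurable_padZero n).aemeasurable

/-- The measure `Exp(a - b) ⊗ Exp(a) ⊗ Exp(a) ⊗ ⋯` on `ℝ₊^∞`. -/
def atlasMeasure (a b : ℝ) : Measure (ℕ → ℝ≥0) :=
  Measure.infinitePi fun i => (expMeasure (if i = 0 then a - b else a)).map Real.toNNReal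

lemma isProbabilityMeasure_atlasMeasure {a b : ℝ} (hb : 0 < b) (hab : b < a) :
    IsProbabilityMeasure (atlasMeasure a b) := by
  have h : ∀ i : ℕ, IsProbabilityMeasure
      ((expMeasure (if i = 0 then a - b else a)).map Real.toNNReal) := by
    intro i
    have hi : 0 < (if i = 0 then a - b else a) := by split_ifs <;> linarith
    have := isProbabilityMeasure_expMeasure hi
    exact Measure.isProbabilityMeasure_map measurable_real_toNNReal.aemeasurable
  unfold atlasMeasure
  infer_instance

/-- The law `μ_{a,b}`, for `0 < b < a`, as a probability measure. -/
def atlasLaw (a b : ℝ) (hb : 0 < b) (hab : b < a) : ProbabilityMeasure (ℕ → ℝ≥0) :=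
  ⟨atlasMeasure a b, isProbabilityMeasure_atlasMeasure hb hab⟩

end

/-! The system is a Markov chain on ordered configurations `y`: arrivals at rank `i` have rate `γᵢ`,
departures have rate `n`, and a move that would break the order is suppressed. From an ordered
configuration every performed move is undone by the opposite one (`enabled_swap_step`), and the
weight `∏ (γᵢ / n) ^ yᵢ` is multiplied by `γᵢ / n` when `yᵢ` grows by one, so detailed balance
holds. Since `yᵢ` is the sum of the gaps up to rank `i`, regrouping the weight by gaps gives `∏ ρᵢ ^
gᵢ` with `ρᵢ = ∏_{j ≥ i} γⱼ / n` (`prod_gapRatio_pow_gaps`). The gaps are therefore independent and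
geometric, where `b < a` ensures `ρᵢ < 1` (`gapRatio_lt_one`).

For uniqueness, the set where one invariant law has strictly larger mass than another is stable
under all moves (`IsInvariantLaw.step_mem`). Departures lead from every configuration to the empty
one, so two distinct laws would each charge the empty configuration strictly more than the other
(`IsInvariantLaw.eq`).

A time grid links the Poisson-driven equation with the balance equations. Outside an event of
probability of order `1 / m`, each of the `m + 1` cells contains at most one active point, and then
the solution follows a chain with independent outcomes (`ae_eq_gridChain`). Each move occurs with
probability proportional to its rate, so this chain preserves an invariant law exactly; letting `m →
∞` gives stationarity (`map_eq_of_isInvariantLaw`). Conversely, on one cell of length `t` the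
coupling error is of order `t ^ 2` and the generator acts at order `t`, so stationarity forces
invariance (`isInvariantLaw_of_map_eq`). Stationarity is a condition on all systems with a given
initial law, so uniqueness also needs a system started from any law on ordered configurations
(`exists_isPauseSystem`): Poisson random measures are superpositions of finite samples, and the
equation is solved path by path.

Convergence is by coupling. The integer part of an `Exp(g)` variable is geometric with ratio `exp
(-g)`, so every stationary law is an image of the limit law under rescaling and rounding. These maps
converge pointwise because `√n * (-log ρᵢ)` tends to the limiting rate (`tendsto_sqrt_mul_gapRate`).
-/

/-! ### Poisson random measures of finite intensity -/

section FiniteIntensity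

variable {E : Type*} [MeasurableSpace E]

/-- The point measure carried by the first `k` terms of a sequence `x`. -/
noncomputable def pointMeasure (ω : ℕ × (ℕ → E)) : Measure E :=
  ∑ l ∈ Finset.range ω.1, Measure.dirac (ω.2 l)

lemma pointMeasure_apply (ω : ℕ × (ℕ → E)) {B : Set E} (hB : MeasurableSet B) :
    pointMeasure ω B = ENNReal.ofReal (∑ l ∈ Finset.range ω.1, B.indicator 1 (ω.2 l)) := by
  rw [pointMeasure, Measure.finsetSum_apply, ENNReal.ofReal_sum_of_nonneg]
  · refine Finset.sum_congr rfl fun l _ => ?_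
    rw [Measure.dirac_apply' _ hB]
    by_cases h : ω.2 l ∈ B <;> simp [h]
  · intro l _
    exact Set.indicator_nonneg (fun _ _ => zero_le_one) _

lemma pointMeasure_apply_eq_natCast (ω : ℕ × (ℕ → E)) {B : Set E} (hB : MeasurableSet B) :
    ∃ k : ℕ, pointMeasure ω B = k := by
  classical
  refine ⟨∑ l ∈ Finset.range ω.1, if ω.2 l ∈ B then 1 else 0, ?_⟩
  rw [pointMeasure, Measure.finsetSum_apply]
  push_cast
  refine Finset.sum_congr rfl fun l _ => ?_
  rw [Measure.dirac_apply' _ hB]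
  by_cases h : ω.2 l ∈ B <;> simp [h]

lemma measurable_sum_range_fst {g : E → ℝ} (hg : Measurable g) :
    Measurable fun ω : ℕ × (ℕ → E) => ∑ l ∈ Finset.range ω.1, g (ω.2 l) :=
  measurable_from_prod_countable_right fun k =>
    Finset.measurable_sum (Finset.range k) fun l _ => hg.comp (measurable_pi_apply l)

lemma measurable_pointMeasure : Measurable (pointMeasure : ℕ × (ℕ → E) → Measure E) := by
  refine Measure.measurable_of_measurable_coe _ fun B hB => ?_
  simp_rw [pointMeasure_apply _ hB]
  exact (measurable_sum_range_fst (measurable_one.indicator hB)).ennreal_ofReal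

/-- The law of a Poisson number of parameter `r` together with an independent i.i.d. sequence. -/
noncomputable def poissonSampleLaw (r : ℝ≥0) (μ : Measure E) : Measure (ℕ × (ℕ → E)) :=
  (poissonMeasure r).prod (Measure.infinitePi fun _ => μ)

instance (r : ℝ≥0) (μ : Measure E) [IsProbabilityMeasure μ] :
    IsProbabilityMeasure (poissonSampleLaw r μ) := by
  unfold poissonSampleLaw; infer_instance

lemma integral_prod_range_infinitePi (μ : Measure E) [IsProbabilityMeasure μ] {φ : E → ℂ}
    (hφ : Measurable φ) (k : ℕ) :
    ∫ x, ∏ l ∈ Finset.range k, φ (x l) ∂(Measure.infinitePi fun _ : ℕ => μ)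
      = (∫ y, φ y ∂μ) ^ k := by
  have hind : iIndepFun (fun (l : Fin k) (x : ℕ → E) => φ (x l))
      (Measure.infinitePi fun _ : ℕ => μ) :=
    (iIndepFun_infinitePi (P := fun _ : ℕ => μ) (X := fun _ => φ) fun _ => hφ).precomp
      Fin.val_injective
  simp_rw [Finset.prod_range]
  rw [hind.integral_fun_prod_eq_prod_integral fun l => by
    exact (hφ.comp (measurable_pi_apply _)).aestronglyMeasurable]
  have : ∀ l : Fin k, ∫ x, φ (x l) ∂(Measure.infinitePi fun _ : ℕ => μ) = ∫ y, φ y ∂μ := by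
    intro l
    have h := (measurePreserving_eval_infinitePi (fun _ : ℕ => μ) l.val)
    exact h.hasLaw.integral_comp hφ.aestronglyMeasurable
  simp [this]

/-- The characteristic functional of a Poisson sample. -/
lemma integral_cexp_sum_poissonSampleLaw (r : ℝ≥0) (μ : Measure E) [IsProbabilityMeasure μ]
    {g : E → ℝ} (hg : Measurable g) :
    ∫ ω, Complex.exp (((∑ l ∈ Finset.range ω.1, g (ω.2 l) : ℝ) : ℂ) * Complex.I)
        ∂(poissonSampleLaw r μ)
      = Complex.exp (r * ((∫ y, Complex.exp (g y * Complex.I) ∂μ) - 1)) := by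
  set z : ℂ := ∫ y, Complex.exp (g y * Complex.I) ∂μ
  have hmeas : Measurable fun ω : ℕ × (ℕ → E) =>
      Complex.exp (((∑ l ∈ Finset.range ω.1, g (ω.2 l) : ℝ) : ℂ) * Complex.I) := by
    have := measurable_sum_range_fst hg
    fun_prop
  have hint : Integrable (fun ω : ℕ × (ℕ → E) =>
      Complex.exp (((∑ l ∈ Finset.range ω.1, g (ω.2 l) : ℝ) : ℂ) * Complex.I))
      ((poissonMeasure r).prod (Measure.infinitePi fun _ => μ)) :=
    Integrable.of_bound hmeas.aestronglyMeasurable 1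
      (ae_of_all _ fun ω => (Complex.norm_exp_ofReal_mul_I _).le)
  have hinner : ∀ k : ℕ, ∫ x, Complex.exp (((∑ l ∈ Finset.range k, g (x l) : ℝ) : ℂ) * Complex.I)
      ∂(Measure.infinitePi fun _ : ℕ => μ) = z ^ k := by
    intro k
    rw [← integral_prod_range_infinitePi μ (φ := fun y => Complex.exp (g y * Complex.I))
      (by fun_prop) k]
    refine integral_congr_ae (ae_of_all _ fun x => ?_)
    simp only [Complex.ofReal_sum, Finset.sum_mul, Complex.exp_sum]
  -- Conditioning on the number `k` of points leaves `z ^ k`; averaging over the Poisson number sums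
  -- the exponential series.
  rw [poissonSampleLaw, integral_prod _ hint]
  simp_rw [hinner]
  rw [integral_poissonMeasure]
  calc ∑' k : ℕ, (Real.exp (-r) * r ^ k / k.factorial) • z ^ k
      = ∑' k : ℕ, (Real.exp (-r) : ℂ) * ((r * z) ^ k / k.factorial) := by
        refine tsum_congr fun k => ?_
        rw [Complex.real_smul]; push_cast; ring
    _ = (Real.exp (-r) : ℂ) * Complex.exp (r * z) := by
        rw [tsum_mul_left, (NormedSpace.expSeries_div_hasSum_exp ((r : ℂ) * z)).tsum_eq,
          Complex.exp_eq_exp_ℂ]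
    _ = Complex.exp (r * (z - 1)) := by
        rw [Complex.ofReal_exp, ← Complex.exp_add]; push_cast; ring_nf

-- Disjointness leaves at most one nonzero indicator, so subtracting one turns the exponential of a
-- sum into a sum.
omit [MeasurableSpace E] in
lemma cexp_indicator_sum {k : ℕ} {B : Fin k → Set E}
    (hd : Pairwise fun j l => Disjoint (B j) (B l)) (t : Fin k → ℝ) (y : E) :
    Complex.exp (((∑ j, t j * (B j).indicator 1 y : ℝ) : ℂ) * Complex.I) - 1
      = ∑ j, (B j).indicator 1 y * (Complex.exp (t j * Complex.I) - 1) := by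
  by_cases h : ∃ j, y ∈ B j
  · obtain ⟨j, hj⟩ := h
    have hne : ∀ l, l ≠ j → y ∉ B l := fun l hl hy => (hd hl).le_bot ⟨hy, hj⟩
    rw [Finset.sum_eq_single j (fun l _ hl => by simp [hne l hl]) (by simp),
      Finset.sum_eq_single j (fun l _ hl => by simp [hne l hl]) (by simp)]
    simp [hj]
  · push Not at h
    simp [h]

lemma integral_cexp_indicator_sum (μ : Measure E) [IsProbabilityMeasure μ] {k : ℕ}
    {B : Fin k → Set E} (hB : ∀ j, MeasurableSet (B j))
    (hd : Pairwise fun j l => Disjoint (B j) (B l)) (t : Fin k → ℝ) :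
    ∫ y, Complex.exp (((∑ j, t j * (B j).indicator 1 y : ℝ) : ℂ) * Complex.I) ∂μ - 1
      = ∑ j, (μ.real (B j) : ℂ) * (Complex.exp (t j * Complex.I) - 1) := by
  have hmeas : Measurable fun y : E => (∑ j, t j * (B j).indicator 1 y : ℝ) :=
    Finset.measurable_sum _ fun j _ => (measurable_one.indicator (hB j)).const_mul _
  have hint : Integrable (fun y : E =>
      Complex.exp (((∑ j, t j * (B j).indicator 1 y : ℝ) : ℂ) * Complex.I)) μ :=
    Integrable.of_bound (by fun_prop : Measurable _).aestronglyMeasurable 1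
      (ae_of_all _ fun y => (Complex.norm_exp_ofReal_mul_I _).le)
  have h1 : (1 : ℂ) = ∫ _ : E, (1 : ℂ) ∂μ := by simp
  have hi : ∀ j, Integrable (fun y : E => (B j).indicator (1 : E → ℂ) y) μ := fun j =>
    (integrable_const (1 : ℂ)).indicator (hB j)
  conv_lhs => rw [h1]
  rw [← integral_sub hint (integrable_const _)]
  simp_rw [cexp_indicator_sum hd t]
  rw [integral_finsetSum _ fun j _ => (hi j).mul_const _]
  refine Finset.sum_congr rfl fun j _ => ?_
  rw [integral_mul_const, integral_indicator (hB j)]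
  simp

lemma hasLaw_sum_indicator (r : ℝ≥0) (μ : Measure E) [IsProbabilityMeasure μ] {B : Set E}
    (hB : MeasurableSet B) :
    HasLaw (fun ω => ∑ l ∈ Finset.range ω.1, B.indicator (1 : E → ℝ) (ω.2 l))
      ((poissonMeasure (r * (μ B).toNNReal)).map (Nat.cast : ℕ → ℝ)) (poissonSampleLaw r μ) := by
  have hm := measurable_sum_range_fst (measurable_one.indicator hB : Measurable (B.indicator 1))
  refine ⟨hm.aemeasurable, ?_⟩
  have := Measure.isProbabilityMeasure_map (μ := poissonSampleLaw r μ) hm.aemeasurable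
  have := Measure.isProbabilityMeasure_map (μ := poissonMeasure (r * (μ B).toNNReal))
    (f := (Nat.cast : ℕ → ℝ)) .of_discrete
  refine Measure.ext_of_charFun (funext fun t => ?_)
  rw [charFun_map_cast_poissonMeasure, charFun_apply_real,
    integral_map hm.aemeasurable (by fun_prop)]
  have h1 := integral_cexp_sum_poissonSampleLaw r μ (g := fun y => t * B.indicator 1 y)
    ((measurable_one.indicator hB).const_mul _)
  have h2 := integral_cexp_indicator_sum μ (B := fun _ : Fin 1 => B) (fun _ => hB)
    (fun j l h => absurd (Subsingleton.elim j l) h) fun _ => t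
  simp only [Finset.univ_unique, Finset.sum_singleton] at h2
  rw [h2] at h1
  simp_rw [← Finset.mul_sum] at h1
  push_cast at h1 ⊢
  rw [h1, mul_assoc]
  rfl

/-- The exponent of the characteristic functional is additive over disjoint sets, so the joint
characteristic function is the product of the marginal ones. -/
lemma iIndepFun_sum_indicator (r : ℝ≥0) (μ : Measure E) [IsProbabilityMeasure μ] {k : ℕ}
    {B : Fin k → Set E} (hB : ∀ j, MeasurableSet (B j))
    (hd : Pairwise fun j l => Disjoint (B j) (B l)) :
    iIndepFun (fun j (ω : ℕ × (ℕ → E)) =>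
      ∑ l ∈ Finset.range ω.1, (B j).indicator (1 : E → ℝ) (ω.2 l)) (poissonSampleLaw r μ) := by
  have hm : ∀ j, Measurable fun ω : ℕ × (ℕ → E) =>
      ∑ l ∈ Finset.range ω.1, (B j).indicator (1 : E → ℝ) (ω.2 l) := fun j =>
    measurable_sum_range_fst (measurable_one.indicator (hB j))
  rw [iIndepFun_iff_charFun_pi fun j => (hm j).aemeasurable]
  intro t
  have h1 := integral_cexp_sum_poissonSampleLaw r μ (g := fun y => ∑ j, t j * (B j).indicator 1 y)
    (Finset.measurable_sum _ fun j _ => (measurable_one.indicator (hB j)).const_mul _)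
  rw [integral_cexp_indicator_sum μ hB hd] at h1
  have hm' : Measurable fun ω : ℕ × (ℕ → E) => WithLp.toLp 2 fun j : Fin k =>
      ∑ l ∈ Finset.range ω.1, (B j).indicator (1 : E → ℝ) (ω.2 l) :=
    (WithLp.measurable_toLp 2 _).comp (measurable_pi_lambda _ hm)
  rw [charFun_apply, integral_map hm'.aemeasurable (by fun_prop)]
  simp_rw [(hasLaw_sum_indicator r μ (hB _)).map_eq, charFun_map_cast_poissonMeasure]
  rw [← Complex.exp_sum]
  convert h1 using 2
  · ext ω
    rw [Finset.sum_comm, PiLp.inner_apply]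
    simp [Finset.mul_sum]
  · rw [Finset.mul_sum]
    refine Finset.sum_congr rfl fun j _ => ?_
    push_cast
    rw [mul_assoc]
    rfl

/-- A Poisson sample is a Poisson random measure. -/
theorem isPoissonRandomMeasure_pointMeasure (r : ℝ≥0) (μ : Measure E) [IsProbabilityMeasure μ] :
    IsPoissonRandomMeasure (poissonSampleLaw r μ) pointMeasure (r • μ) where
  measurable := measurable_pointMeasure
  integer_valued ω B hB := by
    obtain ⟨k, hk⟩ := pointMeasure_apply_eq_natCast ω hB
    exact ⟨k, by simpa using hk⟩
  poisson B hB _ := by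
    have h : ((r • μ) B).toNNReal = r * (μ B).toNNReal := by
      rw [Measure.smul_apply, ENNReal.smul_def, smul_eq_mul, ENNReal.toNNReal_mul,
        ENNReal.toNNReal_coe]
    have hl := hasLaw_sum_indicator r μ hB
    rw [h]
    have h' : (poissonMeasure (r * (μ B).toNNReal)).map (Nat.cast : ℕ → ℝ≥0∞)
        = ((poissonMeasure (r * (μ B).toNNReal)).map (Nat.cast : ℕ → ℝ)).map ENNReal.ofReal := by
      rw [Measure.map_map (by fun_prop) (by fun_prop)]
      congr 1
      ext k
      simp
    simp_rw [pointMeasure_apply _ hB]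
    exact HasLaw.comp (Y := ENNReal.ofReal) ⟨by fun_prop, h'.symm⟩ hl
  indep k B hB hd := by
    simp_rw [pointMeasure_apply _ (hB _)]
    exact (iIndepFun_sum_indicator r μ hB hd).comp (fun _ => ENNReal.ofReal) fun _ => by fun_prop

end FiniteIntensity

/-! ### Superposition of Poisson random measures -/

section Superposition

/-- Independent variables indexed by pairs may be grouped along the first index. -/
lemma iIndepFun.curry {Ω ι κ 𝓧 : Type*} [MeasurableSpace Ω] {P : Measure Ω} [MeasurableSpace 𝓧]
    {X : ι → κ → Ω → 𝓧} (hm : ∀ i j, Measurable (X i j))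
    (h : iIndepFun (fun (q : ι × κ) => X q.1 q.2) P) : iIndepFun (fun i ω j => X i j ω) P := by
  have := h.isProbabilityMeasure
  rw [iIndepFun_iff_map_fun_eq_infinitePi_map fun i => measurable_pi_lambda _ fun j => hm i j]
  have hq := h.map_fun_eq_infinitePi_map fun q : ι × κ => hm q.1 q.2
  have hprob : ∀ i j, IsProbabilityMeasure (P.map (X i j)) := fun i j =>
    Measure.isProbabilityMeasure_map (hm i j).aemeasurable
  have hc := Measure.infinitePi_map_curry fun i j => P.map (X i j)
  rw [← hq, Measure.map_map (by fun_prop)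
    (measurable_pi_lambda _ fun q : ι × κ => hm q.1 q.2)] at hc
  refine Eq.trans hc ?_
  congr 1
  ext1 i
  exact ((h.precomp (g := fun j => (i, j)) (Prod.mk_right_injective i)).map_fun_eq_infinitePi_map
    fun j => hm i j).symm

lemma poissonMeasure_zero : poissonMeasure 0 = Measure.dirac 0 := by
  refine Measure.ext_of_singleton fun k => ?_
  rw [poissonMeasure_singleton]
  rcases k with _ | k <;> simp

lemma tendsto_poissonMeasure_singleton {u : ℕ → ℝ≥0} {r : ℝ≥0} (hu : Tendsto u atTop (𝓝 r))
    (k : ℕ) : Tendsto (fun M => poissonMeasure (u M) {k}) atTop (𝓝 (poissonMeasure r {k})) := by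
  simp_rw [poissonMeasure_singleton]
  refine (ENNReal.continuous_ofReal.tendsto _).comp ?_
  have hu' : Tendsto (fun M => (u M : ℝ)) atTop (𝓝 r) := (NNReal.continuous_coe.tendsto r).comp hu
  exact (((Real.continuous_exp.tendsto _).comp hu'.neg).mul (hu'.pow k)).div_const _

/-- A probability measure giving the same mass as `μ` to every natural number is `μ`. -/
lemma eq_map_natCast_of_singleton {ν : Measure ℝ≥0∞} [IsProbabilityMeasure ν] {μ : Measure ℕ}
    [IsProbabilityMeasure μ] (h : ∀ k : ℕ, ν {(k : ℝ≥0∞)} = μ {k}) :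
    ν = μ.map (Nat.cast : ℕ → ℝ≥0∞) := by
  have hmeas : Measurable (Nat.cast : ℕ → ℝ≥0∞) := measurable_from_top
  have := Measure.isProbabilityMeasure_map (μ := μ) hmeas.aemeasurable
  refine (Measure.eq_of_le_of_isProbabilityMeasure ?_).symm
  refine Measure.le_iff.2 fun s hs => ?_
  rw [Measure.map_apply hmeas hs, ← Measure.tsum_indicator_apply_singleton μ _ (hmeas hs)]
  calc ∑' k : ℕ, ((Nat.cast : ℕ → ℝ≥0∞) ⁻¹' s).indicator (fun k => μ {k}) k
      = ∑' k : ℕ, ν ({(k : ℝ≥0∞)} ∩ s) := by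
        refine tsum_congr fun k => ?_
        by_cases hk : (k : ℝ≥0∞) ∈ s
        · rw [Set.indicator_of_mem (by exact hk), ← h,
            Set.inter_eq_left.2 (Set.singleton_subset_iff.2 hk)]
        · rw [Set.indicator_of_notMem (by exact hk),
            Set.singleton_inter_eq_empty.2 hk, measure_empty]
    _ = ν (⋃ k : ℕ, {(k : ℝ≥0∞)} ∩ s) := by
        rw [measure_iUnion _ fun k => (measurableSet_singleton _).inter hs]
        intro j k hjk
        refine Set.disjoint_left.2 fun x hx hx' => hjk ?_
        have h1 : x = j := hx.1
        have h2 : x = k := hx'.1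
        exact_mod_cast h1.symm.trans h2
    _ ≤ ν s := measure_mono (Set.iUnion_subset fun k => Set.inter_subset_right)

variable {Ω : Type*} [MeasurableSpace Ω] {P : Measure Ω}

lemma hasLaw_sum_range_poisson [IsProbabilityMeasure P] {X : ℕ → Ω → ℝ≥0∞} {r : ℕ → ℝ≥0}
    (hm : ∀ c, Measurable (X c))
    (hX : ∀ c, HasLaw (X c) ((poissonMeasure (r c)).map (Nat.cast : ℕ → ℝ≥0∞)) P)
    (hind : iIndepFun X P) (M : ℕ) :
    HasLaw (∑ c ∈ Finset.range M, X c)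
      ((poissonMeasure (∑ c ∈ Finset.range M, r c)).map (Nat.cast : ℕ → ℝ≥0∞)) P := by
  induction M with
  | zero =>
    simp only [Finset.range_zero, Finset.sum_empty, poissonMeasure_zero]
    rw [Measure.map_dirac' measurable_from_top]
    exact hasLaw_dirac_of_ae_eq (by simp; rfl)
  | succ M ih =>
    rw [Finset.sum_range_succ, Finset.sum_range_succ]
    exact (hind.indepFun_finsetSum_of_notMem hm Finset.notMem_range_self)
      |>.hasLaw_add_map_cast_poissonMeasure ih (hX M)

/-- A convergent countable sum of independent Poisson variables is Poisson. -/
lemma hasLaw_tsum_poisson [IsProbabilityMeasure P] {X : ℕ → Ω → ℝ≥0∞} {r : ℕ → ℝ≥0} {s : ℝ≥0}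
    (hm : ∀ c, Measurable (X c))
    (hX : ∀ c, HasLaw (X c) ((poissonMeasure (r c)).map (Nat.cast : ℕ → ℝ≥0∞)) P)
    (hind : iIndepFun X P) (hr : HasSum r s) :
    HasLaw (fun ω => ∑' c, X c ω) ((poissonMeasure s).map (Nat.cast : ℕ → ℝ≥0∞)) P := by
  have hnat : Measurable (Nat.cast : ℕ → ℝ≥0∞) := measurable_from_top
  have hmt : Measurable fun ω => ∑' c, X c ω := Measurable.tsum hm
  have hmS : ∀ M, Measurable fun ω => ∑ c ∈ Finset.range M, X c ω := fun M =>
    Finset.measurable_sum _ fun c _ => hm c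
  have hS : ∀ M, HasLaw (fun ω => ∑ c ∈ Finset.range M, X c ω)
      ((poissonMeasure (∑ c ∈ Finset.range M, r c)).map (Nat.cast : ℕ → ℝ≥0∞)) P := fun M => by
    have := hasLaw_sum_range_poisson hm hX hind M
    rwa [Finset.sum_fn] at this
  -- Partial sums are almost surely natural numbers, so their convergence to `k` means that they are
  -- eventually equal to `k`.
  have hint : ∀ᵐ ω ∂P, ∀ M, ∃ k : ℕ, ∑ c ∈ Finset.range M, X c ω = k := by
    refine ae_all_iff.2 fun M => ?_
    have hset : MeasurableSet (Set.range (Nat.cast : ℕ → ℝ≥0∞)) :=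
      (Set.countable_range _).measurableSet
    have : ∀ᵐ x ∂((poissonMeasure (∑ c ∈ Finset.range M, r c)).map (Nat.cast : ℕ → ℝ≥0∞)),
        x ∈ Set.range (Nat.cast : ℕ → ℝ≥0∞) :=
      (ae_map_iff hnat.aemeasurable hset).2 (ae_of_all _ fun k => ⟨k, rfl⟩)
    rw [← (hS M).map_eq] at this
    filter_upwards [ae_of_ae_map (hmS M).aemeasurable this] with ω hω
    obtain ⟨k, hk⟩ := hω
    exact ⟨k, hk.symm⟩
  have hprob := Measure.isProbabilityMeasure_map (μ := P) hmt.aemeasurable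
  refine ⟨hmt.aemeasurable, eq_map_natCast_of_singleton fun k => ?_⟩
  rw [Measure.map_apply hmt (measurableSet_singleton _)]
  have hlim : Tendsto (fun M => P ((fun ω => ∑ c ∈ Finset.range M, X c ω) ⁻¹' {(k : ℝ≥0∞)}))
      atTop (𝓝 (P ((fun ω => ∑' c, X c ω) ⁻¹' {(k : ℝ≥0∞)}))) := by
    refine tendsto_measure_of_ae_tendsto_indicator atTop (hmt (measurableSet_singleton _))
      (fun M => hmS M (measurableSet_singleton _)) MeasurableSet.univ (measure_ne_top _ _)
      (.of_forall fun M => Set.subset_univ _) ?_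
    filter_upwards [hint] with ω hω
    have ht : Tendsto (fun M => ∑ c ∈ Finset.range M, X c ω) atTop (𝓝 (∑' c, X c ω)) :=
      ENNReal.summable.hasSum.tendsto_sum_nat
    by_cases hk : ∑' c, X c ω = k
    · rw [hk] at ht
      -- The extended naturals other than `k` form a closed subset of `ℝ≥0∞`; its complement is the
      -- neighbourhood sought.
      have : ∀ᶠ x : ℝ≥0∞ in 𝓝 (k : ℝ≥0∞), ∀ j : ℕ, x = j → x = k := by
        have h1 : IsClosed (ENat.toENNReal '' {(k : ℕ∞)}ᶜ) :=
          ENat.isClosedEmbedding_toENNReal.isClosedMap _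
            (ENat.isOpen_singleton (ENat.natCast_ne_top k)).isClosed_compl
        have h2 : (k : ℝ≥0∞) ∈ (ENat.toENNReal '' {(k : ℕ∞)}ᶜ)ᶜ := by
          rintro ⟨x, hx, hxk⟩
          exact hx (ENat.toENNReal_strictMono.injective (by simpa using hxk))
        filter_upwards [h1.isOpen_compl.mem_nhds h2] with x hx j hj
        by_contra hne
        exact hx ⟨j, fun h => hne (by rw [hj]; exact_mod_cast congrArg ENat.toENNReal h),
          by simp [hj]⟩
      filter_upwards [ht.eventually this] with M hM
      obtain ⟨j, hj⟩ := hω M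
      simp [hk, hM j hj]
    · filter_upwards [ht.eventually (isOpen_compl_singleton.mem_nhds hk)] with M hM
      exact iff_of_false hM hk
  refine tendsto_nhds_unique hlim ?_
  have := tendsto_poissonMeasure_singleton hr.tendsto_sum_nat k
  refine this.congr fun M => ?_
  rw [← Measure.map_apply (hmS M) (measurableSet_singleton _), (hS M).map_eq,
    Measure.map_apply hnat (measurableSet_singleton _)]
  congr 1
  ext j
  simp

variable {E : Type*} [MeasurableSpace E]

/-- Closedness passes integrality from partial sums to an infinite superposition. -/
lemma isClosed_range_toENNReal : IsClosed (Set.range ENat.toENNReal) :=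
  ENat.isClosedEmbedding_toENNReal.isClosed_range

/-- The superposition of independent Poisson random measures is a Poisson random measure. -/
theorem IsPoissonRandomMeasure.sum [IsProbabilityMeasure P] {N : ℕ → Ω → Measure E}
    {m : ℕ → Measure E} (h : ∀ c, IsPoissonRandomMeasure P (N c) (m c)) (hind : iIndepFun N P) :
    IsPoissonRandomMeasure P (fun ω => Measure.sum fun c => N c ω) (Measure.sum m) where
  measurable := by
    refine Measure.measurable_of_measurable_coe _ fun B hB => ?_
    simp_rw [Measure.sum_apply _ hB]
    exact Measurable.tsum fun c => (Measure.measurable_coe hB).comp (h c).measurable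
  integer_valued ω B hB := by
    rw [Measure.sum_apply _ hB]
    have : ∑' c, N c ω B ∈ Set.range ENat.toENNReal := by
      refine isClosed_range_toENNReal.mem_of_tendsto
        (ENNReal.summable (f := fun c => N c ω B)).hasSum.tendsto_sum_nat (.of_forall fun M => ?_)
      choose k hk using fun c => (h c).integer_valued ω B hB
      simp_rw [hk]
      exact ⟨∑ c ∈ Finset.range M, k c, map_sum ENat.toENNRealRingHom _ _⟩
    obtain ⟨k, hk⟩ := this
    exact ⟨k, hk.symm⟩
  poisson B hB hfin := by
    simp_rw [Measure.sum_apply _ hB] at hfin ⊢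
    have hc : ∀ c, m c B ≠ ∞ := ENNReal.ne_top_of_tsum_ne_top hfin
    refine hasLaw_tsum_poisson (r := fun c => (m c B).toNNReal)
      (fun c => (Measure.measurable_coe hB).comp (h c).measurable)
      (fun c => (h c).poisson B hB (hc c))
      (hind.comp (fun _ μ => μ B) fun _ => Measure.measurable_coe hB) ?_
    rw [ENNReal.tsum_toNNReal_eq hc]
    refine Summable.hasSum ?_
    rw [← ENNReal.tsum_coe_ne_top_iff_summable]
    simpa [ENNReal.coe_toNNReal (hc _)] using hfin
  indep k B hB hd := by
    have hm : ∀ c j, Measurable fun ω => N c ω (B j) := fun c j =>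
      (Measure.measurable_coe (hB j)).comp (h c).measurable
    -- Independence across components and, within each, across disjoint sets gives independence over
    -- all pairs. These are then regrouped by set and summed over components.
    have h1 : iIndepFun (fun (q : Fin k × ℕ) ω => N q.2 ω (B q.1)) P := by
      refine (iIndepFun_uncurry' (X := fun c j ω => N c ω (B j)) hm ?_
        fun c => (h c).indep k B hB hd).precomp (g := Prod.swap) Prod.swap_injective
      exact hind.comp (fun _ μ j => μ (B j))
        fun _ => measurable_pi_lambda _ fun j => Measure.measurable_coe (hB j)
    have h2 : iIndepFun (fun (j : Fin k) ω (c : ℕ) => N c ω (B j)) P :=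
      iIndepFun.curry (X := fun j c ω => N c ω (B j)) (fun j c => hm c j) h1
    simp_rw [Measure.sum_apply _ (hB _)]
    exact h2.comp (fun _ x => ∑' c, x c)
      fun _ => Measurable.tsum fun c => measurable_pi_apply c

lemma IsPoissonRandomMeasure.comp_measurePreserving {Ω' : Type*} [MeasurableSpace Ω']
    {P' : Measure Ω'} {N : Ω → Measure E} {m : Measure E} (h : IsPoissonRandomMeasure P N m)
    {f : Ω' → Ω} (hf : MeasurePreserving f P' P) :
    IsPoissonRandomMeasure P' (fun ω => N (f ω)) m where
  measurable := h.measurable.comp hf.measurable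
  integer_valued ω := h.integer_valued (f ω)
  poisson B hB hfin := (h.poisson B hB hfin).comp hf.hasLaw
  indep k B hB hd := by
    have h1 := h.indep k B hB hd
    rw [iIndepFun_iff_measure_inter_preimage_eq_mul] at h1 ⊢
    intro S sets hS
    have hm : ∀ j, j ∈ S → MeasurableSet ((fun ω => N ω (B j)) ⁻¹' sets j) := fun j hj =>
      ((Measure.measurable_coe (hB j)).comp h.measurable) (hS j hj)
    have h2 := h1 S hS
    rw [← hf.measure_preimage (S.measurableSet_biInter hm).nullMeasurableSet] at h2
    rw [Finset.prod_congr rfl fun j hj =>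
      (hf.measure_preimage (hm j hj).nullMeasurableSet).symm] at h2
    simp only [Set.preimage_iInter] at h2
    exact h2

lemma isPoissonRandomMeasure_zero [IsProbabilityMeasure P] :
    IsPoissonRandomMeasure P (fun _ => (0 : Measure E)) 0 where
  measurable := measurable_const
  integer_valued _ _ _ := ⟨0, by simp⟩
  poisson B _ _ := by
    simp only [Measure.coe_zero, Pi.zero_apply, ENNReal.toNNReal_zero, poissonMeasure_zero]
    rw [Measure.map_dirac' measurable_from_top]
    exact hasLaw_dirac_of_ae_eq (by simp)
  indep k B _ _ := by
    rw [iIndepFun_iff_measure_inter_preimage_eq_mul]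
    intro S sets _
    by_cases h : ∀ j ∈ S, (0 : ℝ≥0∞) ∈ sets j
    · rw [Finset.prod_eq_one fun j hj => by simp [h j hj]]
      have : ⋂ i ∈ S, (fun _ : Ω => (0 : Measure E) (B i)) ⁻¹' sets i = Set.univ := by
        simp only [Set.iInter_eq_univ]
        exact fun j hj => by simp [h j hj]
      rw [this, measure_univ]
    · push Not at h
      obtain ⟨j, hj, hj0⟩ := h
      rw [Finset.prod_eq_zero hj (by simp [hj0])]
      exact measure_mono_null (Set.biInter_subset_of_mem hj) (by simp [hj0])

/-- Every finite measure is the intensity of a Poisson random measure. -/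
theorem exists_isPoissonRandomMeasure_of_isFiniteMeasure {E : Type} [MeasurableSpace E]
    (m : Measure E) [IsFiniteMeasure m] :
    ∃ (Ω : Type) (_ : MeasurableSpace Ω) (P : Measure Ω) (N : Ω → Measure E),
      IsProbabilityMeasure P ∧ IsPoissonRandomMeasure P N m := by
  by_cases hm : m = 0
  · subst hm
    exact ⟨Unit, inferInstance, Measure.dirac (), _, inferInstance, isPoissonRandomMeasure_zero⟩
  · have : NeZero m := ⟨hm⟩
    set r := (m Set.univ).toNNReal
    have hr : (r : ℝ≥0∞) = m Set.univ := ENNReal.coe_toNNReal (measure_ne_top m _)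
    have hμ : IsProbabilityMeasure ((m Set.univ)⁻¹ • m) := inferInstance
    refine ⟨_, inferInstance, poissonSampleLaw r ((m Set.univ)⁻¹ • m), pointMeasure,
      inferInstance, ?_⟩
    have h := isPoissonRandomMeasure_pointMeasure r ((m Set.univ)⁻¹ • m)
    have hs : r • ((m Set.univ)⁻¹ • m) = m := by
      refine Measure.ext fun B _ => ?_
      rw [Measure.smul_apply, Measure.smul_apply, ENNReal.smul_def, smul_eq_mul, smul_eq_mul, hr,
        ← mul_assoc, ENNReal.mul_inv_cancel (by simpa using hm) (measure_ne_top m _), one_mul]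
    rwa [hs] at h

/-- Every s-finite measure is the intensity of a Poisson random measure. -/
theorem exists_isPoissonRandomMeasure {E : Type} [MeasurableSpace E] (m : Measure E) [SFinite m] :
    ∃ (Ω : Type) (_ : MeasurableSpace Ω) (P : Measure Ω) (N : Ω → Measure E),
      IsProbabilityMeasure P ∧ IsPoissonRandomMeasure P N m := by
  choose Ω hΩ P N hP hN using fun c =>
    exists_isPoissonRandomMeasure_of_isFiniteMeasure (sfiniteSeq m c)
  refine ⟨∀ c, Ω c, inferInstance, Measure.infinitePi P,
    fun ω => Measure.sum fun c => N c (ω c), inferInstance, ?_⟩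
  have hind : iIndepFun (fun c (ω : ∀ c, Ω c) => N c (ω c)) (Measure.infinitePi P) :=
    iIndepFun_infinitePi fun c => (hN c).measurable
  have h := IsPoissonRandomMeasure.sum
    (fun c => (hN c).comp_measurePreserving (measurePreserving_eval_infinitePi P c)) hind
  rw [sum_sfiniteSeq] at h
  exact h

end Superposition

/-! ### Deterministic analysis of the dynamics -/

section Dynamics

variable {n : ℕ}

/-- A move is an arrival (`Sum.inl i`) or a departure (`Sum.inr i`) at rank `i`. It is enabled in
the configuration `y` if it preserves the order. -/
def enabled (d : Fin n ⊕ Fin n) (y : Fin n → ℕ) : Prop :=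
  match d with
  | .inl i => (y i : ℕ∞) < rankAbove y i
  | .inr i => rankBelow y i < y i

open Classical in
/-- The configuration after the move `d` has been attempted in the configuration `y`. -/
noncomputable def step (d : Fin n ⊕ Fin n) (y : Fin n → ℕ) : Fin n → ℕ :=
  if enabled d y then
    match d with
    | .inl i => Function.update y i (y i + 1)
    | .inr i => Function.update y i (y i - 1)
  else y

-- The increment is split as in the equation, arrivals minus departures, so that it matches
-- `netMoves`.
open Classical in
lemma step_apply (d : Fin n ⊕ Fin n) (y : Fin n → ℕ) (i : Fin n) :
    (step d y i : ℝ) = y i + (if d = .inl i ∧ enabled d y then 1 else 0)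
      - (if d = .inr i ∧ enabled d y then 1 else 0) := by
  by_cases h : enabled d y
  swap
  · simp [step, h]
  rcases d with j | j <;> by_cases hij : j = i
  · subst hij; simp [step, h]
  · simp [step, h, Function.update_of_ne (Ne.symm hij), hij]
  · subst hij
    have : 1 ≤ y j := Nat.one_le_iff_ne_zero.2 (Nat.ne_zero_of_lt h)
    simp [step, h, this]
  · simp [step, h, Function.update_of_ne (Ne.symm hij), hij]

/-- The points at times in `B` of the driver of the move `d` that lie below its rate. -/
def activePoints (r : Fin n ⊕ Fin n → ℝ) (d : Fin n ⊕ Fin n) (B : Set ℝ≥0) : Set (ℝ≥0 × ℝ≥0) :=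
  {p | p.1 ∈ B ∧ (p.2 : ℝ) ≤ r d}

lemma measurableSet_activePoints (r : Fin n ⊕ Fin n → ℝ) (d : Fin n ⊕ Fin n) {B : Set ℝ≥0}
    (hB : MeasurableSet B) : MeasurableSet (activePoints r d B) :=
  (measurable_fst hB).inter
    (measurableSet_le (measurable_coe_nnreal_real.comp measurable_snd) measurable_const)

lemma activePoints_mono (r : Fin n ⊕ Fin n → ℝ) (d : Fin n ⊕ Fin n) {B C : Set ℝ≥0} (h : B ⊆ C) :
    activePoints r d B ⊆ activePoints r d C :=
  fun _ hp => ⟨h hp.1, hp.2⟩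

/-- The measure on the time axis formed by the active points of the driver `d`. -/
noncomputable def timeMeasure (r : Fin n ⊕ Fin n → ℝ) (N : Fin n ⊕ Fin n → Measure (ℝ≥0 × ℝ≥0))
    (d : Fin n ⊕ Fin n) : Measure ℝ≥0 :=
  ((N d).restrict {p | (p.2 : ℝ) ≤ r d}).map Prod.fst

lemma timeMeasure_apply (r : Fin n ⊕ Fin n → ℝ) (N : Fin n ⊕ Fin n → Measure (ℝ≥0 × ℝ≥0))
    (d : Fin n ⊕ Fin n) {B : Set ℝ≥0} (hB : MeasurableSet B) :
    timeMeasure r N d B = N d (activePoints r d B) := by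
  rw [timeMeasure, Measure.map_apply measurable_fst hB,
    Measure.restrict_apply (measurable_fst hB)]
  rfl

/-- The points up to time `t` of the driver of the move `d` that are used by the path `Y`. -/
def usedPoints (r : Fin n ⊕ Fin n → ℝ) (Y : ℝ≥0 → Fin n → ℕ) (d : Fin n ⊕ Fin n) (t : ℝ≥0) :
    Set (ℝ≥0 × ℝ≥0) :=
  {p | p.1 ≤ t ∧ (p.2 : ℝ) ≤ r d ∧ enabled d (Function.leftLim Y p.1)}

lemma usedPoints_subset (r : Fin n ⊕ Fin n → ℝ) (Y : ℝ≥0 → Fin n → ℕ) (d : Fin n ⊕ Fin n)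
    (t : ℝ≥0) : usedPoints r Y d t ⊆ activePoints r d (Set.Iic t) :=
  fun _ hp => ⟨hp.1, hp.2.1⟩

/-- The net number of used points that act on rank `i` up to time `t`. -/
noncomputable def netMoves (r : Fin n ⊕ Fin n → ℝ) (N : Fin n ⊕ Fin n → Measure (ℝ≥0 × ℝ≥0))
    (Y : ℝ≥0 → Fin n → ℕ) (i : Fin n) (t : ℝ≥0) : ℝ :=
  (N (.inl i)).real (usedPoints r Y (.inl i) t) - (N (.inr i)).real (usedPoints r Y (.inr i) t)

/-- The path `Y` solves the equation of the system driven by the point measures `N`. -/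
def IsPausePath (r : Fin n ⊕ Fin n → ℝ) (N : Fin n ⊕ Fin n → Measure (ℝ≥0 × ℝ≥0))
    (Y : ℝ≥0 → Fin n → ℕ) : Prop :=
  ∀ t i, (Y t i : ℝ) = Y 0 i + netMoves r N Y i t

/-- The numbers of active points of the drivers during `(s, t]`. -/
noncomputable def counts (r : Fin n ⊕ Fin n → ℝ) (N : Fin n ⊕ Fin n → Measure (ℝ≥0 × ℝ≥0))
    (s t : ℝ≥0) (d : Fin n ⊕ Fin n) : ℝ≥0∞ :=
  N d (activePoints r d (Set.Ioc s t))

/-- There is at most one active point among all drivers. -/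
def AtMostOne (C : Fin n ⊕ Fin n → ℝ≥0∞) : Prop := C = 0 ∨ ∃ d, C = Pi.single d 1

open Classical in
/-- The unique move, if any, encoded by the numbers of active points. -/
noncomputable def outcome (C : Fin n ⊕ Fin n → ℝ≥0∞) : Option (Fin n ⊕ Fin n) :=
  if h : ∃ d, C = Pi.single d 1 then some h.choose else none

lemma outcome_eq_some_iff {C : Fin n ⊕ Fin n → ℝ≥0∞} {d : Fin n ⊕ Fin n} :
    outcome C = some d ↔ C = Pi.single d 1 := by
  classical
  unfold outcome
  split_ifs with h
  · rw [Option.some_inj]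
    refine ⟨fun hd => hd ▸ h.choose_spec, fun hC => ?_⟩
    have h1 := h.choose_spec.symm.trans hC
    by_contra hne
    have h2 := congrFun h1 h.choose
    rw [Pi.single_eq_same, Pi.single_eq_of_ne hne] at h2
    exact one_ne_zero h2
  · simp only [false_iff]
    exact fun hC => h ⟨d, hC⟩

lemma outcome_zero : outcome (0 : Fin n ⊕ Fin n → ℝ≥0∞) = none := by
  refine Option.eq_none_iff_forall_not_mem.2 fun d hd => ?_
  have h := congrFun (outcome_eq_some_iff.1 hd) d
  simp at h

/-- The effect of an outcome on a configuration. -/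
noncomputable def applyOutcome (e : Option (Fin n ⊕ Fin n)) (y : Fin n → ℕ) : Fin n → ℕ :=
  e.elim y fun d => step d y

/-- Iterated effect of a sequence of outcomes. -/
noncomputable def applyOutcomes (e : ℕ → Option (Fin n ⊕ Fin n)) (y : Fin n → ℕ) :
    ℕ → Fin n → ℕ
  | 0 => y
  | k + 1 => applyOutcome (e k) (applyOutcomes e y k)

variable {r : Fin n ⊕ Fin n → ℝ} {N : Fin n ⊕ Fin n → Measure (ℝ≥0 × ℝ≥0)} {Y : ℝ≥0 → Fin n → ℕ}

-- Within `(s, t]` only time `τ` carries active points, and whether they are used depends on the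
-- single left limit at `τ`.
open Classical in
lemma measureReal_usedPoints_of_isolated {d : Fin n ⊕ Fin n} {s t τ : ℝ≥0}
    (hfin : N d (activePoints r d (Set.Iic t)) ≠ ∞) (hs : s < τ) (ht : τ ≤ t)
    (h0 : N d (activePoints r d (Set.Ioc s t \ {τ})) = 0) :
    (N d).real (usedPoints r Y d t) = (N d).real (usedPoints r Y d s)
      + if enabled d (Function.leftLim Y τ) then (N d).real (activePoints r d {τ}) else 0 := by
  have hfin' : N d (usedPoints r Y d t) ≠ ∞ :=
    measure_ne_top_of_subset (usedPoints_subset r Y d t) hfin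
  have hm : MeasurableSet {p : ℝ≥0 × ℝ≥0 | p.1 ≤ s} := measurable_fst measurableSet_Iic
  rw [← measureReal_inter_add_sdiff hm hfin']
  congr 1
  · congr 1
    ext p
    simp only [usedPoints, Set.mem_inter_iff, Set.mem_ofPred_eq]
    constructor
    · rintro ⟨⟨_, h2⟩, h3⟩; exact ⟨h3, h2⟩
    · rintro ⟨h3, h2⟩; exact ⟨⟨h3.trans (hs.le.trans ht), h2⟩, h3⟩
  · have hsub : usedPoints r Y d t \ {p | p.1 ≤ s} ⊆
        {p | p ∈ activePoints r d {τ} ∧ enabled d (Function.leftLim Y τ)}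
          ∪ activePoints r d (Set.Ioc s t \ {τ}) := by
      rintro p ⟨⟨h1, h2, h3⟩, h4⟩
      by_cases hp : p.1 = τ
      · exact .inl ⟨⟨hp, h2⟩, hp ▸ h3⟩
      · exact .inr ⟨⟨⟨not_le.1 h4, h1⟩, hp⟩, h2⟩
    have hsup : {p | p ∈ activePoints r d {τ} ∧ enabled d (Function.leftLim Y τ)} ⊆
        usedPoints r Y d t \ {p | p.1 ≤ s} := by
      rintro p ⟨⟨h1, h2⟩, h3⟩
      have h1 : p.1 = τ := h1
      exact ⟨⟨h1 ▸ ht, h2, h1 ▸ h3⟩, by simpa [h1] using hs⟩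
    have heq : N d (usedPoints r Y d t \ {p | p.1 ≤ s})
        = N d {p | p ∈ activePoints r d {τ} ∧ enabled d (Function.leftLim Y τ)} := by
      refine le_antisymm ?_ (measure_mono hsup)
      refine (measure_mono hsub).trans ((measure_union_le _ _).trans ?_)
      rw [h0, add_zero]
    rw [measureReal_def, heq, ← measureReal_def]
    split_ifs with h <;> simp [h]

/-- The net effect on rank `i` of a unique active point at time `τ` of `(s, t]`. -/
lemma netMoves_of_isolated {d₀ : Fin n ⊕ Fin n} {s t τ : ℝ≥0}
    (hfin : ∀ d, N d (activePoints r d (Set.Iic t)) ≠ ∞) (hs : s < τ) (ht : τ ≤ t)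
    (h0 : ∀ d, N d (activePoints r d (Set.Ioc s t \ {τ})) = 0)
    (h1 : ∀ d, N d (activePoints r d {τ}) = (Pi.single d₀ 1 : Fin n ⊕ Fin n → ℝ≥0∞) d)
    (i : Fin n) :
    netMoves r N Y i t = netMoves r N Y i s
      + (step d₀ (Function.leftLim Y τ) i - Function.leftLim Y τ i) := by
  classical
  have key : ∀ d, (N d).real (usedPoints r Y d t) = (N d).real (usedPoints r Y d s)
      + if d₀ = d ∧ enabled d₀ (Function.leftLim Y τ) then 1 else 0 := by
    intro d
    rw [measureReal_usedPoints_of_isolated (hfin d) hs ht (h0 d),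
      measureReal_def (N d) (activePoints r d {τ}), h1]
    congr 1
    by_cases hd : d₀ = d
    · subst hd; simp
    · simp [hd]
  rw [netMoves, netMoves, key, key, step_apply]
  ring

lemma netMoves_of_null {s t : ℝ≥0} (hst : s ≤ t)
    (hfin : ∀ d, N d (activePoints r d (Set.Iic t)) ≠ ∞)
    (h0 : ∀ d, N d (activePoints r d (Set.Ioc s t)) = 0) (i : Fin n) :
    netMoves r N Y i t = netMoves r N Y i s := by
  classical
  rcases hst.eq_or_lt with rfl | hst
  · rfl
  have key : ∀ d, (N d).real (usedPoints r Y d t) = (N d).real (usedPoints r Y d s) := by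
    intro d
    -- The isolated-point formula is applied with `τ = t`, where the atom is null as well.
    rw [measureReal_usedPoints_of_isolated (hfin d) hst le_rfl
      (measure_mono_null (activePoints_mono r d Set.sdiff_subset) (h0 d)),
      measureReal_def (N d) (activePoints r d {t}), measure_mono_null (activePoints_mono r d
        (Set.singleton_subset_iff.2 (Set.right_mem_Ioc.2 hst))) (h0 d)]
    simp
  rw [netMoves, netMoves, key, key]

lemma IsPausePath.eq_of_null (hY : IsPausePath r N Y) {s t : ℝ≥0} (hst : s ≤ t)
    (hfin : ∀ d, N d (activePoints r d (Set.Iic t)) ≠ ∞)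
    (h0 : ∀ d, N d (activePoints r d (Set.Ioc s t)) = 0) : Y t = Y s := by
  ext i
  have h : (Y t i : ℝ) = Y s i := by rw [hY t, hY s, netMoves_of_null hst hfin h0]
  exact_mod_cast h

lemma leftLim_eq_of_eqOn {Y : ℝ≥0 → Fin n → ℕ} {s τ : ℝ≥0} {y : Fin n → ℕ} (hs : s < τ)
    (h : ∀ u, s ≤ u → u < τ → Y u = y) : Function.leftLim Y τ = y := by
  have : (𝓝[<] τ).NeBot := nhdsLT_neBot_of_exists_lt ⟨s, hs⟩
  refine leftLim_eq_of_tendsto (tendsto_nhds_of_eventually_eq ?_)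
  filter_upwards [Ico_mem_nhdsLT hs] with u hu
  exact h u hu.1 hu.2

/-- No active point lies in `(s, τ)`, so the path still equals `Y s` just before `τ`. This
identifies the left limit that decides whether the move is enabled. -/
lemma IsPausePath.eq_step_of_isolated (hY : IsPausePath r N Y) {d₀ : Fin n ⊕ Fin n}
    {s t τ : ℝ≥0} (hfin : ∀ d, N d (activePoints r d (Set.Iic t)) ≠ ∞) (hs : s < τ) (ht : τ ≤ t)
    (h0 : ∀ d, N d (activePoints r d (Set.Ioc s t \ {τ})) = 0)
    (h1 : ∀ d, N d (activePoints r d {τ}) = (Pi.single d₀ 1 : Fin n ⊕ Fin n → ℝ≥0∞) d) :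
    Y t = step d₀ (Y s) := by
  have hlim : Function.leftLim Y τ = Y s := by
    refine leftLim_eq_of_eqOn hs fun u hu huτ => hY.eq_of_null hu (fun d => ?_) fun d => ?_
    · exact measure_ne_top_of_subset
        (activePoints_mono r d (Set.Iic_subset_Iic.2 (huτ.le.trans ht))) (hfin d)
    · exact measure_mono_null (activePoints_mono r d (B := Set.Ioc s u)
        (C := Set.Ioc s t \ {τ}) fun v hv =>
          ⟨⟨hv.1, hv.2.trans (huτ.le.trans ht)⟩, (hv.2.trans_lt huτ).ne⟩) (h0 d)
  ext i
  have h : (Y t i : ℝ) = step d₀ (Y s) i := by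
    rw [hY t, netMoves_of_isolated hfin hs ht h0 h1, hlim, hY s]; ring
  exact_mod_cast h

/-- An integer valued measure with mass one on an interval has a single atom there. -/
lemma exists_atom_of_apply_eq_one {ν : Measure ℝ≥0}
    (hint : ∀ B, MeasurableSet B → ∃ k : ℕ∞, ν B = (k : ℝ≥0∞)) {B : Set ℝ≥0} (hB : MeasurableSet B)
    (h1 : ν B = 1) : ∃ τ ∈ B, ν {τ} = 1 ∧ ν (B \ {τ}) = 0 := by
  -- Restricted to `B` the measure takes only the values zero and one, hence is a Dirac mass.
  have hz : IsZeroOneMeasure (ν.restrict B) := by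
    refine ⟨fun s hs => ?_⟩
    rw [Measure.restrict_apply hs]
    obtain ⟨k, hk⟩ := hint _ (hs.inter hB)
    have hle : (k : ℝ≥0∞) ≤ ((1 : ℕ∞) : ℝ≥0∞) := by
      rw [← hk, ENat.toENNReal_one, ← h1]
      exact measure_mono Set.inter_subset_right
    rw [hk]
    rcases Order.le_one_iff.1 (ENat.toENNReal_le.1 hle) with h | h <;> simp [h]
  have hne : NeZero (ν.restrict B) := ⟨by
    rw [Ne, Measure.restrict_eq_zero, h1]; exact one_ne_zero⟩
  obtain ⟨τ, hτ⟩ := IsZeroOneMeasure.exists_eq_dirac (μ := ν.restrict B)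
  have hmem : τ ∈ B := by
    have := Measure.restrict_apply (μ := ν) (s := B) hB.compl
    rw [Set.compl_inter_self, measure_empty, hτ, Measure.dirac_apply' _ hB.compl] at this
    by_contra hn
    simp [hn] at this
  have h2 : ν {τ} = 1 := by
    have := Measure.restrict_apply (μ := ν) (s := B) (measurableSet_singleton τ)
    rwa [hτ, Set.inter_eq_left.2 (Set.singleton_subset_iff.2 hmem), Measure.dirac_apply' _
      (measurableSet_singleton τ), Set.indicator_of_mem (Set.mem_singleton τ), Pi.one_apply, eq_comm] at this
  refine ⟨τ, hmem, h2, ?_⟩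
  rw [measure_sdiff (Set.singleton_subset_iff.2 hmem)
    (measurableSet_singleton τ).nullMeasurableSet (by simp [h2]), h1, h2, tsub_self]

/-- Integer valued point measures. -/
def IntegerValued (N : Fin n ⊕ Fin n → Measure (ℝ≥0 × ℝ≥0)) : Prop :=
  ∀ d B, MeasurableSet B → ∃ k : ℕ∞, N d B = (k : ℝ≥0∞)

lemma IntegerValued.exists_isolated (hN : IntegerValued N) {d₀ : Fin n ⊕ Fin n} {s t : ℝ≥0}
    (hC : counts r N s t = Pi.single d₀ 1) :
    ∃ τ, s < τ ∧ τ ≤ t ∧ (∀ d, N d (activePoints r d (Set.Ioc s t \ {τ})) = 0) ∧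
      ∀ d, N d (activePoints r d {τ}) = (Pi.single d₀ 1 : Fin n ⊕ Fin n → ℝ≥0∞) d := by
  have hint : ∀ B, MeasurableSet B → ∃ k : ℕ∞, timeMeasure r N d₀ B = (k : ℝ≥0∞) := fun B hB => by
    rw [timeMeasure_apply _ _ _ hB]
    exact hN d₀ _ (measurableSet_activePoints r d₀ hB)
  have h1 : timeMeasure r N d₀ (Set.Ioc s t) = 1 := by
    rw [timeMeasure_apply _ _ _ measurableSet_Ioc]
    exact (congrFun hC d₀).trans (Pi.single_eq_same _ _)
  obtain ⟨τ, hτ, h2, h3⟩ := exists_atom_of_apply_eq_one hint measurableSet_Ioc h1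
  rw [timeMeasure_apply _ _ _ (measurableSet_singleton τ)] at h2
  rw [timeMeasure_apply _ _ _ (measurableSet_Ioc.diff (measurableSet_singleton τ))] at h3
  have hne : ∀ d, d ≠ d₀ → N d (activePoints r d (Set.Ioc s t)) = 0 := fun d hd =>
    (congrFun hC d).trans (Pi.single_eq_of_ne hd _)
  refine ⟨τ, hτ.1, hτ.2, fun d => ?_, fun d => ?_⟩ <;> by_cases hd : d = d₀
  · rw [hd, h3]
  · exact measure_mono_null (activePoints_mono r d Set.sdiff_subset) (hne d hd)
  · rw [hd, h2, Pi.single_eq_same]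
  · rw [Pi.single_eq_of_ne hd]
    exact measure_mono_null (activePoints_mono r d (Set.singleton_subset_iff.2 hτ)) (hne d hd)

/-- On a cell with at most one active point, the final value depends only on the initial value and
the counts, not on the position of the point. -/
lemma IsPausePath.eq_applyOutcome (hY : IsPausePath r N Y) (hN : IntegerValued N) {s t : ℝ≥0}
    (hst : s ≤ t) (hfin : ∀ d, N d (activePoints r d (Set.Iic t)) ≠ ∞)
    (hC : AtMostOne (counts r N s t)) : Y t = applyOutcome (outcome (counts r N s t)) (Y s) := by
  rcases hC with hC | ⟨d₀, hC⟩
  · rw [hC, outcome_zero]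
    exact hY.eq_of_null hst hfin fun d => congrFun hC d
  · obtain ⟨τ, hs, ht, h0, h1⟩ := hN.exists_isolated hC
    rw [outcome_eq_some_iff.2 hC]
    exact hY.eq_step_of_isolated hfin hs ht h0 h1

lemma IsPausePath.eq_applyOutcomes (hY : IsPausePath r N Y) (hN : IntegerValued N) {s : ℕ → ℝ≥0}
    (hs0 : s 0 = 0) (hs : Monotone s) {m : ℕ}
    (hfin : ∀ d, N d (activePoints r d (Set.Iic (s m))) ≠ ∞)
    (hC : ∀ k < m, AtMostOne (counts r N (s k) (s (k + 1)))) :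
    Y (s m) = applyOutcomes (fun k => outcome (counts r N (s k) (s (k + 1)))) (Y 0) m := by
  induction m with
  | zero => rw [hs0]; rfl
  | succ m ih =>
    rw [applyOutcomes, ← ih (fun d => measure_ne_top_of_subset (activePoints_mono r d
      (Set.Iic_subset_Iic.2 (hs m.le_succ))) (hfin d)) fun k hk => hC k (hk.trans m.lt_succ_self)]
    exact hY.eq_applyOutcome hN (hs m.le_succ) hfin (hC m m.lt_succ_self)

end Dynamics

/-! ### Construction of solution paths -/

section LocallyFinite

variable {J : Set ℝ≥0}

/-- The number of event times up to time `t`. -/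
noncomputable def eventCount (J : Set ℝ≥0) (t : ℝ≥0) : ℕ := (J ∩ Set.Iic t).ncard

lemma exists_lt_inter_Ioo_eq_empty (hJ : ∀ t, (J ∩ Set.Iic t).Finite) {τ : ℝ≥0} (hτ : 0 < τ) :
    ∃ s < τ, J ∩ Set.Ioo s τ = ∅ := by
  have hF : ((J ∩ Set.Iic τ) \ {τ})ᶜ ∈ 𝓝 τ :=
    (((hJ τ).subset Set.sdiff_subset).isClosed.isOpen_compl).mem_nhds (by simp)
  obtain ⟨s, hs, hsub⟩ := exists_Ioc_subset_of_mem_nhds hF ⟨0, hτ⟩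
  refine ⟨s, hs, Set.eq_empty_iff_forall_notMem.2 fun u hu => ?_⟩
  exact hsub ⟨hu.2.1, hu.2.2.le⟩ ⟨⟨hu.1, hu.2.2.le⟩, hu.2.2.ne⟩

lemma exists_gt_inter_Ioo_eq_empty (hJ : ∀ t, (J ∩ Set.Iic t).Finite) (t : ℝ≥0) :
    ∃ u > t, J ∩ Set.Ioo t u = ∅ := by
  have ht : t < t + 1 := lt_add_of_pos_right t one_pos
  have hF : ((J ∩ Set.Iic (t + 1)) \ {t})ᶜ ∈ 𝓝 t :=
    (((hJ (t + 1)).subset Set.sdiff_subset).isClosed.isOpen_compl).mem_nhds (by simp)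
  obtain ⟨u, hu, hsub⟩ := exists_Ico_subset_of_mem_nhds hF ⟨t + 1, ht⟩
  refine ⟨min u (t + 1), lt_min hu ht, Set.eq_empty_iff_forall_notMem.2 fun v hv => ?_⟩
  exact hsub ⟨hv.2.1.le, hv.2.2.trans_le (min_le_left _ _)⟩
    ⟨⟨hv.1, (hv.2.2.trans_le (min_le_right _ _)).le⟩, hv.2.1.ne'⟩

lemma eventCount_eq_of_inter_Ioc_eq_empty {s t : ℝ≥0} (hst : s ≤ t) (h : J ∩ Set.Ioc s t = ∅) :
    eventCount J t = eventCount J s := by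
  unfold eventCount
  congr 1
  ext u
  refine ⟨fun hu => ⟨hu.1, ?_⟩, fun hu => ⟨hu.1, le_trans hu.2 hst⟩⟩
  by_contra hus
  exact Set.notMem_empty u (h ▸ ⟨hu.1, not_le.1 hus, hu.2⟩)

lemma eventCount_eq_add_one (hJ : ∀ t, (J ∩ Set.Iic t).Finite) {s t τ : ℝ≥0}
    (h : J ∩ Set.Ioc s t = {τ}) : eventCount J t = eventCount J s + 1 := by
  have hτ : τ ∈ J ∩ Set.Ioc s t := h ▸ rfl
  have : J ∩ Set.Iic t = insert τ (J ∩ Set.Iic s) := by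
    ext u
    constructor
    · intro hu
      by_cases hus : u ≤ s
      · exact .inr ⟨hu.1, hus⟩
      · have : u ∈ J ∩ Set.Ioc s t := ⟨hu.1, not_le.1 hus, hu.2⟩
        rw [h] at this
        exact .inl this
    · rintro (rfl | hu)
      · exact ⟨hτ.1, hτ.2.2⟩
      · exact ⟨hu.1, le_trans hu.2 (hτ.2.1.le.trans hτ.2.2)⟩
  rw [eventCount, this, Set.ncard_insert_of_notMem (fun hu => not_lt_of_ge hu.2 hτ.2.1) (hJ s),
    eventCount]

/-- The count jumps at every event, so events are labelled by their number and the choice in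
`eventMove` is forced. -/
lemma eventCount_injOn (hJ : ∀ t, (J ∩ Set.Iic t).Finite) : Set.InjOn (eventCount J) J := by
  have hlt : ∀ {σ τ}, τ ∈ J → σ < τ → eventCount J σ < eventCount J τ := fun {σ τ} hτ h =>
    Set.ncard_lt_ncard ⟨Set.inter_subset_inter_right _ (Set.Iic_subset_Iic.2 h.le),
      fun hsub => not_lt_of_ge (hsub ⟨hτ, Set.self_mem_Iic⟩).2 h⟩ (hJ τ)
  intro σ hσ τ hτ h
  rcases lt_trichotomy σ τ with h' | h' | h'
  · exact absurd h (hlt hτ h').ne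
  · exact h'
  · exact absurd h (hlt hσ h').ne'

end LocallyFinite

/-! ### Solving the equation path by path. -/

section PathConstruction

variable {n : ℕ} {r : Fin n ⊕ Fin n → ℝ} {N : Fin n ⊕ Fin n → Measure (ℝ≥0 × ℝ≥0)}

open Classical in
/-- The move performed at the `(k + 1)`-st event time. -/
noncomputable def eventMove (r : Fin n ⊕ Fin n → ℝ) (N : Fin n ⊕ Fin n → Measure (ℝ≥0 × ℝ≥0))
    (J : Set ℝ≥0) (k : ℕ) : Option (Fin n ⊕ Fin n) :=
  if h : ∃ τ ∈ J, eventCount J τ = k + 1 then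
    outcome fun d => N d (activePoints r d {h.choose})
  else none

/-- The path that performs the successive moves at the event times. -/
noncomputable def eventPath (r : Fin n ⊕ Fin n → ℝ) (N : Fin n ⊕ Fin n → Measure (ℝ≥0 × ℝ≥0))
    (J : Set ℝ≥0) (y : Fin n → ℕ) (t : ℝ≥0) : Fin n → ℕ :=
  applyOutcomes (eventMove r N J) y (eventCount J t)

lemma eventMove_eq {J : Set ℝ≥0} (hJ : ∀ t, (J ∩ Set.Iic t).Finite) {τ : ℝ≥0} (hτ : τ ∈ J) {k : ℕ}
    (hk : eventCount J τ = k + 1) :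
    eventMove r N J k = outcome fun d => N d (activePoints r d {τ}) := by
  have h : ∃ τ ∈ J, eventCount J τ = k + 1 := ⟨τ, hτ, hk⟩
  rw [eventMove, dif_pos h, eventCount_injOn hJ h.choose_spec.1 hτ (h.choose_spec.2.trans hk.symm)]

lemma eventPath_eq_of_inter_Ioc_eq_empty {J : Set ℝ≥0} (y : Fin n → ℕ) {s t : ℝ≥0} (hst : s ≤ t)
    (h : J ∩ Set.Ioc s t = ∅) : eventPath r N J y t = eventPath r N J y s := by
  rw [eventPath, eventCount_eq_of_inter_Ioc_eq_empty hst h, eventPath]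

/-- Induction on the number of events up to `t`: the equation holds just before the last event `τ`,
and at `τ` both sides change by the same move. -/
theorem exists_isPausePath_of_events (y : Fin n → ℕ)
    (hfin : ∀ d t, N d (activePoints r d (Set.Iic t)) ≠ ∞)
    {J : Set ℝ≥0} (hJ : ∀ t, (J ∩ Set.Iic t).Finite) (hJ0 : 0 ∉ J)
    (hnull : ∀ d t, N d (activePoints r d (Set.Iic t \ J)) = 0)
    (hatom : ∀ τ ∈ J, ∃ d₀, ∀ d, N d (activePoints r d {τ})
      = (Pi.single d₀ 1 : Fin n ⊕ Fin n → ℝ≥0∞) d) :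
    ∃ Y : ℝ≥0 → Fin n → ℕ, Y 0 = y ∧ IsPausePath r N Y ∧
      (∀ t, ContinuousWithinAt Y (Set.Ici t) t) ∧ ∀ t, ∃ l, Tendsto Y (𝓝[<] t) (𝓝 l) := by
  set Y := eventPath r N J y
  have h0 : Y 0 = y := by
    have : eventCount J 0 = 0 := by
      rw [eventCount, Set.ncard_eq_zero (hJ 0)]
      refine Set.eq_empty_iff_forall_notMem.2 fun u hu => hJ0 ?_
      rw [← le_zero_iff.1 hu.2]
      exact hu.1
    simp only [Y, eventPath, this, applyOutcomes]
  have hleft : ∀ t, 0 < t → ∃ s < t, ∀ u, s ≤ u → u < t → Y u = Y s := by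
    intro t ht
    obtain ⟨s, hs, hempty⟩ := exists_lt_inter_Ioo_eq_empty hJ ht
    refine ⟨s, hs, fun u hu hut => eventPath_eq_of_inter_Ioc_eq_empty y hu ?_⟩
    exact Set.subset_empty_iff.1 (hempty ▸ Set.inter_subset_inter_right J
      fun v hv => ⟨hv.1, hv.2.trans_lt hut⟩)
  refine ⟨Y, h0, ?_, fun t => ?_, fun t => ?_⟩
  · have key : ∀ k t, eventCount J t = k → ∀ i, (Y t i : ℝ) = Y 0 i + netMoves r N Y i t := by
      intro k
      induction k with
      | zero =>
        intro t ht i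
        have hempty : J ∩ Set.Iic t = ∅ := (Set.ncard_eq_zero (hJ t)).1 ht
        have hz : ∀ d, (N d).real (usedPoints r Y d t) = 0 := fun d => by
          refine (measureReal_eq_zero_iff
            (measure_ne_top_of_subset (usedPoints_subset r Y d t) (hfin d t))).2
            (measure_mono_null (usedPoints_subset r Y d t) ?_)
          rw [← hnull d t]
          congr 2
          ext u
          exact ⟨fun hu => ⟨hu, fun huJ => Set.notMem_empty u (hempty ▸ ⟨huJ, hu⟩)⟩, fun hu => hu.1⟩
        rw [h0, netMoves, hz, hz]
        simp [Y, eventPath, ht, applyOutcomes]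
      | succ k ih =>
        intro t ht i
        have hne : (J ∩ Set.Iic t).Nonempty := by
          rw [← Set.ncard_pos (hJ t)]
          exact lt_of_lt_of_eq k.succ_pos ht.symm
        obtain ⟨τ, hτ, hmax⟩ := Set.exists_max_image _ id (hJ t) hne
        have hτ0 : 0 < τ := pos_iff_ne_zero.2 fun h => hJ0 (h ▸ hτ.1)
        obtain ⟨s, hs, hconst⟩ := hleft τ hτ0
        obtain ⟨s', hs', hempty⟩ := exists_lt_inter_Ioo_eq_empty hJ hτ0
        -- From this time on and before `τ`, the path is constant and no event occurs.
        have hmaxs : max s s' < τ := max_lt hs hs'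
        have hIoc : J ∩ Set.Ioc (max s s') t = {τ} := by
          refine Set.eq_singleton_iff_unique_mem.2 ⟨⟨hτ.1, hmaxs, hτ.2⟩, fun u hu => ?_⟩
          refine le_antisymm (hmax u ⟨hu.1, hu.2.2⟩) (not_lt.1 fun hlt => ?_)
          exact Set.notMem_empty u
            (hempty ▸ ⟨hu.1, (le_max_right s s').trans_lt hu.2.1, hlt⟩)
        have hcs : eventCount J (max s s') = k := by
          have := eventCount_eq_add_one hJ hIoc
          omega
        have hcτ : eventCount J τ = k + 1 := by
          rw [← ht]
          refine (eventCount_eq_of_inter_Ioc_eq_empty hτ.2 ?_).symm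
          refine Set.eq_empty_iff_forall_notMem.2 fun u hu => ?_
          exact not_lt_of_ge (hmax u ⟨hu.1, hu.2.2⟩) hu.2.1
        obtain ⟨d₀, hd₀⟩ := hatom τ hτ.1
        have hlim : Function.leftLim Y τ = Y (max s s') := by
          refine leftLim_eq_of_eqOn hmaxs fun u hu huτ => ?_
          rw [hconst u ((le_max_left s s').trans hu) huτ, hconst _ (le_max_left s s') hmaxs]
        have hYt : Y t = step d₀ (Y (max s s')) := by
          have h1 : Y t = applyOutcome (eventMove r N J k) (Y (max s s')) := by
            simp only [Y, eventPath, ht, hcs, applyOutcomes]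
          rw [h1, eventMove_eq hJ hτ.1 hcτ, outcome_eq_some_iff.2 (funext hd₀)]
          rfl
        rw [netMoves_of_isolated (fun d => hfin d t) hmaxs hτ.2 (fun d => ?_) hd₀, hlim, hYt]
        · have := ih _ hcs i
          linarith
        · refine measure_mono_null (activePoints_mono r d fun u hu => ?_) (hnull d t)
          refine ⟨hu.1.2, fun huJ => hu.2 ?_⟩
          rw [← hIoc]
          exact ⟨huJ, hu.1⟩
    exact fun t i => key _ t rfl i
  · obtain ⟨u, hu, hempty⟩ := exists_gt_inter_Ioo_eq_empty hJ t
    refine tendsto_nhds_of_eventually_eq ?_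
    filter_upwards [Ico_mem_nhdsGE hu] with v hv
    refine eventPath_eq_of_inter_Ioc_eq_empty y hv.1 ?_
    exact Set.subset_empty_iff.1 (hempty ▸ Set.inter_subset_inter_right J
      fun w hw => ⟨hw.1, hw.2.trans_lt hv.2⟩)
  · rcases eq_zero_or_pos t with rfl | ht
    -- The filter `𝓝[<] 0` is trivial in `ℝ≥0`, so any limit will do.
    · refine ⟨0, ?_⟩
      simp
    · obtain ⟨s, hs, hconst⟩ := hleft t ht
      refine ⟨Y s, tendsto_nhds_of_eventually_eq ?_⟩
      filter_upwards [Ico_mem_nhdsLT hs] with u hu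
      exact hconst u hu.1 hu.2

/-- The regular grid that divides `[0, T]` into `m + 1` intervals. -/
noncomputable def grid (T : ℝ≥0) (m k : ℕ) : ℝ≥0 := T * (k / (m + 1 : ℕ))

lemma grid_zero (T : ℝ≥0) (m : ℕ) : grid T m 0 = 0 := by simp [grid]

lemma grid_last (T : ℝ≥0) (m : ℕ) : grid T m (m + 1) = T := by
  rw [grid, div_self (by positivity), mul_one]

lemma grid_mono (T : ℝ≥0) (m : ℕ) : Monotone (grid T m) := fun j k h => by
  unfold grid
  gcongr

/-- Drivers for which the dynamics can be solved path by path: there are no points at time zero,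
finitely many active points in bounded time, and never two of them at the same time. -/
structure GoodDrivers (r : Fin n ⊕ Fin n → ℝ) (N : Fin n ⊕ Fin n → Measure (ℝ≥0 × ℝ≥0)) : Prop where
  integerValued : IntegerValued N
  finite : ∀ d (T : ℕ), N d (activePoints r d (Set.Iic T)) ≠ ∞
  null_zero : ∀ d, N d (activePoints r d {0}) = 0
  separated : ∀ T : ℕ, ∃ m, ∀ k < m + 1, AtMostOne (counts r N (grid T m k) (grid T m (k + 1)))

lemma GoodDrivers.finite_Iic (h : GoodDrivers r N) (d : Fin n ⊕ Fin n) (t : ℝ≥0) :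
    N d (activePoints r d (Set.Iic t)) ≠ ∞ :=
  measure_ne_top_of_subset
    (activePoints_mono r d (Set.Iic_subset_Iic.2 (Nat.le_ceil t))) (h.finite d ⌈t⌉₊)

/-- The event times are the times charged by some driver. A cell with at most one active point
contains at most one event and no mass elsewhere; finitely many such cells cover `(0, T]`, and time
zero is null. -/
theorem GoodDrivers.exists_isPausePath (h : GoodDrivers r N) (y : Fin n → ℕ) :
    ∃ Y : ℝ≥0 → Fin n → ℕ, Y 0 = y ∧ IsPausePath r N Y ∧
      (∀ t, ContinuousWithinAt Y (Set.Ici t) t) ∧ ∀ t, ∃ l, Tendsto Y (𝓝[<] t) (𝓝 l) := by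
  set J : Set ℝ≥0 := {τ | ∃ d, N d (activePoints r d {τ}) ≠ 0}
  have hJ0 : 0 ∉ J := fun ⟨d, hd⟩ => hd (h.null_zero d)
  have hcell : ∀ {s t}, AtMostOne (counts r N s t) →
      (J ∩ Set.Ioc s t).Finite ∧ (∀ d, N d (activePoints r d (Set.Ioc s t \ J)) = 0) ∧
        ∀ τ ∈ J ∩ Set.Ioc s t, ∃ d₀, ∀ d, N d (activePoints r d {τ})
          = (Pi.single d₀ 1 : Fin n ⊕ Fin n → ℝ≥0∞) d := by
    rintro s t (hC | ⟨d₀, hC⟩)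
    · have hz : ∀ d, N d (activePoints r d (Set.Ioc s t)) = 0 := fun d => congrFun hC d
      have hempty : J ∩ Set.Ioc s t = ∅ := by
        refine Set.eq_empty_iff_forall_notMem.2 fun u hu => ?_
        obtain ⟨d, hd⟩ := hu.1
        exact hd (measure_mono_null (activePoints_mono r d (Set.singleton_subset_iff.2 hu.2)) (hz d))
      rw [hempty]
      exact ⟨Set.finite_empty, fun d => measure_mono_null (activePoints_mono r d Set.sdiff_subset)
        (hz d), fun τ hτ => absurd hτ (Set.notMem_empty τ)⟩
    · obtain ⟨τ, hs, ht, h0, h1⟩ := h.integerValued.exists_isolated hC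
      have hτJ : τ ∈ J := ⟨d₀, by rw [h1, Pi.single_eq_same]; exact one_ne_zero⟩
      have hJe : J ∩ Set.Ioc s t = {τ} := by
        refine Set.eq_singleton_iff_unique_mem.2 ⟨⟨hτJ, hs, ht⟩, fun u hu => ?_⟩
        by_contra hne
        obtain ⟨d, hd⟩ := hu.1
        exact hd (measure_mono_null (activePoints_mono r d
          (C := Set.Ioc s t \ {τ}) (Set.singleton_subset_iff.2 ⟨hu.2, hne⟩)) (h0 d))
      rw [hJe]
      refine ⟨Set.finite_singleton τ, fun d => ?_, fun u hu => ⟨d₀, ?_⟩⟩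
      · refine measure_mono_null (activePoints_mono r d (B := Set.Ioc s t \ J)
          (C := Set.Ioc s t \ {τ}) fun u hu => ⟨hu.1, fun huτ => hu.2 ?_⟩) (h0 d)
        rw [Set.mem_singleton_iff.1 huτ]
        exact hτJ
      · rw [Set.mem_singleton_iff.1 hu]
        exact h1
  have hcover : ∀ (T m : ℕ), Set.Ioc (0 : ℝ≥0) T
      = ⋃ k ∈ Finset.range (m + 1), Set.Ioc (grid T m k) (grid T m (k + 1)) := by
    intro T m
    have := (grid_mono T m).biUnion_Ico_Ioc_map_succ 0 (m + 1)
    rw [grid_zero, grid_last] at this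
    rw [← this]
    ext u
    simp
  refine exists_isPausePath_of_events y h.finite_Iic (J := J) (fun t => ?_) hJ0 (fun d t => ?_) ?_
  · obtain ⟨m, hm⟩ := h.separated ⌈t⌉₊
    refine Set.Finite.subset (s := ⋃ k ∈ Finset.range (m + 1),
      J ∩ Set.Ioc (grid ⌈t⌉₊ m k) (grid ⌈t⌉₊ m (k + 1))) ?_ fun u hu => ?_
    · exact Set.Finite.biUnion (Finset.finite_toSet _)
        fun k hk => (hcell (hm k (Finset.mem_range.1 hk))).1
    · have : u ∈ Set.Ioc (0 : ℝ≥0) (⌈t⌉₊ : ℕ) :=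
        ⟨pos_iff_ne_zero.2 fun h0 => hJ0 (h0 ▸ hu.1), le_trans hu.2 (Nat.le_ceil t)⟩
      rw [hcover _ m] at this
      rw [← Set.inter_iUnion₂]
      exact ⟨hu.1, this⟩
  · obtain ⟨m, hm⟩ := h.separated ⌈t⌉₊
    have hsub : activePoints r d (Set.Iic t \ J) ⊆ activePoints r d {0} ∪
        ⋃ k ∈ Finset.range (m + 1),
          activePoints r d (Set.Ioc (grid ⌈t⌉₊ m k) (grid ⌈t⌉₊ m (k + 1)) \ J) := by
      intro p hp
      rcases eq_zero_or_pos p.1 with h0 | h0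
      · exact .inl ⟨h0, hp.2⟩
      · have : p.1 ∈ Set.Ioc (0 : ℝ≥0) (⌈t⌉₊ : ℕ) := ⟨h0, le_trans hp.1.1 (Nat.le_ceil t)⟩
        rw [hcover _ m] at this
        obtain ⟨k, hk, hpk⟩ := Set.mem_iUnion₂.1 this
        exact .inr (Set.mem_iUnion₂.2 ⟨k, hk, ⟨hpk, hp.1.2⟩, hp.2⟩)
    refine measure_mono_null hsub (measure_union_null (h.null_zero d) ?_)
    exact (measure_biUnion_null_iff (Finset.countable_toSet _)).2
      fun k hk => (hcell (hm k (Finset.mem_range.1 hk))).2.1 d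
  · intro τ hτ
    obtain ⟨m, hm⟩ := h.separated ⌈τ⌉₊
    have : τ ∈ Set.Ioc (0 : ℝ≥0) (⌈τ⌉₊ : ℕ) :=
      ⟨pos_iff_ne_zero.2 fun h0 => hJ0 (h0 ▸ hτ), Nat.le_ceil τ⟩
    rw [hcover _ m] at this
    obtain ⟨k, hk, hpk⟩ := Set.mem_iUnion₂.1 this
    exact (hcell (hm k (Finset.mem_range.1 hk))).2.2 τ ⟨hτ, hpk⟩

end PathConstruction

/-! ### Counts of active points -/

section Counts

lemma measurableEmbedding_coe_nnreal : MeasurableEmbedding ((↑) : ℝ≥0 → ℝ) :=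
  MeasurableEmbedding.subtype_coe measurableSet_Ici

lemma lebesgueHalfLine_Ioc (s t : ℝ≥0) :
    lebesgueHalfLine (Set.Ioc s t) = ENNReal.ofReal (t - s) := by
  rw [lebesgueHalfLine, measurableEmbedding_coe_nnreal.comap_apply, ← Real.volume_Ioc]
  congr 1
  ext x
  simp only [Set.mem_image, Set.mem_Ioc]
  constructor
  · rintro ⟨u, hu, rfl⟩; exact_mod_cast hu
  · rintro ⟨h1, h2⟩
    exact ⟨⟨x, s.2.trans h1.le⟩, ⟨h1, h2⟩, rfl⟩

lemma lebesgueHalfLine_Iic (t : ℝ≥0) : lebesgueHalfLine (Set.Iic t) = t := by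
  rw [lebesgueHalfLine, measurableEmbedding_coe_nnreal.comap_apply]
  have : ((↑) : ℝ≥0 → ℝ) '' Set.Iic t = Set.Icc 0 (t : ℝ) := by
    ext x
    simp only [Set.mem_image, Set.mem_Iic, Set.mem_Icc]
    constructor
    · rintro ⟨u, hu, rfl⟩; exact ⟨u.2, by exact_mod_cast hu⟩
    · rintro ⟨h1, h2⟩
      exact ⟨⟨x, h1⟩, h2, rfl⟩
  rw [this, Real.volume_Icc, sub_zero, ENNReal.ofReal_coe_nnreal]

instance : SigmaFinite lebesgueHalfLine :=
  ⟨⟨{ set := fun k => Set.Iic (k : ℝ≥0)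
      set_mem := fun _ => trivial
      finite := fun k => by rw [lebesgueHalfLine_Iic]; exact ENNReal.coe_lt_top
      spanning := Set.iUnion_eq_univ_iff.2 fun t => ⟨⌈t⌉₊, Nat.le_ceil t⟩ }⟩⟩

instance : SigmaFinite lebesgueQuadrant := by unfold lebesgueQuadrant; infer_instance

variable {n : ℕ} {r : Fin n ⊕ Fin n → ℝ}

lemma lebesgueQuadrant_activePoints {d : Fin n ⊕ Fin n} (hr : 0 ≤ r d) (B : Set ℝ≥0) :
    lebesgueQuadrant (activePoints r d B) = lebesgueHalfLine B * ENNReal.ofReal (r d) := by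
  have : activePoints r d B = B ×ˢ Set.Iic (r d).toNNReal := by
    ext p
    simp only [activePoints, Set.mem_prod, Set.mem_Iic, Real.le_toNNReal_iff_coe_le hr]
    rfl
  rw [this, lebesgueQuadrant, Measure.prod_prod, lebesgueHalfLine_Iic]
  rfl

variable {Ω : Type*} [MeasurableSpace Ω] {P : Measure Ω}
  {N : Fin n ⊕ Fin n → Ω → Measure (ℝ≥0 × ℝ≥0)}

lemma IsPoissonRandomMeasure.measurable_apply {E : Type*} [MeasurableSpace E] {N : Ω → Measure E}
    {m : Measure E} (h : IsPoissonRandomMeasure P N m) {B : Set E} (hB : MeasurableSet B) :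
    Measurable fun ω => N ω B :=
  (Measure.measurable_coe hB).comp h.measurable

lemma IsPoissonRandomMeasure.measure_eq_natCast {E : Type*} [MeasurableSpace E]
    {N : Ω → Measure E} {m : Measure E} (h : IsPoissonRandomMeasure P N m) {B : Set E}
    (hB : MeasurableSet B) (hfin : m B ≠ ∞) (k : ℕ) :
    P {ω | N ω B = k} = poissonMeasure (m B).toNNReal {k} := by
  have h1 := (h.poisson B hB hfin).measure_eq (p := fun x => x = (k : ℝ≥0∞))
    (measurableSet_singleton _)
  rw [h1]
  refine (Measure.map_apply measurable_from_top (measurableSet_singleton (k : ℝ≥0∞))).trans ?_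
  congr 1
  ext j
  simp

lemma IsPoissonRandomMeasure.ae_ne_top {E : Type*} [MeasurableSpace E]
    {N : Ω → Measure E} {m : Measure E} (h : IsPoissonRandomMeasure P N m) {B : Set E}
    (hB : MeasurableSet B) (hfin : m B ≠ ∞) : ∀ᵐ ω ∂P, N ω B ≠ ∞ := by
  have h1 : ∀ᵐ x ∂((poissonMeasure (m B).toNNReal).map (Nat.cast : ℕ → ℝ≥0∞)), x ≠ ∞ :=
    (ae_map_iff (measurable_from_top (f := (Nat.cast : ℕ → ℝ≥0∞))).aemeasurable
      (measurableSet_singleton _).compl).2 (ae_of_all _ fun k => ENNReal.natCast_ne_top k)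
  rw [← (h.poisson B hB hfin).map_eq] at h1
  exact ae_of_ae_map (h.poisson B hB hfin).aemeasurable h1

lemma IsPoissonRandomMeasure.ae_eq_zero {E : Type*} [MeasurableSpace E] [IsProbabilityMeasure P]
    {N : Ω → Measure E} {m : Measure E} (h : IsPoissonRandomMeasure P N m) {B : Set E}
    (hB : MeasurableSet B) (h0 : m B = 0) : ∀ᵐ ω ∂P, N ω B = 0 := by
  have h1 := h.measure_eq_natCast hB (by simp [h0]) 0
  rw [h0, ENNReal.toNNReal_zero, poissonMeasure_zero] at h1
  have h2 : P {ω | N ω B = 0} = 1 := by simpa using h1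
  exact (prob_compl_eq_zero_iff ((h.measurable_apply hB) (measurableSet_singleton 0))).2 h2

lemma IsPoissonRandomMeasure.iIndepFun_nat {E : Type*} [MeasurableSpace E]
    {N : Ω → Measure E} {m : Measure E} (h : IsPoissonRandomMeasure P N m) {B : ℕ → Set E}
    (hB : ∀ k, MeasurableSet (B k)) (hd : Pairwise fun j l => Disjoint (B j) (B l)) :
    iIndepFun (fun k ω => N ω (B k)) P := by
  rw [iIndepFun_iff_finset]
  intro s
  have h1 := h.indep s.card (fun j => B (s.equivFin.symm j)) (fun j => hB _) fun j l hjl =>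
    hd fun he => hjl (s.equivFin.symm.injective (Subtype.ext he))
  have h2 := h1.precomp (g := s.equivFin) s.equivFin.injective
  simpa [Function.comp_def, Finset.restrict_def] using h2

instance : MeasurableSpace (Option (Fin n ⊕ Fin n)) := ⊤

instance : DiscreteMeasurableSpace (Option (Fin n ⊕ Fin n)) := ⟨fun _ => trivial⟩

/-- Independent Poisson drivers for all moves. -/
structure IsDriver (P : Measure Ω) (r : Fin n ⊕ Fin n → ℝ)
    (N : Fin n ⊕ Fin n → Ω → Measure (ℝ≥0 × ℝ≥0)) : Prop where
  poisson : ∀ d, IsPoissonRandomMeasure P (N d) lebesgueQuadrant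
  indep : iIndepFun N P
  rate_nonneg : ∀ d, 0 ≤ r d

namespace IsDriver

lemma integerValued (h : IsDriver P r N) (ω : Ω) : IntegerValued fun d => N d ω :=
  fun d B hB => (h.poisson d).integer_valued ω B hB

lemma measurable_counts (h : IsDriver P r N) (s t : ℝ≥0) :
    Measurable fun ω => counts r (fun d => N d ω) s t :=
  measurable_pi_lambda _ fun d => (h.poisson d).measurable_apply
    (measurableSet_activePoints r d measurableSet_Ioc)

lemma ae_finite (h : IsDriver P r N) :
    ∀ᵐ ω ∂P, ∀ d (T : ℕ), N d ω (activePoints r d (Set.Iic T)) ≠ ∞ := by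
  refine ae_all_iff.2 fun d => ae_all_iff.2 fun T => ?_
  refine (h.poisson d).ae_ne_top (measurableSet_activePoints r d measurableSet_Iic) ?_
  rw [lebesgueQuadrant_activePoints (h.rate_nonneg d), lebesgueHalfLine_Iic]
  exact ENNReal.mul_ne_top ENNReal.coe_ne_top ENNReal.ofReal_ne_top

lemma ae_null_zero [IsProbabilityMeasure P] (h : IsDriver P r N) :
    ∀ᵐ ω ∂P, ∀ d, N d ω (activePoints r d {0}) = 0 := by
  refine ae_all_iff.2 fun d => ?_
  refine (h.poisson d).ae_eq_zero (measurableSet_activePoints r d (measurableSet_singleton 0)) ?_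
  rw [lebesgueQuadrant_activePoints (h.rate_nonneg d)]
  have : lebesgueHalfLine {0} = 0 := by
    have : ({0} : Set ℝ≥0) = Set.Iic 0 := by ext; simp
    rw [this, lebesgueHalfLine_Iic, ENNReal.coe_zero]
  rw [this, zero_mul]

lemma measureReal_count_eq (h : IsDriver P r N) {s t : ℝ≥0} (hst : s ≤ t) (d : Fin n ⊕ Fin n)
    (k : ℕ) : P.real {ω | counts r (fun d => N d ω) s t d = k}
      = Real.exp (-((t - s) * r d)) * ((t - s) * r d) ^ k / k.factorial := by
  have h1 := (h.poisson d).measure_eq_natCast (measurableSet_activePoints r d measurableSet_Ioc)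
    (B := activePoints r d (Set.Ioc s t)) (by
      rw [lebesgueQuadrant_activePoints (h.rate_nonneg d), lebesgueHalfLine_Ioc]
      exact ENNReal.mul_ne_top ENNReal.ofReal_ne_top ENNReal.ofReal_ne_top) k
  have hts : (0 : ℝ) ≤ t - s := sub_nonneg.2 (by exact_mod_cast hst)
  rw [measureReal_def]
  simp only [counts]
  rw [h1, ← measureReal_def, poissonMeasure_real_singleton,
    lebesgueQuadrant_activePoints (h.rate_nonneg d), lebesgueHalfLine_Ioc]
  have : ((ENNReal.ofReal (t - s) * ENNReal.ofReal (r d)).toNNReal : ℝ) = (t - s) * r d := by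
    rw [← ENNReal.ofReal_mul hts]
    exact Real.coe_toNNReal _ (mul_nonneg hts (h.rate_nonneg d))
  rw [this]

lemma measureReal_counts_eq (h : IsDriver P r N) {s t : ℝ≥0} (hst : s ≤ t)
    (k : Fin n ⊕ Fin n → ℕ) : P.real {ω | counts r (fun d => N d ω) s t = fun d => (k d : ℝ≥0∞)}
      = ∏ d, Real.exp (-((t - s) * r d)) * ((t - s) * r d) ^ k d / (k d).factorial := by
  have hind : iIndepFun (fun d ω => counts r (fun d => N d ω) s t d) P :=
    h.indep.comp (fun d μ => μ (activePoints r d (Set.Ioc s t)))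
      fun d => Measure.measurable_coe (measurableSet_activePoints r d measurableSet_Ioc)
  have hset : {ω | counts r (fun d => N d ω) s t = fun d => (k d : ℝ≥0∞)}
      = ⋂ d, (fun ω => counts r (fun d => N d ω) s t d) ⁻¹' {(k d : ℝ≥0∞)} := by
    ext ω
    simp [funext_iff]
  rw [hset, measureReal_def, hind.meas_iInter fun d => ⟨_, measurableSet_singleton _, rfl⟩,
    ENNReal.toReal_prod]
  exact Finset.prod_congr rfl fun d _ => h.measureReal_count_eq hst d (k d)

lemma measureReal_counts_eq_zero (h : IsDriver P r N) {s t : ℝ≥0} (hst : s ≤ t) :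
    P.real {ω | counts r (fun d => N d ω) s t = 0} = Real.exp (-((t - s) * ∑ d, r d)) := by
  have := h.measureReal_counts_eq hst 0
  simp only [Pi.zero_apply, Nat.cast_zero, pow_zero, mul_one, Nat.factorial_zero, Nat.cast_one,
    div_one, ← Real.exp_sum] at this
  rw [Finset.mul_sum, ← Finset.sum_neg_distrib, ← this]
  rfl

/-- The factor in front of `r d` does not depend on `d`; the one-step law of the chain uses nothing
else about the law of an outcome. -/
lemma measureReal_outcome_eq_some (h : IsDriver P r N) {s t : ℝ≥0} (hst : s ≤ t)
    (d : Fin n ⊕ Fin n) : P.real {ω | outcome (counts r (fun d => N d ω) s t) = some d}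
      = (t - s) * Real.exp (-((t - s) * ∑ d, r d)) * r d := by
  have := h.measureReal_counts_eq hst (Pi.single d 1)
  have hset : {ω | outcome (counts r (fun d => N d ω) s t) = some d}
      = {ω | counts r (fun d => N d ω) s t
        = fun d' => ((Pi.single d 1 : Fin n ⊕ Fin n → ℕ) d' : ℝ≥0∞)} := by
    ext ω
    rw [Set.mem_ofPred_eq, Set.mem_ofPred_eq, outcome_eq_some_iff]
    have : (Pi.single d 1 : Fin n ⊕ Fin n → ℝ≥0∞)
        = fun d' => ((Pi.single d 1 : Fin n ⊕ Fin n → ℕ) d' : ℝ≥0∞) := by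
      ext d'
      by_cases hd : d' = d
      · subst hd; simp
      · simp [hd]
    rw [this]
  rw [hset, this, Finset.mul_sum, ← Finset.sum_neg_distrib, Real.exp_sum]
  rw [← Finset.mul_prod_erase _ _ (Finset.mem_univ d),
    ← Finset.mul_prod_erase _ (fun d => Real.exp (-((t - s) * r d))) (Finset.mem_univ d)]
  have : ∏ d' ∈ Finset.univ.erase d, Real.exp (-((t - s) * r d'))
        * ((t - s) * r d') ^ (Pi.single d 1 : Fin n ⊕ Fin n → ℕ) d'
          / ((Pi.single d 1 : Fin n ⊕ Fin n → ℕ) d').factorial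
      = ∏ d' ∈ Finset.univ.erase d, Real.exp (-((t - s) * r d')) := by
    refine Finset.prod_congr rfl fun d' hd' => ?_
    rw [Pi.single_eq_of_ne (Finset.ne_of_mem_erase hd')]
    simp
  rw [this, Pi.single_eq_same]
  simp only [pow_one, Nat.factorial_one, Nat.cast_one, div_one]
  ring

lemma measurable_outcome : Measurable (outcome : (Fin n ⊕ Fin n → ℝ≥0∞) → _) := by
  have hsome : ∀ d, MeasurableSet (outcome ⁻¹' {some d} : Set (Fin n ⊕ Fin n → ℝ≥0∞)) := by
    intro d
    have : (outcome ⁻¹' {some d} : Set (Fin n ⊕ Fin n → ℝ≥0∞)) = {Pi.single d 1} := by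
      ext C
      exact outcome_eq_some_iff
    rw [this]
    exact measurableSet_singleton _
  refine measurable_to_countable' fun x => ?_
  rcases x with _ | d
  · have : (outcome ⁻¹' {none} : Set (Fin n ⊕ Fin n → ℝ≥0∞)) = (⋃ d, outcome ⁻¹' {some d})ᶜ := by
      ext C
      simp [Option.eq_none_iff_forall_ne_some]
    rw [this]
    exact (MeasurableSet.iUnion hsome).compl
  · exact hsome d

lemma measurableSet_atMostOne :
    MeasurableSet {C : Fin n ⊕ Fin n → ℝ≥0∞ | AtMostOne C} := by
  have : {C : Fin n ⊕ Fin n → ℝ≥0∞ | AtMostOne C} = {0} ∪ ⋃ d, {Pi.single d 1} := by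
    ext C
    simp [AtMostOne, eq_comm]
  rw [this]
  exact (measurableSet_singleton _).union (MeasurableSet.iUnion fun d => measurableSet_singleton _)

/-- Two active points during a short interval are unlikely. -/
lemma measureReal_not_atMostOne_le [IsProbabilityMeasure P] (h : IsDriver P r N) {s t : ℝ≥0}
    (hst : s ≤ t) :
    P.real {ω | ¬ AtMostOne (counts r (fun d => N d ω) s t)} ≤ ((t - s) * ∑ d, r d) ^ 2 := by
  set X : ℝ := (t - s) * ∑ d, r d with hX
  have hX0 : 0 ≤ X := mul_nonneg (sub_nonneg.2 (by exact_mod_cast hst))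
    (Finset.sum_nonneg fun d _ => h.rate_nonneg d)
  have hmeas : ∀ C : Set (Fin n ⊕ Fin n → ℝ≥0∞), MeasurableSet C →
      MeasurableSet {ω | counts r (fun d => N d ω) s t ∈ C} :=
    fun C hC => h.measurable_counts s t hC
  have hset : {ω | ¬ AtMostOne (counts r (fun d => N d ω) s t)}
      = {ω | counts r (fun d => N d ω) s t ∈ {C | AtMostOne C}}ᶜ := rfl
  rw [hset, probReal_compl_eq_one_sub (hmeas _ measurableSet_atMostOne)]
  have hsome : ∀ d, {ω | outcome (counts r (fun d => N d ω) s t) = some d}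
      = {ω | counts r (fun d => N d ω) s t ∈ ({Pi.single d 1} : Set _)} := fun d => by
    ext ω
    exact outcome_eq_some_iff
  have hunion : {ω | counts r (fun d => N d ω) s t ∈ {C | AtMostOne C}}
      = {ω | counts r (fun d => N d ω) s t = 0} ∪
        ⋃ d ∈ (Finset.univ : Finset (Fin n ⊕ Fin n)),
          {ω | outcome (counts r (fun d => N d ω) s t) = some d} := by
    ext ω
    simp [AtMostOne, outcome_eq_some_iff]
  have hval : P.real {ω | counts r (fun d => N d ω) s t ∈ {C | AtMostOne C}}
      = Real.exp (-X) * (1 + X) := by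
    rw [hunion, measureReal_union ?_ ?_ (measure_ne_top _ _) (measure_ne_top _ _),
      measureReal_biUnion_finset, h.measureReal_counts_eq_zero hst,
      Finset.sum_congr rfl fun d _ => h.measureReal_outcome_eq_some hst d, ← Finset.mul_sum]
    · rw [hX]; ring
    · intro d _ d' _ hdd'
      refine Set.disjoint_left.2 fun ω hω hω' => hdd' ?_
      exact Option.some_injective _ (hω.symm.trans hω')
    · intro d _
      rw [hsome]
      exact hmeas _ (measurableSet_singleton _)
    · refine Set.disjoint_left.2 fun ω hω hω' => ?_
      obtain ⟨d, -, hd⟩ := Set.mem_iUnion₂.1 hω'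
      have h1 : outcome (counts r (fun d => N d ω) s t) = some d := hd
      have h2 : counts r (fun d => N d ω) s t = 0 := hω
      rw [h2, outcome_zero] at h1
      exact absurd h1 (by simp)
    · refine Finset.measurableSet_biUnion _ fun d _ => ?_
      rw [hsome]
      exact hmeas _ (measurableSet_singleton _)
  rw [hval]
  -- `exp (-X) * (1 + X) ≥ (1 - X) * (1 + X) = 1 - X ^ 2`.
  have := Real.add_one_le_exp (-X)
  nlinarith

/-- The outcomes on the successive intervals of a grid are independent. -/
lemma iIndepFun_outcome (h : IsDriver P r N) {s : ℕ → ℝ≥0} (hs : Monotone s) :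
    iIndepFun (fun k ω => outcome (counts r (fun d => N d ω) (s k) (s (k + 1)))) P := by
  have hdisj : ∀ d, Pairwise fun j l =>
      Disjoint (activePoints r d (Set.Ioc (s j) (s (j + 1))))
        (activePoints r d (Set.Ioc (s l) (s (l + 1)))) := by
    intro d j l hjl
    refine Set.disjoint_left.2 fun p hp hp' => ?_
    exact Set.disjoint_left.1 (hs.pairwise_disjoint_on_Ioc_succ hjl) hp.1 hp'.1
  have hB : ∀ d k, MeasurableSet (activePoints r d (Set.Ioc (s k) (s (k + 1)))) := fun d k =>
    measurableSet_activePoints r d measurableSet_Ioc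
  have hm : ∀ d k, Measurable fun ω => N d ω (activePoints r d (Set.Ioc (s k) (s (k + 1)))) :=
    fun d k => (h.poisson d).measurable_apply (hB d k)
  -- Counts are independent over all pairs of driver and cell; regrouping by cell makes the count
  -- vectors of different cells independent.
  have h1 := iIndepFun_uncurry'
    (X := fun d k ω => N d ω (activePoints r d (Set.Ioc (s k) (s (k + 1))))) hm
    (h.indep.comp (fun d μ k => μ (activePoints r d (Set.Ioc (s k) (s (k + 1)))))
      fun d => measurable_pi_lambda _ fun k => Measure.measurable_coe (hB d k))
    fun d => (h.poisson d).iIndepFun_nat (hB d) (hdisj d)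
  have h2 := iIndepFun.curry
    (X := fun k d ω => N d ω (activePoints r d (Set.Ioc (s k) (s (k + 1)))))
    (fun k d => hm d k) (h1.precomp (g := Prod.swap) Prod.swap_injective)
  exact h2.comp (fun _ => outcome) fun _ => measurable_outcome

end IsDriver

end Counts

/-! ### Approximation by a discrete time chain -/

section Chain

variable {Ω : Type*} [MeasurableSpace Ω] {P : Measure Ω}

lemma IndepFun.prodMk_of_indepFun_prodMk {β γ δ : Type*} [MeasurableSpace β] [MeasurableSpace γ]
    [MeasurableSpace δ] [IsProbabilityMeasure P] {X : Ω → β} {V : Ω → γ} {Z : Ω → δ}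
    (hX : Measurable X) (hV : Measurable V) (hZ : Measurable Z)
    (h1 : IndepFun X (fun ω => (V ω, Z ω)) P) (h2 : IndepFun V Z P) :
    IndepFun (fun ω => (X ω, V ω)) Z P := by
  have hXV : IndepFun X V P := h1.comp measurable_id measurable_fst
  have e1 := (indepFun_iff_map_prod_eq_prod_map_map hX.aemeasurable
    (hV.prodMk hZ).aemeasurable).1 h1
  rw [(indepFun_iff_map_prod_eq_prod_map_map hV.aemeasurable hZ.aemeasurable).1 h2] at e1
  rw [indepFun_iff_map_prod_eq_prod_map_map (hX.prodMk hV).aemeasurable hZ.aemeasurable,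
    (indepFun_iff_map_prod_eq_prod_map_map hX.aemeasurable hV.aemeasurable).1 hXV]
  have := Measure.isProbabilityMeasure_map (μ := P) hX.aemeasurable
  have := Measure.isProbabilityMeasure_map (μ := P) hV.aemeasurable
  have := Measure.isProbabilityMeasure_map (μ := P) hZ.aemeasurable
  rw [← Measure.prodAssoc_prod, ← (MeasurableEquiv.prodAssoc).symm.map_measurableEquiv_injective.eq_iff,
    MeasurableEquiv.map_symm_map] at e1
  rw [← e1, Measure.map_map (by fun_prop) (hX.prodMk (hV.prodMk hZ))]
  rfl

variable {n : ℕ} {r : Fin n ⊕ Fin n → ℝ} {N : Fin n ⊕ Fin n → Ω → Measure (ℝ≥0 × ℝ≥0)}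

lemma applyOutcomes_congr {e e' : ℕ → Option (Fin n ⊕ Fin n)} (y : Fin n → ℕ) {m : ℕ}
    (h : ∀ k < m, e k = e' k) : applyOutcomes e y m = applyOutcomes e' y m := by
  induction m with
  | zero => rfl
  | succ m ih =>
    rw [applyOutcomes, applyOutcomes, ih fun k hk => h k (hk.trans m.lt_succ_self),
      h m m.lt_succ_self]

lemma measurable_applyOutcomes {y : Ω → Fin n → ℕ} {e : ℕ → Ω → Option (Fin n ⊕ Fin n)}
    (hy : Measurable y) (he : ∀ k, Measurable (e k)) (m : ℕ) :
    Measurable fun ω => applyOutcomes (fun k => e k ω) (y ω) m := by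
  induction m with
  | zero => exact hy
  | succ m ih =>
    exact (measurable_from_prod_countable_right (f := fun q : Option (Fin n ⊕ Fin n) × (Fin n → ℕ) =>
      applyOutcome q.1 q.2) fun x => .of_discrete).comp ((he m).prodMk ih)

/-- The state of the chain is independent of the next outcome. -/
lemma indepFun_applyOutcomes [IsProbabilityMeasure P] {y : Ω → Fin n → ℕ}
    {e : ℕ → Ω → Option (Fin n ⊕ Fin n)} (hy : Measurable y) (he : ∀ k, Measurable (e k))
    (hind : iIndepFun e P) (hye : IndepFun y (fun ω k => e k ω) P) (m : ℕ) :
    IndepFun (fun ω => applyOutcomes (fun k => e k ω) (y ω) m) (e m) P := by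
  have h1 : IndepFun (fun ω (k : Finset.range m) => e k ω) (e m) P :=
    (hind.indepFun_finset (Finset.range m) {m} (by simp) he).comp measurable_id
      (measurable_pi_apply (⟨m, Finset.mem_singleton_self m⟩ : ({m} : Finset ℕ)))
  have h2 : IndepFun y (fun ω => (fun k : Finset.range m => e k ω, e m ω)) P :=
    hye.comp (φ := id) (ψ := fun x : ℕ → Option (Fin n ⊕ Fin n) =>
      ((fun k : Finset.range m => x k, x m) : (Finset.range m → Option (Fin n ⊕ Fin n)) × _))
      measurable_id (by fun_prop)
  have h3 := IndepFun.prodMk_of_indepFun_prodMk hy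
    (measurable_pi_lambda _ fun k : Finset.range m => he k) (he m) h2 h1
  classical
  -- The state after `m` steps reads only the outcomes before `m`, so the filler `none` at later
  -- indices has no effect.
  let g : (Fin n → ℕ) × (Finset.range m → Option (Fin n ⊕ Fin n)) → Fin n → ℕ := fun q =>
    applyOutcomes (fun k => if h : k ∈ Finset.range m then q.2 ⟨k, h⟩ else none) q.1 m
  have hg : Measurable g := by
    refine measurable_applyOutcomes measurable_fst (fun k => ?_) m
    by_cases h : k ∈ Finset.range m
    · simp only [h, dite_true]
      exact (measurable_pi_apply _).comp measurable_snd
    · simp only [h, dite_false]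
      exact measurable_const
  have h4 := h3.comp hg measurable_id
  have : (fun ω => applyOutcomes (fun k => e k ω) (y ω) m)
      = g ∘ fun ω => (y ω, fun k : Finset.range m => e k ω) := by
    ext1 ω
    exact applyOutcomes_congr _ fun k hk => by simp [hk]
  rw [this]
  exact h4

/-- A law that is annihilated by the generator of the system, in each state. -/
def IsInvariantLaw (r : Fin n ⊕ Fin n → ℝ) (μ : Measure (Fin n → ℕ)) : Prop :=
  ∀ y, ∑ d, r d * μ.real (step d ⁻¹' {y}) = (∑ d, r d) * μ.real {y}

/-- One step of the chain. -/
lemma measureReal_applyOutcome [IsProbabilityMeasure P] {Z : Ω → Fin n → ℕ}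
    {e : Ω → Option (Fin n ⊕ Fin n)} (hZ : Measurable Z) (he : Measurable e) (hind : IndepFun Z e P)
    {κ : ℝ} (hκ : ∀ d, P.real {ω | e ω = some d} = κ * r d) (y : Fin n → ℕ) :
    P.real {ω | applyOutcome (e ω) (Z ω) = y} = (P.map Z).real {y}
      + κ * (∑ d, r d * (P.map Z).real (step d ⁻¹' {y}) - (∑ d, r d) * (P.map Z).real {y}) := by
  have hme : ∀ x, MeasurableSet {ω | e ω = x} := fun x => he (measurableSet_singleton x)
  have hmap : ∀ B, (P.map Z).real B = P.real (Z ⁻¹' B) := fun B => by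
    rw [measureReal_def, Measure.map_apply hZ .of_discrete, measureReal_def]
  -- `none` takes the probability left over by the moves.
  have hsum : P.real {ω | e ω = none} + ∑ d, κ * r d = 1 := by
    have hu : (⋃ x ∈ (Finset.univ : Finset (Option (Fin n ⊕ Fin n))), {ω | e ω = x}) = Set.univ := by
      ext ω; simp
    have h1 : P.real (⋃ x ∈ (Finset.univ : Finset (Option (Fin n ⊕ Fin n))), {ω | e ω = x})
        = ∑ x, P.real {ω | e ω = x} := by
      refine measureReal_biUnion_finset ?_ fun x _ => hme x
      intro x _ x' _ hxx'
      exact Set.disjoint_left.2 fun ω (hω : e ω = x) (hω' : e ω = x') => hxx' (hω.symm.trans hω')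
    rw [hu, probReal_univ, Fintype.sum_option] at h1
    rw [h1, Finset.sum_congr rfl fun d _ => hκ d]
  have hsplit : {ω | applyOutcome (e ω) (Z ω) = y}
      = ⋃ x ∈ (Finset.univ : Finset (Option (Fin n ⊕ Fin n))),
        Z ⁻¹' (applyOutcome x ⁻¹' {y}) ∩ e ⁻¹' {x} := by
    ext ω
    simp only [Set.mem_ofPred_eq, Set.mem_iUnion, Finset.mem_univ, exists_true_left]
    constructor
    · intro h; exact ⟨e ω, h, rfl⟩
    · rintro ⟨x, h1, h2⟩
      have h2 : e ω = x := h2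
      rw [h2]; exact h1
  have hfact : ∀ x, P.real (Z ⁻¹' (applyOutcome x ⁻¹' {y}) ∩ e ⁻¹' {x})
      = (P.map Z).real (applyOutcome x ⁻¹' {y}) * P.real {ω | e ω = x} := fun x => by
    rw [measureReal_def, hind.measure_inter_preimage_eq_mul _ _ .of_discrete .of_discrete, ENNReal.toReal_mul,
      hmap, measureReal_def, measureReal_def]
    rfl
  rw [hsplit, measureReal_biUnion_finset, Finset.sum_congr rfl fun x _ => hfact x,
    Fintype.sum_option, Finset.sum_congr rfl fun d _ => congrArg _ (hκ d)]
  · have hnone : (applyOutcome (none : Option (Fin n ⊕ Fin n))) ⁻¹' {y} = {y} := rfl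
    have hsome : ∀ d : Fin n ⊕ Fin n, applyOutcome (some d) ⁻¹' {y} = step d ⁻¹' {y} :=
      fun d => rfl
    have h2 : P.real {ω | e ω = none} = 1 - κ * ∑ d, r d := by
      rw [Finset.mul_sum]; linarith
    simp only [hnone, hsome, h2]
    have h3 : ∑ d, (P.map Z).real (step d ⁻¹' {y}) * (κ * r d)
        = κ * ∑ d, r d * (P.map Z).real (step d ⁻¹' {y}) := by
      rw [Finset.mul_sum]
      exact Finset.sum_congr rfl fun d _ => by ring
    rw [h3]
    ring
  · intro x _ x' _ hxx'
    exact Set.disjoint_left.2 fun ω hω hω' => hxx' (hω.2.symm.trans hω'.2)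
  · intro x _
    exact (hZ .of_discrete).inter (hme x)

/-- For an invariant law the correction term of the one-step law vanishes whatever the factor `κ k`,
so each step preserves the law exactly, with no small-time error. -/
lemma map_applyOutcomes_eq_of_isInvariantLaw [IsProbabilityMeasure P] {y : Ω → Fin n → ℕ}
    {e : ℕ → Ω → Option (Fin n ⊕ Fin n)} (hy : Measurable y) (he : ∀ k, Measurable (e k))
    (hind : iIndepFun e P) (hye : IndepFun y (fun ω k => e k ω) P)
    {κ : ℕ → ℝ} (hκ : ∀ k d, P.real {ω | e k ω = some d} = κ k * r d)
    (hinv : IsInvariantLaw r (P.map y)) (m : ℕ) :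
    P.map (fun ω => applyOutcomes (fun k => e k ω) (y ω) m) = P.map y := by
  induction m with
  | zero => rfl
  | succ m ih =>
    have hm := measurable_applyOutcomes hy he (m + 1)
    have := Measure.isProbabilityMeasure_map (μ := P) hm.aemeasurable
    have := Measure.isProbabilityMeasure_map (μ := P) hy.aemeasurable
    refine Measure.ext_of_singleton fun z => ?_
    rw [← measureReal_eq_measureReal_iff]
    have h1 := measureReal_applyOutcome (measurable_applyOutcomes hy he m) (he m)
      (indepFun_applyOutcomes hy he hind hye m) (hκ m) z
    rw [ih, hinv z, sub_self, mul_zero, add_zero] at h1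
    rw [← h1, measureReal_def, Measure.map_apply hm .of_discrete]
    rfl

/-! ### Laws of solutions -/

/-- A process driven by `N` that solves the equation. -/
structure IsSolution (P : Measure Ω) (r : Fin n ⊕ Fin n → ℝ)
    (N : Fin n ⊕ Fin n → Ω → Measure (ℝ≥0 × ℝ≥0)) (Y : ℝ≥0 → Ω → Fin n → ℕ) : Prop where
  driver : IsDriver P r N
  indep_initial : IndepFun (Y 0) (fun ω d => N d ω) P
  measurable : ∀ t, Measurable (Y t)
  path : ∀ᵐ ω ∂P, IsPausePath r (fun d => N d ω) fun t => Y t ω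

/-- The outcome on an interval of the grid. -/
noncomputable def gridOutcome (r : Fin n ⊕ Fin n → ℝ)
    (N : Fin n ⊕ Fin n → Ω → Measure (ℝ≥0 × ℝ≥0)) (t : ℝ≥0) (m k : ℕ) (ω : Ω) :
    Option (Fin n ⊕ Fin n) :=
  outcome (counts r (fun d => N d ω) (grid t m k) (grid t m (k + 1)))

/-- The chain that approximates the solution on the grid. -/
noncomputable def gridChain (r : Fin n ⊕ Fin n → ℝ) (N : Fin n ⊕ Fin n → Ω → Measure (ℝ≥0 × ℝ≥0))
    (y : Ω → Fin n → ℕ) (t : ℝ≥0) (m : ℕ) (ω : Ω) : Fin n → ℕ :=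
  applyOutcomes (fun k => gridOutcome r N t m k ω) (y ω) (m + 1)

lemma indepFun_gridOutcome {y : Ω → Fin n → ℕ} (hy : IndepFun y (fun ω d => N d ω) P) (t : ℝ≥0)
    (m : ℕ) : IndepFun y (fun ω k => gridOutcome r N t m k ω) P := by
  refine hy.comp (φ := id) (ψ := fun x k => outcome (counts r x (grid t m k) (grid t m (k + 1))))
    measurable_id ?_
  refine measurable_pi_lambda _ fun k => IsDriver.measurable_outcome.comp ?_
  exact measurable_pi_lambda _ fun d => (Measure.measurable_coe
    (measurableSet_activePoints r d measurableSet_Ioc)).comp (measurable_pi_apply d)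

lemma IsDriver.measurable_gridOutcome (h : IsDriver P r N) (t : ℝ≥0) (m k : ℕ) :
    Measurable (gridOutcome r N t m k) :=
  IsDriver.measurable_outcome.comp (h.measurable_counts _ _)

lemma IsDriver.iIndepFun_gridOutcome (h : IsDriver P r N) (t : ℝ≥0) (m : ℕ) :
    iIndepFun (gridOutcome r N t m) P :=
  h.iIndepFun_outcome (grid_mono t m)

variable {Y : ℝ≥0 → Ω → Fin n → ℕ}

lemma grid_succ_sub (t : ℝ≥0) (m k : ℕ) :
    (grid t m (k + 1) : ℝ) - grid t m k = t / (m + 1 : ℕ) := by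
  simp only [grid]
  push_cast
  ring

/-- There are two active points in some interval of the grid. -/
def gridBad (r : Fin n ⊕ Fin n → ℝ) (N : Fin n ⊕ Fin n → Ω → Measure (ℝ≥0 × ℝ≥0))
    (t : ℝ≥0) (m : ℕ) : Set Ω :=
  ⋃ k ∈ Finset.range (m + 1),
    {ω | ¬ AtMostOne (counts r (fun d => N d ω) (grid t m k) (grid t m (k + 1)))}

/-- A cell is bad with probability at most quadratic in its length, so the union bound over `m + 1`
cells still leaves a factor `1 / (m + 1)`. -/
lemma IsDriver.measureReal_gridBad_le [IsProbabilityMeasure P] (h : IsDriver P r N) (t : ℝ≥0)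
    (m : ℕ) : P.real (gridBad r N t m) ≤ (t * ∑ d, r d) ^ 2 / (m + 1 : ℕ) := by
  refine (measureReal_biUnion_finset_le _ _).trans ?_
  have : ∀ k ∈ Finset.range (m + 1),
      P.real {ω | ¬ AtMostOne (counts r (fun d => N d ω) (grid t m k) (grid t m (k + 1)))}
        ≤ (t / (m + 1 : ℕ) * ∑ d, r d) ^ 2 := by
    rintro k -
    rw [← grid_succ_sub t m k]
    exact h.measureReal_not_atMostOne_le (grid_mono t m k.le_succ)
  refine (Finset.sum_le_sum this).trans (le_of_eq ?_)
  rw [Finset.sum_const, Finset.card_range, nsmul_eq_mul]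
  have : ((m + 1 : ℕ) : ℝ) ≠ 0 := by positivity
  field_simp

lemma tendsto_div_add_one_atTop (c : ℝ) :
    Tendsto (fun m : ℕ => c / (m + 1 : ℕ)) atTop (𝓝 0) :=
  (tendsto_const_div_atTop_nhds_zero_nat c).comp (tendsto_add_atTop_nat 1)

namespace IsSolution

lemma measurable_gridChain (h : IsDriver P r N) {y : Ω → Fin n → ℕ} (hy : Measurable y) (t : ℝ≥0)
    (m : ℕ) : Measurable (gridChain r N y t m) :=
  measurable_applyOutcomes hy
    (h.measurable_gridOutcome t m) (m + 1)

/-- Off the bad event the coupling of path and chain is exact, so their laws differ by no more than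
the probability of that event. -/
lemma ae_eq_gridChain (h : IsSolution P r N Y) (t : ℝ≥0) (m : ℕ) :
    ∀ᵐ ω ∂P, ω ∉ gridBad r N t m → Y t ω = gridChain r N (Y 0) t m ω := by
  filter_upwards [h.path, h.driver.ae_finite] with ω hpath hfin hgood
  have h1 := hpath.eq_applyOutcomes (h.driver.integerValued ω) (grid_zero t m) (grid_mono t m)
    (m := m + 1) (fun d => by
      rw [grid_last]
      exact measure_ne_top_of_subset
        (activePoints_mono r d (Set.Iic_subset_Iic.2 (Nat.le_ceil t))) (hfin d ⌈t⌉₊))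
    fun k hk => by
      by_contra hbad
      exact hgood (Set.mem_iUnion₂.2 ⟨k, Finset.mem_range.2 hk, hbad⟩)
  rw [grid_last] at h1
  exact h1

lemma measureReal_ne_gridChain_le [IsProbabilityMeasure P] (h : IsSolution P r N Y) (t : ℝ≥0)
    (m : ℕ) : P.real {ω | Y t ω ≠ gridChain r N (Y 0) t m ω} ≤ (t * ∑ d, r d) ^ 2 / (m + 1 : ℕ) := by
  refine le_trans ?_ (h.driver.measureReal_gridBad_le t m)
  refine ENNReal.toReal_mono (measure_ne_top _ _) (measure_mono_ae ?_)
  filter_upwards [h.ae_eq_gridChain t m] with ω hω hne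
  by_contra hgood
  exact hne (hω hgood)

lemma abs_measureReal_sub_le [IsProbabilityMeasure P] {U V : Ω → Fin n → ℕ} (y : Fin n → ℕ) :
    |P.real {ω | U ω = y} - P.real {ω | V ω = y}| ≤ P.real {ω | U ω ≠ V ω} := by
  have key : ∀ U V : Ω → Fin n → ℕ,
      P.real {ω | U ω = y} ≤ P.real {ω | V ω = y} + P.real {ω | U ω ≠ V ω} := fun U V => by
    refine (measureReal_mono (fun ω hω => ?_)).trans (measureReal_union_le _ _)
    by_cases h : U ω = V ω
    · exact .inl (h.symm.trans hω)
    · exact .inr h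
  rw [abs_le]
  have h1 := key U V
  have h2 := key V U
  have : {ω | V ω ≠ U ω} = {ω | U ω ≠ V ω} := by ext; exact ne_comm
  rw [this] at h2
  constructor <;> linarith

lemma measureReal_outcome_grid (h : IsDriver P r N) (t : ℝ≥0) (m k : ℕ) (d : Fin n ⊕ Fin n) :
    P.real {ω | gridOutcome r N t m k ω = some d}
      = t / (m + 1 : ℕ) * Real.exp (-(t / (m + 1 : ℕ) * ∑ d, r d)) * r d := by
  have := h.measureReal_outcome_eq_some (grid_mono t m k.le_succ) d
  rwa [grid_succ_sub] at this

variable [IsProbabilityMeasure P]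

/-- The law of a solution started from an invariant law does not change. -/
theorem map_eq_of_isInvariantLaw (h : IsSolution P r N Y) (hinv : IsInvariantLaw r (P.map (Y 0)))
    (t : ℝ≥0) : P.map (Y t) = P.map (Y 0) := by
  have h0 := Measure.isProbabilityMeasure_map (μ := P) (h.measurable 0).aemeasurable
  have ht := Measure.isProbabilityMeasure_map (μ := P) (h.measurable t).aemeasurable
  refine Measure.ext_of_singleton fun y => ?_
  rw [← measureReal_eq_measureReal_iff]
  -- The chain keeps the initial law for every mesh; only the coupling error is left, and it tends
  -- to zero.
  have hchain : ∀ m, P.map (gridChain r N (Y 0) t m) = P.map (Y 0) := fun m =>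
    map_applyOutcomes_eq_of_isInvariantLaw (h.measurable 0)
      (h.driver.measurable_gridOutcome t m) (h.driver.iIndepFun_gridOutcome t m)
      (indepFun_gridOutcome h.indep_initial t m)
      (fun k d => measureReal_outcome_grid h.driver t m k d) hinv (m + 1)
  have hle : ∀ m : ℕ, |(P.map (Y t)).real {y} - (P.map (Y 0)).real {y}|
      ≤ (t * ∑ d, r d) ^ 2 / (m + 1 : ℕ) := by
    intro m
    refine le_trans (le_of_eq ?_) ((abs_measureReal_sub_le (P := P) (U := Y t)
      (V := gridChain r N (Y 0) t m) y).trans (h.measureReal_ne_gridChain_le t m))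
    rw [← hchain m, measureReal_def, measureReal_def, Measure.map_apply (h.measurable t) .of_discrete,
      Measure.map_apply (measurable_gridChain h.driver (h.measurable 0) t m) .of_discrete]
    rfl
  have := ge_of_tendsto' (tendsto_div_add_one_atTop _) hle
  exact sub_eq_zero.1 (abs_eq_zero.1 (le_antisymm this (abs_nonneg _)))

/-- If the law of a solution does not change, it is invariant. -/
theorem isInvariantLaw_of_map_eq (h : IsSolution P r N Y)
    (hmap : ∀ t, P.map (Y t) = P.map (Y 0)) : IsInvariantLaw r (P.map (Y 0)) := by
  intro y
  set Λ := ∑ d, r d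
  set Δ := ∑ d, r d * (P.map (Y 0)).real (step d ⁻¹' {y}) - Λ * (P.map (Y 0)).real {y} with hΔ
  -- A single cell of length `t` (`m = 0`): the generator contributes `t * exp (-(t * Λ)) * Δ` and
  -- the coupling error is at most `(t * Λ) ^ 2`. Dividing by `t` and letting `t → 0` forces `Δ =
  -- 0`.
  have hle : ∀ t : ℝ≥0, 0 < t → Real.exp (-(t * Λ)) * |Δ| ≤ t * Λ ^ 2 := by
    intro t ht
    have h1 := (abs_measureReal_sub_le (P := P) (U := Y t)
      (V := gridChain r N (Y 0) t 0) y).trans (h.measureReal_ne_gridChain_le t 0)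
    have h2 := measureReal_applyOutcome (h.measurable 0)
      (h.driver.measurable_gridOutcome t 0 0)
      (indepFun_applyOutcomes (h.measurable 0) (h.driver.measurable_gridOutcome t 0)
        (h.driver.iIndepFun_gridOutcome t 0) (indepFun_gridOutcome h.indep_initial t 0) 0)
      (fun d => measureReal_outcome_grid h.driver t 0 0 d) y
    have h3 : P.real {ω | Y t ω = y} = (P.map (Y 0)).real {y} := by
      rw [← hmap t, measureReal_def, measureReal_def, Measure.map_apply (h.measurable t) .of_discrete]
      rfl
    have h4 : P.real {ω | gridChain r N (Y 0) t 0 ω = y} = (P.map (Y 0)).real {y}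
        + t * Real.exp (-(t * Λ)) * Δ := by
      have : ((0 + 1 : ℕ) : ℝ) = 1 := by norm_num
      rw [this, div_one] at h2
      exact h2
    rw [h3, h4] at h1
    have ht' : (0 : ℝ) < t := by exact_mod_cast ht
    have h5 : |(P.map (Y 0)).real {y} - ((P.map (Y 0)).real {y} + t * Real.exp (-(t * Λ)) * Δ)|
        = t * (Real.exp (-(t * Λ)) * |Δ|) := by
      rw [sub_add_cancel_left, abs_neg, abs_mul, abs_mul, abs_of_pos ht',
        abs_of_pos (Real.exp_pos _)]
      ring
    rw [h5] at h1
    have h6 : (t * Λ) ^ 2 / ((0 + 1 : ℕ) : ℝ) = t * (t * Λ ^ 2) := by push_cast; ring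
    rw [h6] at h1
    exact le_of_mul_le_mul_left h1 ht'
  have hlim1 : Tendsto (fun m : ℕ => Real.exp (-((1 / (m + 1 : ℕ) : ℝ) * Λ)) * |Δ|) atTop
      (𝓝 (Real.exp (-(0 * Λ)) * |Δ|)) :=
    ((Real.continuous_exp.tendsto _).comp ((tendsto_div_add_one_atTop 1).mul_const Λ).neg).mul_const _
  have hlim2 : Tendsto (fun m : ℕ => (1 / (m + 1 : ℕ) : ℝ) * Λ ^ 2) atTop (𝓝 (0 * Λ ^ 2)) :=
    (tendsto_div_add_one_atTop 1).mul_const _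
  have hfin := le_of_tendsto_of_tendsto' hlim1 hlim2 fun m => by
    have := hle (1 / (m + 1 : ℕ)) (by positivity)
    simpa using this
  simp only [zero_mul, neg_zero, Real.exp_zero, one_mul] at hfin
  exact sub_eq_zero.1 (abs_eq_zero.1 (le_antisymm hfin (abs_nonneg _)))

/-- A set of configurations that is stable under all moves is never left. -/
theorem ae_mem_of_step_mem (h : IsSolution P r N Y) {S : Set (Fin n → ℕ)}
    (hS : ∀ d, ∀ y ∈ S, step d y ∈ S) (h0 : ∀ᵐ ω ∂P, Y 0 ω ∈ S) (t : ℝ≥0) :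
    ∀ᵐ ω ∂P, Y t ω ∈ S := by
  have hchain : ∀ m e y, y ∈ S → applyOutcomes e y m ∈ S := by
    intro m e y hy
    induction m with
    | zero => exact hy
    | succ m ih =>
      rw [applyOutcomes]
      rcases e m with _ | d
      · exact ih
      · exact hS d _ ih
  have hle : ∀ m : ℕ, P.real {ω | Y t ω ∉ S} ≤ (t * ∑ d, r d) ^ 2 / (m + 1 : ℕ) := by
    intro m
    refine le_trans (ENNReal.toReal_mono (measure_ne_top _ _) (measure_mono_ae ?_))
      (h.measureReal_ne_gridChain_le t m)
    filter_upwards [h0] with ω hω hne heq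
    exact hne (by rw [heq]; exact hchain _ _ _ hω)
  have h1 := ge_of_tendsto' (tendsto_div_add_one_atTop _) hle
  exact (measureReal_eq_zero_iff).1 (le_antisymm h1 measureReal_nonneg)

end IsSolution

end Chain

/-! ### Existence of solutions -/

section Existence

variable {Ω : Type*} [MeasurableSpace Ω] {P : Measure Ω} {n : ℕ} {r : Fin n ⊕ Fin n → ℝ}
  {N : Fin n ⊕ Fin n → Ω → Measure (ℝ≥0 × ℝ≥0)}

/-- If no mesh separated the points up to `T`, the bad events of all meshes would occur at once, but
their probabilities tend to zero. -/
lemma IsDriver.ae_goodDrivers [IsProbabilityMeasure P] (h : IsDriver P r N) :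
    ∀ᵐ ω ∂P, GoodDrivers r fun d => N d ω := by
  have hsep : ∀ᵐ ω ∂P, ∀ T : ℕ, ∃ m, ω ∉ gridBad r N T m := by
    refine ae_all_iff.2 fun T => ?_
    have hle : ∀ m : ℕ, P.real {ω | ¬ ∃ m, ω ∉ gridBad r N T m}
        ≤ (((T : ℝ≥0) : ℝ) * ∑ d, r d) ^ 2 / (m + 1 : ℕ) := fun m =>
      (measureReal_mono fun ω hω => not_not.1 (not_exists.1 hω m)).trans
        (h.measureReal_gridBad_le T m)
    exact (measureReal_eq_zero_iff).1
      (le_antisymm (ge_of_tendsto' (tendsto_div_add_one_atTop _) hle) measureReal_nonneg)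
  filter_upwards [h.ae_finite, h.ae_null_zero, hsep] with ω h1 h2 h3
  refine ⟨h.integerValued ω, h1, h2, fun T => ?_⟩
  obtain ⟨m, hm⟩ := h3 T
  refine ⟨m, fun k hk => ?_⟩
  by_contra hbad
  exact hm (Set.mem_iUnion₂.2 ⟨k, Finset.mem_range.2 hk, hbad⟩)

lemma AtMostOne.mono {C C' : Fin n ⊕ Fin n → ℝ≥0∞} (hC : AtMostOne C) (hle : C' ≤ C)
    (hint : ∀ d, ∃ k : ℕ∞, C' d = (k : ℝ≥0∞)) : AtMostOne C' := by
  rcases hC with rfl | ⟨d₀, rfl⟩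
  · exact .inl (le_antisymm hle zero_le)
  · have hne : ∀ d, d ≠ d₀ → C' d = 0 := fun d hd =>
      le_antisymm ((hle d).trans_eq (Pi.single_eq_of_ne hd _)) zero_le
    obtain ⟨k, hk⟩ := hint d₀
    have hk1 : (k : ℝ≥0∞) ≤ ((1 : ℕ∞) : ℝ≥0∞) := by
      have := hle d₀
      rwa [Pi.single_eq_same, hk, ← ENat.toENNReal_one] at this
    rcases Order.le_one_iff.1 (ENat.toENNReal_le.1 hk1) with h | h
    · refine .inl (funext fun d => ?_)
      by_cases hd : d = d₀
      · rw [hd, hk, h]; simp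
      · exact hne d hd
    · refine .inr ⟨d₀, funext fun d => ?_⟩
      by_cases hd : d = d₀
      · rw [hd, hk, h, Pi.single_eq_same]; simp
      · rw [hne d hd, Pi.single_eq_of_ne hd]

lemma counts_mono {N : Fin n ⊕ Fin n → Measure (ℝ≥0 × ℝ≥0)} {s t s' t' : ℝ≥0}
    (h : Set.Ioc s' t' ⊆ Set.Ioc s t) : counts r N s' t' ≤ counts r N s t :=
  fun d => measure_mono (activePoints_mono r d h)

/-- A solution exists for every driver and every independent initial configuration. -/
theorem IsDriver.exists_isSolution [IsProbabilityMeasure P] (h : IsDriver P r N)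
    {y : Ω → Fin n → ℕ} (hy : Measurable y) (hind : IndepFun y (fun ω d => N d ω) P) :
    ∃ Y : ℝ≥0 → Ω → Fin n → ℕ, IsSolution P r N Y ∧ Y 0 = y ∧
      (∀ᵐ ω ∂P, ∀ t, ContinuousWithinAt (fun s => Y s ω) (Set.Ici t) t) ∧
      ∀ᵐ ω ∂P, ∀ t, ∃ l, Tendsto (fun s => Y s ω) (𝓝[<] t) (𝓝 l) := by
  classical
  -- A measurable set of full measure on which the drivers are good; off it the path is frozen at
  -- `y`.
  set G : Set Ω := (toMeasurable P {ω | ¬ GoodDrivers r fun d => N d ω})ᶜ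
  have hGm : MeasurableSet G := (measurableSet_toMeasurable _ _).compl
  have hG : ∀ᵐ ω ∂P, ω ∈ G := by
    rw [ae_iff]
    simp only [G, Set.mem_compl_iff, not_not]
    exact (measure_toMeasurable _).trans h.ae_goodDrivers
  have hgood : ∀ ω ∈ G, GoodDrivers r fun d => N d ω := fun ω hω => by
    by_contra hbad
    exact hω (subset_toMeasurable _ _ hbad)
  choose! Z hZ0 hZpath hZr hZl using fun ω (hω : ω ∈ G) => (hgood ω hω).exists_isPausePath (y ω)
  set Y : ℝ≥0 → Ω → Fin n → ℕ := fun t ω => if ω ∈ G then Z ω t else y ω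
  have hYG : ∀ {ω}, ω ∈ G → (fun t => Y t ω) = Z ω := fun hω => funext fun t => if_pos hω
  have hY0 : Y 0 = y := funext fun ω => by
    by_cases hω : ω ∈ G
    · simp [Y, hω, hZ0 ω hω]
    · simp [Y, hω]
  -- Paths are chosen separately for each `ω`, so measurability must be recovered: on `G` and off
  -- the bad event of mesh `m`, `Y t` equals the measurable chain `W m`, and each `ω ∈ G` admits
  -- such an `m`.
  have hYm : ∀ t, Measurable (Y t) := by
    intro t
    set T := ⌈t⌉₊
    have ht : t ≤ (T : ℝ≥0) := Nat.le_ceil t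
    -- Separation is known only up to integer horizons, so the grid of `[0, ⌈t⌉]` is cut off at `t`,
    -- which leaves the later cells empty.
    set W : ℕ → Ω → Fin n → ℕ := fun m ω => applyOutcomes (fun k => outcome
      (counts r (fun d => N d ω) (min (grid T m k) t) (min (grid T m (k + 1)) t))) (y ω) (m + 1)
    have hWm : ∀ m, Measurable (W m) := fun m => measurable_applyOutcomes hy
      (fun k => measurable_outcome.comp (h.measurable_counts _ _)) (m + 1)
    have hbadm : ∀ m, MeasurableSet (gridBad r N T m) := fun m =>
      Finset.measurableSet_biUnion _ fun k _ =>
        (h.measurable_counts _ _) measurableSet_atMostOne.compl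
    have hYW : ∀ m ω, ω ∈ G → ω ∉ gridBad r N T m → Y t ω = W m ω := by
      intro m ω hω hm
      have hs : Monotone fun k => min (grid T m k) t := fun j k hjk =>
        min_le_min_right t (grid_mono _ m hjk)
      have h1 := (hZpath ω hω).eq_applyOutcomes (h.integerValued ω)
        (s := fun k => min (grid T m k) t) (by simp [grid_zero]) hs (m := m + 1)
        (fun d => (hgood ω hω).finite_Iic d _) fun k hk => by
          have hk' : AtMostOne (counts r (fun d => N d ω) (grid T m k) (grid T m (k + 1))) := by
            by_contra hbad
            exact hm (Set.mem_iUnion₂.2 ⟨k, Finset.mem_range.2 hk, hbad⟩)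
          refine hk'.mono (counts_mono fun u hu => ?_) fun d => h.integerValued ω d _
            (measurableSet_activePoints r d measurableSet_Ioc)
          have hut : u ≤ t := hu.2.trans (min_le_right _ _)
          refine ⟨?_, hu.2.trans (min_le_left _ _)⟩
          rcases min_lt_iff.1 hu.1 with h' | h'
          · exact h'
          · exact absurd h' (not_lt_of_ge hut)
      have h2 : min (grid (T : ℝ≥0) m (m + 1)) t = t := by rw [grid_last]; exact min_eq_right ht
      simp only [h2, hZ0 ω hω] at h1
      simp only [Y, if_pos hω]
      exact h1
    refine measurable_to_countable' fun z => ?_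
    have hset : Y t ⁻¹' {z} = (Gᶜ ∩ y ⁻¹' {z}) ∪
        ⋃ m, G ∩ (gridBad r N T m)ᶜ ∩ W m ⁻¹' {z} := by
      ext ω
      by_cases hω : ω ∈ G
      · obtain ⟨m, hm⟩ := (hgood ω hω).separated T
        have hm' : ω ∉ gridBad r N T m := fun hbad => by
          obtain ⟨k, hk, hk'⟩ := Set.mem_iUnion₂.1 hbad
          exact hk' (hm k (Finset.mem_range.1 hk))
        constructor
        · intro hz
          refine .inr (Set.mem_iUnion.2 ⟨m, ⟨hω, hm'⟩, ?_⟩)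
          rw [Set.mem_preimage, ← hYW m ω hω hm']
          exact hz
        · rintro (hz | hz)
          · exact absurd hω hz.1
          · obtain ⟨m, ⟨-, hm⟩, hz⟩ := Set.mem_iUnion.1 hz
            rw [Set.mem_preimage, hYW m ω hω hm]
            exact hz
      · simp [Y, hω]
    rw [hset]
    exact (hGm.compl.inter (hy (measurableSet_singleton z))).union (MeasurableSet.iUnion fun m =>
      (hGm.inter (hbadm m).compl).inter (hWm m (measurableSet_singleton z)))
  refine ⟨Y, ⟨h, by rwa [hY0], hYm, ?_⟩, hY0, ?_, ?_⟩
  · filter_upwards [hG] with ω hω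
    rw [hYG hω]
    exact hZpath ω hω
  · filter_upwards [hG] with ω hω
    rw [hYG hω]
    exact hZr ω hω
  · filter_upwards [hG] with ω hω
    rw [hYG hω]
    exact hZl ω hω

end Existence

/-! ### The system with pauses -/

section PauseSystem

variable {n : ℕ} {a b : ℝ}

/-- The rates of the moves of the system with pauses. -/
noncomputable def pauseRate (a b : ℝ) (n : ℕ) : Fin n ⊕ Fin n → ℝ :=
  Sum.elim (arrivalRate a b n) fun _ => n

lemma pauseRate_nonneg (hγ : ∀ i : Fin n, 0 < arrivalRate a b n i) (d : Fin n ⊕ Fin n) :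
    0 ≤ pauseRate a b n d := by
  rcases d with i | i
  · exact (hγ i).le
  · exact Nat.cast_nonneg n

lemma IsPauseSystem.isSolution {Ω : Type*} [MeasurableSpace Ω] {P : Measure Ω}
    {A D : Fin n → Ω → Measure (ℝ≥0 × ℝ≥0)} {Y : ℝ≥0 → Ω → Fin n → ℕ}
    (h : IsPauseSystem P a b n A D Y) (hγ : ∀ i : Fin n, 0 < arrivalRate a b n i) :
    IsSolution P (pauseRate a b n) (Sum.elim A D) Y where
  driver :=
    { poisson := by
        rintro (i | i)
        · exact h.poisson_arrivals i
        · exact h.poisson_departures i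
      indep := h.indep_drivers
      rate_nonneg := pauseRate_nonneg hγ }
  indep_initial := by
    have hm : Measurable fun (q : (Fin n → Measure (ℝ≥0 × ℝ≥0)) × (Fin n → Measure (ℝ≥0 × ℝ≥0)))
        (d : Fin n ⊕ Fin n) => Sum.elim q.1 q.2 d := by
      refine measurable_pi_lambda _ ?_
      rintro (i | i)
      · exact (measurable_pi_apply i).comp measurable_fst
      · exact (measurable_pi_apply i).comp measurable_snd
    have := h.indep_initial.comp measurable_id hm
    convert! this using 1
    ext ω d
    rcases d with i | i <;> rfl
  measurable := h.measurable
  path := by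
    filter_upwards [h.equation] with ω hω t i
    rw [hω t i, add_sub_assoc]
    rfl

/-- The system with pauses can be started from any law on the ordered configurations. -/
theorem exists_isPauseSystem (hγ : ∀ i : Fin n, 0 < arrivalRate a b n i)
    (ν : Measure (Fin n → ℕ)) [IsProbabilityMeasure ν] (hν : ∀ᵐ y ∂ν, Monotone y) :
    ∃ (Ω : Type) (_ : MeasurableSpace Ω) (P : Measure Ω) (_ : IsProbabilityMeasure P)
      (A D : Fin n → Ω → Measure (ℝ≥0 × ℝ≥0)) (Y : ℝ≥0 → Ω → Fin n → ℕ),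
      IsPauseSystem P a b n A D Y ∧ P.map (Y 0) = ν := by
  obtain ⟨Ω₀, _, P₀, N₀, hP₀, hN₀⟩ := exists_isPoissonRandomMeasure lebesgueQuadrant
  -- One independent copy of the Poisson random measure per move; the initial configuration lives on
  -- a separate factor.
  set Q : Measure (Fin n ⊕ Fin n → Ω₀) := Measure.infinitePi fun _ => P₀
  set P : Measure ((Fin n → ℕ) × (Fin n ⊕ Fin n → Ω₀)) := ν.prod Q
  set N : Fin n ⊕ Fin n → (Fin n → ℕ) × (Fin n ⊕ Fin n → Ω₀) → Measure (ℝ≥0 × ℝ≥0) :=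
    fun d ω => N₀ (ω.2 d)
  have hsnd : MeasurePreserving Prod.snd P Q := measurePreserving_snd
  have hfst : MeasurePreserving Prod.fst P ν := measurePreserving_fst
  have hNm : ∀ d, Measurable (N d) := fun d =>
    hN₀.measurable.comp ((measurable_pi_apply d).comp measurable_snd)
  have hdriver : IsDriver P (pauseRate a b n) N := by
    refine ⟨fun d => ?_, ?_, pauseRate_nonneg hγ⟩
    · exact hN₀.comp_measurePreserving
        ((measurePreserving_eval_infinitePi (fun _ => P₀) d).comp hsnd)
    · have hQ : iIndepFun (fun d (x : Fin n ⊕ Fin n → Ω₀) => N₀ (x d)) Q :=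
        iIndepFun_infinitePi (X := fun _ => N₀) fun _ => hN₀.measurable
      have hQm : ∀ d, Measurable fun x : Fin n ⊕ Fin n → Ω₀ => N₀ (x d) := fun d =>
        hN₀.measurable.comp (measurable_pi_apply d)
      rw [iIndepFun_iff_map_fun_eq_infinitePi_map hNm]
      rw [iIndepFun_iff_map_fun_eq_infinitePi_map hQm] at hQ
      have h1 : ∀ d, P.map (N d) = Q.map fun x => N₀ (x d) := fun d => by
        rw [← hsnd.map_eq, Measure.map_map (hQm d) measurable_snd]
        rfl
      simp_rw [h1]
      rw [← hQ]
      conv_rhs => rw [← hsnd.map_eq, Measure.map_map (measurable_pi_lambda _ hQm) measurable_snd]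
      rfl
  have hind : IndepFun (Prod.fst : (Fin n → ℕ) × (Fin n ⊕ Fin n → Ω₀) → Fin n → ℕ)
      (fun ω d => N d ω) P :=
    (indepFun_prod (μ := ν) (ν := Q) (X := id) (Y := fun (x : Fin n ⊕ Fin n → Ω₀) d => N₀ (x d)) measurable_id
      (measurable_pi_lambda _ fun d => hN₀.measurable.comp (measurable_pi_apply d)) :)
  obtain ⟨Y, hY, hY0, hr, hl⟩ := hdriver.exists_isSolution measurable_fst hind
  refine ⟨_, _, P, inferInstance, fun i => N (.inl i), fun i => N (.inr i), Y, ?_, ?_⟩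
  · refine ⟨fun i => hdriver.poisson _, fun i => hdriver.poisson _, ?_, ?_, hY.measurable, ?_, hr, hl,
      ?_⟩
    · convert! hdriver.indep using 1
      ext d : 1
      rcases d with i | i <;> rfl
    · exact hY.indep_initial.comp (φ := id) (ψ := fun x : Fin n ⊕ Fin n → Measure (ℝ≥0 × ℝ≥0) =>
        (fun i : Fin n => x (.inl i), fun i : Fin n => x (.inr i))) measurable_id (by fun_prop)
    · rw [hY0]
      exact hfst.quasiMeasurePreserving.ae hν
    · filter_upwards [hY.path] with ω hω t i
      rw [hω t i, netMoves, ← add_sub_assoc]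
      rfl
  · rw [hY0]
    exact hfst.map_eq

end PauseSystem

/-! ### Moves and ordered configurations -/

section Moves

variable {n : ℕ} {y : Fin n → ℕ}

lemma enabled_inl_iff {i : Fin n} :
    enabled (.inl i) y ↔ ∀ j : Fin n, j.val = i.val + 1 → y i < y j := by
  simp only [enabled, rankAbove]
  split_ifs with h
  · rw [Nat.cast_lt]
    refine ⟨fun hlt j hj => ?_, fun hlt => hlt _ rfl⟩
    rwa [show j = ⟨i.val + 1, h⟩ from Fin.ext hj]
  · exact ⟨fun _ j hj => absurd (hj ▸ j.isLt) h, fun _ => ENat.natCast_lt_top _⟩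

lemma enabled_inr_iff {i : Fin n} :
    enabled (.inr i) y ↔ 0 < y i ∧ ∀ j : Fin n, j.val + 1 = i.val → y j < y i := by
  simp only [enabled, rankBelow]
  split_ifs with h
  · exact ⟨fun hlt => ⟨hlt, fun j hj => by omega⟩, fun hlt => hlt.1⟩
  · refine ⟨fun hlt => ⟨by omega, fun j hj => ?_⟩, fun hlt => hlt.2 _ (by simp; omega)⟩
    rwa [show j = ⟨i.val - 1, by omega⟩ from Fin.ext (by simp; omega)]

lemma step_of_not_enabled {d : Fin n ⊕ Fin n} (h : ¬ enabled d y) : step d y = y := if_neg h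

lemma step_inl {i : Fin n} (h : enabled (.inl i) y) :
    step (.inl i) y = Function.update y i (y i + 1) := if_pos h

lemma step_inr {i : Fin n} (h : enabled (.inr i) y) :
    step (.inr i) y = Function.update y i (y i - 1) := if_pos h

lemma step_ne_self {d : Fin n ⊕ Fin n} (h : enabled d y) : step d y ≠ y := by
  rcases d with i | i
  · rw [step_inl h]
    intro heq
    have := congrFun heq i
    simp at this
  · rw [step_inr h]
    intro heq
    have := congrFun heq i
    have := (enabled_inr_iff.1 h).1
    simp at *
    omega

/-- Enabledness is a strict inequality with the neighbouring rank, so a change by one unit cannot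
cross it. -/
lemma monotone_step (d : Fin n ⊕ Fin n) (hy : Monotone y) : Monotone (step d y) := by
  by_cases h : enabled d y
  swap
  · rwa [step_of_not_enabled h]
  rcases d with i | i
  · rw [step_inl h]
    intro j k hjk
    rcases eq_or_ne j i with rfl | hj <;> rcases eq_or_ne k j with rfl | hk
    · rfl
    · have hlt : j.val < k.val := lt_of_le_of_ne hjk fun he => hk (Fin.ext he.symm)
      have h1 := enabled_inl_iff.1 h ⟨j.val + 1, by omega⟩ rfl
      have h2 : y ⟨j.val + 1, by omega⟩ ≤ y k := hy (Fin.le_def.2 hlt)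
      simp only [Function.update_self, Function.update_of_ne hk]
      omega
    · rfl
    · have h1 := hy hjk
      rcases eq_or_ne k i with rfl | hki
      · simp only [Function.update_self, Function.update_of_ne hj]
        omega
      · simpa only [Function.update_of_ne hki, Function.update_of_ne hj] using h1
  · rw [step_inr h]
    intro j k hjk
    have h1 := hy hjk
    rcases eq_or_ne k i with rfl | hk <;> rcases eq_or_ne j k with rfl | hj
    · rfl
    · have hlt : j.val < k.val := lt_of_le_of_ne hjk fun he => hj (Fin.ext he)
      have h1 := (enabled_inr_iff.1 h).2 ⟨k.val - 1, by omega⟩ (by simp; omega)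
      have h2 : y j ≤ y ⟨k.val - 1, by omega⟩ := hy (Fin.le_def.2 (by simp; omega))
      simp only [Function.update_self, Function.update_of_ne hj]
      omega
    · rfl
    · rcases eq_or_ne j i with rfl | hji
      · simp only [Function.update_self, Function.update_of_ne hk]
        omega
      · simpa only [Function.update_of_ne hji, Function.update_of_ne hk] using h1

/-- Every enabled move from an ordered configuration can be undone by the opposite move. -/
lemma enabled_swap_step (hy : Monotone y) {d : Fin n ⊕ Fin n} (h : enabled d y) :
    enabled d.swap (step d y) ∧ step d.swap (step d y) = y := by
  suffices hs : enabled d.swap (step d y) by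
    refine ⟨hs, ?_⟩
    rcases d with i | i
    · simp only [Sum.swap_inl] at hs ⊢
      rw [step_inr hs, step_inl h]
      simp
    · simp only [Sum.swap_inr] at hs ⊢
      rw [step_inl hs, step_inr h]
      have := (enabled_inr_iff.1 h).1
      simp [Nat.sub_add_cancel this]
  rcases d with i | i
  · rw [step_inl h, Sum.swap_inl, enabled_inr_iff]
    refine ⟨by simp, fun j hj => ?_⟩
    have hji : j ≠ i := fun he => by subst he; omega
    have := hy (Fin.le_def.2 (show j.val ≤ i.val by omega))
    simp only [Function.update_self, Function.update_of_ne hji]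
    omega
  · rw [step_inr h, Sum.swap_inr, enabled_inl_iff]
    intro j hj
    have hji : j ≠ i := fun he => by subst he; omega
    have := hy (Fin.le_def.2 (show i.val ≤ j.val by omega))
    have := (enabled_inr_iff.1 h).1
    simp only [Function.update_self, Function.update_of_ne hji]
    omega

/-- The empty configuration can be reached from every configuration. -/
lemma zero_mem_of_step_mem {S : Set (Fin n → ℕ)} (hS : ∀ d, ∀ y ∈ S, step d y ∈ S) (hy : y ∈ S) :
    0 ∈ S := by
  induction hk : ∑ i, y i using Nat.strong_induction_on generalizing y with
  | _ k ih =>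
    by_cases h0 : y = 0
    · rwa [← h0]
    obtain ⟨i₀, hi₀⟩ := Function.ne_iff.1 h0
    -- At the lowest rank with a nonempty queue a departure is enabled, and it lowers the total on
    -- which the induction runs.
    obtain ⟨i, hi, hmin⟩ := WellFounded.has_min (wellFounded_lt (α := Fin n)) {i | y i ≠ 0}
      ⟨i₀, hi₀⟩
    have hen : enabled (.inr i) y := by
      refine enabled_inr_iff.2 ⟨Nat.pos_of_ne_zero hi, fun j hj => ?_⟩
      have hj0 : y j = 0 := by
        by_contra hne
        exact hmin j hne (Fin.lt_def.2 (by omega))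
      rw [hj0]
      exact Nat.pos_of_ne_zero hi
    refine ih _ ?_ (hS (.inr i) y hy) rfl
    rw [← hk, step_inr hen]
    refine Finset.sum_lt_sum (fun j _ => ?_) ⟨i, Finset.mem_univ i, ?_⟩
    · rcases eq_or_ne j i with rfl | hj
      · simp
      · rw [Function.update_of_ne hj]
    · rw [Function.update_self]
      exact Nat.sub_lt (Nat.pos_of_ne_zero hi) one_pos

end Moves

/-! ### Invariant laws -/

section Invariant

variable {n : ℕ} {r : Fin n ⊕ Fin n → ℝ}

-- Among ordered configurations, `y` has only two possible predecessors under `d`: itself, if the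
-- move is blocked there, and the configuration reached from `y` by the opposite move.
open Classical in
lemma measureReal_preimage_step {μ : Measure (Fin n → ℕ)} [IsFiniteMeasure μ]
    (hμ : ∀ᵐ y ∂μ, Monotone y) (d : Fin n ⊕ Fin n) {y : Fin n → ℕ} (hy : Monotone y) :
    μ.real (step d ⁻¹' {y}) = (if enabled d y then 0 else μ.real {y})
      + if enabled d.swap y then μ.real {step d.swap y} else 0 := by
  have hmem : ∀ x, Monotone x → (step d x = y ↔
      (¬ enabled d y ∧ x = y) ∨ (enabled d.swap y ∧ x = step d.swap y)) := by
    intro x hx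
    constructor
    · rintro rfl
      by_cases hen : enabled d x
      · obtain ⟨h1, h2⟩ := enabled_swap_step hx hen
        exact .inr ⟨h1, h2.symm⟩
      · rw [step_of_not_enabled hen]
        exact .inl ⟨hen, rfl⟩
    · rintro (⟨h1, rfl⟩ | ⟨h1, rfl⟩)
      · exact step_of_not_enabled h1
      · simpa using (enabled_swap_step hy h1).2
  have hset : μ.real (step d ⁻¹' {y}) = μ.real ({x | ¬ enabled d y ∧ x = y} ∪
      {x | enabled d.swap y ∧ x = step d.swap y}) := by
    refine measureReal_congr ?_
    filter_upwards [hμ] with x hx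
    exact propext (hmem x hx)
  rw [hset, measureReal_union _ .of_discrete]
  · congr 1
    · split_ifs with h <;> simp [h]
    · split_ifs with h <;> simp [h]
  · rw [Set.disjoint_left]
    rintro x ⟨-, rfl⟩ ⟨h1, h2⟩
    exact step_ne_self h1 h2.symm

/-- Detailed balance implies invariance. -/
theorem isInvariantLaw_of_detailed_balance {μ : Measure (Fin n → ℕ)} [IsFiniteMeasure μ]
    (hμ : ∀ᵐ y ∂μ, Monotone y)
    (hbal : ∀ y, Monotone y → ∀ i, enabled (.inl i) y →
      r (.inl i) * μ.real {y} = r (.inr i) * μ.real {step (.inl i) y}) :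
    IsInvariantLaw r μ := by
  classical
  intro y
  by_cases hy : Monotone y
  swap
  -- Off the ordered configurations both sides vanish, since moves preserve the order.
  · have h0 : ∀ A : Set (Fin n → ℕ), (∀ x ∈ A, ¬ Monotone x) → μ.real A = 0 := fun A hA =>
      (measureReal_eq_zero_iff).2 (measure_mono_null hA hμ)
    rw [h0 {y} (by simpa using hy), mul_zero]
    refine Finset.sum_eq_zero fun d _ => ?_
    rw [h0 _ fun x hx hmono => hy (by rw [← (hx : step d x = y)]; exact monotone_step d hmono),
      mul_zero]
  have hbal' : ∀ d, enabled d y → r d.swap * μ.real {step d y} = r d * μ.real {y} := by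
    rintro (i | i) hd
    · exact (hbal y hy i hd).symm
    · obtain ⟨h1, h2⟩ := enabled_swap_step hy hd
      have := hbal _ (monotone_step _ hy) i h1
      rw [Sum.swap_inr] at h2
      rw [h2] at this
      exact this
  simp_rw [measureReal_preimage_step hμ _ hy, mul_add, Finset.sum_add_distrib]
  -- Exchanging arrivals and departures, detailed balance turns the inflow into `y` through a move
  -- into the outflow through its opposite.
  have hswap : ∑ d, r d * (if enabled d.swap y then μ.real {step d.swap y} else 0)
      = ∑ d, r d * (if enabled d y then μ.real {y} else 0) := by
    rw [← Equiv.sum_comp (Equiv.sumComm (Fin n) (Fin n))]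
    refine Finset.sum_congr rfl fun d _ => ?_
    simp only [Equiv.sumComm_apply, Sum.swap_swap]
    split_ifs with h
    · exact hbal' d h
    · simp
  rw [hswap, ← Finset.sum_add_distrib, Finset.sum_mul]
  refine Finset.sum_congr rfl fun d _ => ?_
  split_ifs <;> simp

/-- As functions of `S` both sides are finite measures on a countable space, so balance on
singletons extends to all sets. -/
lemma IsInvariantLaw.measureReal_preimage {μ : Measure (Fin n → ℕ)} [IsFiniteMeasure μ]
    (h : IsInvariantLaw r μ) (hr : ∀ d, 0 ≤ r d) (S : Set (Fin n → ℕ)) :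
    ∑ d, r d * μ.real (step d ⁻¹' S) = (∑ d, r d) * μ.real S := by
  have hm : ∀ d : Fin n ⊕ Fin n, Measurable (step d) := fun d => .of_discrete
  have hreal : ∀ S : Set (Fin n → ℕ), (∑ d, ENNReal.ofReal (r d) • μ.map (step d)) S
      = ENNReal.ofReal (∑ d, r d * μ.real (step d ⁻¹' S)) := by
    intro S
    rw [ENNReal.ofReal_sum_of_nonneg fun d _ => mul_nonneg (hr d) measureReal_nonneg,
      Measure.finsetSum_apply]
    refine Finset.sum_congr rfl fun d _ => ?_
    rw [Measure.smul_apply, Measure.map_apply (hm d) .of_discrete, ENNReal.ofReal_mul (hr d),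
      ofReal_measureReal, smul_eq_mul]
  have heq : ∑ d, ENNReal.ofReal (r d) • μ.map (step d) = ENNReal.ofReal (∑ d, r d) • μ := by
    refine Measure.ext_of_singleton fun y => ?_
    rw [hreal, h y, Measure.smul_apply, ENNReal.ofReal_mul (Finset.sum_nonneg fun d _ => hr d),
      ofReal_measureReal, smul_eq_mul]
  have h1 := hreal S
  rw [heq, Measure.smul_apply, smul_eq_mul, ← ofReal_measureReal,
    ← ENNReal.ofReal_mul (Finset.sum_nonneg fun d _ => hr d)] at h1
  exact ((ENNReal.ofReal_eq_ofReal_iff (mul_nonneg (Finset.sum_nonneg fun d _ => hr d)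
    measureReal_nonneg) (Finset.sum_nonneg fun d _ => mul_nonneg (hr d) measureReal_nonneg)).1
    h1).symm

lemma measureReal_le_of_singleton_le {E : Type*} [MeasurableSpace E] [Countable E]
    [MeasurableSingletonClass E] {μ ν : Measure E} [IsFiniteMeasure μ] [IsFiniteMeasure ν]
    {B : Set E} (h : ∀ x ∈ B, μ.real {x} ≤ ν.real {x}) : μ.real B ≤ ν.real B := by
  refine ENNReal.toReal_mono (measure_ne_top _ _) ?_
  have hB : B.Countable := B.to_countable
  rw [← Set.biUnion_of_singleton B]
  rw [measure_biUnion hB (fun x _ z _ hxz => by simpa using hxz) fun x _ => measurableSet_singleton x,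
    measure_biUnion hB (fun x _ z _ hxz => by simpa using hxz) fun x _ => measurableSet_singleton x]
  exact ENNReal.tsum_le_tsum fun x =>
    (ENNReal.toReal_le_toReal (measure_ne_top _ _) (measure_ne_top _ _)).1 (h x x.2)

/-- The set where one invariant law charges more than another one is stable under all moves. -/
lemma IsInvariantLaw.step_mem {μ ν : Measure (Fin n → ℕ)} [IsFiniteMeasure μ] [IsFiniteMeasure ν]
    (hμ : IsInvariantLaw r μ) (hν : IsInvariantLaw r ν) (hr : ∀ d, 0 < r d) (d : Fin n ⊕ Fin n)
    {y : Fin n → ℕ} (hy : ν.real {y} < μ.real {y}) :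
    ν.real {step d y} < μ.real {step d y} := by
  set S : Set (Fin n → ℕ) := {y | ν.real {y} < μ.real {y}}
  have hr' : ∀ d, 0 ≤ r d := fun d => (hr d).le
  have hsplit : ∀ (κ : Measure (Fin n → ℕ)) [IsFiniteMeasure κ] (B : Set (Fin n → ℕ)),
      κ.real S - κ.real B = κ.real (S \ B) - κ.real (B \ S) := by
    intro κ _ B
    have h1 := measureReal_inter_add_sdiff (μ := κ) (s := S) (t := B) .of_discrete
    have h2 := measureReal_inter_add_sdiff (μ := κ) (s := B) (t := S) .of_discrete
    rw [Set.inter_comm] at h2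
    linarith
  -- `S` is positive for `μ - ν` and its complement is negative, so `S` maximizes `μ - ν` over all
  -- sets.
  have hpos : ∀ B, 0 ≤ (μ.real S - ν.real S) - (μ.real B - ν.real B) := by
    intro B
    have h1 : μ.real (B \ S) ≤ ν.real (B \ S) :=
      measureReal_le_of_singleton_le fun x hx => not_lt.1 hx.2
    have h2 : ν.real (S \ B) ≤ μ.real (S \ B) :=
      measureReal_le_of_singleton_le fun x hx => (hx.1 : _ < _).le
    linarith [hsplit μ B, hsplit ν B]
  -- By invariance the weighted deficits of the sets `step d ⁻¹' S` sum to zero; being nonnegative,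
  -- they all vanish.
  have hsum : ∑ d, r d * ((μ.real S - ν.real S)
      - (μ.real (step d ⁻¹' S) - ν.real (step d ⁻¹' S))) = 0 := by
    simp_rw [mul_sub, Finset.sum_sub_distrib]
    rw [hμ.measureReal_preimage hr', hν.measureReal_preimage hr', Finset.sum_mul, Finset.sum_mul]
    ring
  have hd := (mul_eq_zero.1 ((Finset.sum_eq_zero_iff_of_nonneg fun d _ =>
    mul_nonneg (hr' d) (hpos _)).1 hsum d (Finset.mem_univ d))).resolve_left (hr d).ne'
  by_contra hne
  -- If `d` led from `y` out of `S`, then `step d ⁻¹' S` would miss the point `y`, where `μ`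
  -- strictly exceeds `ν`, and its deficit would be positive.
  have hmem : y ∈ S \ step d ⁻¹' S := ⟨hy, hne⟩
  have h1 : μ.real (step d ⁻¹' S \ S) ≤ ν.real (step d ⁻¹' S \ S) :=
    measureReal_le_of_singleton_le fun x hx => not_lt.1 hx.2
  have h2 : ν.real ((S \ step d ⁻¹' S) \ {y}) ≤ μ.real ((S \ step d ⁻¹' S) \ {y}) :=
    measureReal_le_of_singleton_le fun x hx => (hx.1.1 : _ < _).le
  have h3 : ∀ (κ : Measure (Fin n → ℕ)) [IsFiniteMeasure κ],
      κ.real {y} + κ.real ((S \ step d ⁻¹' S) \ {y}) = κ.real (S \ step d ⁻¹' S) := by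
    intro κ _
    have := measureReal_inter_add_sdiff (μ := κ) (s := S \ step d ⁻¹' S) (t := {y}) .of_discrete
    rwa [Set.inter_eq_right.2 (Set.singleton_subset_iff.2 hmem)] at this
  linarith [hsplit μ (step d ⁻¹' S), hsplit ν (step d ⁻¹' S), h3 μ, h3 ν]

lemma exists_singleton_lt_of_ne {E : Type*} [MeasurableSpace E] [Countable E]
    [MeasurableSingletonClass E] {μ ν : Measure E} [IsProbabilityMeasure μ]
    [IsProbabilityMeasure ν] (h : μ ≠ ν) : ∃ x, ν.real {x} < μ.real {x} := by
  by_contra! hle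
  refine h (Measure.ext_of_singleton fun x => ?_)
  have h1 : μ.real {x}ᶜ ≤ ν.real {x}ᶜ := measureReal_le_of_singleton_le fun z _ => hle z
  rw [probReal_compl_eq_one_sub (measurableSet_singleton x),
    probReal_compl_eq_one_sub (measurableSet_singleton x)] at h1
  rw [← ofReal_measureReal, ← ofReal_measureReal (μ := ν), le_antisymm (hle x) (by linarith)]

/-- There is at most one invariant law if all moves have positive rates. -/
theorem IsInvariantLaw.eq {μ ν : Measure (Fin n → ℕ)} [IsProbabilityMeasure μ]
    [IsProbabilityMeasure ν] (hμ : IsInvariantLaw r μ) (hν : IsInvariantLaw r ν)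
    (hr : ∀ d, 0 < r d) : μ = ν := by
  by_contra hne
  obtain ⟨x, hx⟩ := exists_singleton_lt_of_ne hne
  obtain ⟨z, hz⟩ := exists_singleton_lt_of_ne (Ne.symm hne)
  -- Both strict-inequality sets are stable and nonempty, so both would contain the empty
  -- configuration.
  have h1 := zero_mem_of_step_mem (S := {y | ν.real {y} < μ.real {y}})
    (fun d y hy => hμ.step_mem hν hr d hy) hx
  have h2 := zero_mem_of_step_mem (S := {y | μ.real {y} < ν.real {y}})
    (fun d y hy => hν.step_mem hμ hr d hy) hz
  simp only [Set.mem_ofPred_eq] at h1 h2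
  exact lt_asymm h1 h2

end Invariant

/-! ### The parameters of the stationary law -/

section Parameters

variable {a b : ℝ} {n : ℕ}

lemma gapFactor_eq (hn : 0 < n) (j : Fin n) :
    1 - a / (n : ℝ) ^ (3 / 2 : ℝ) + b / √n * (if j.val = 0 then 1 else 0)
      = arrivalRate a b n j / n := by
  have hn' : (0 : ℝ) < n := Nat.cast_pos.2 hn
  have hs : 0 < √(n : ℝ) := Real.sqrt_pos.2 hn'
  have h1 : (n : ℝ) ^ (3 / 2 : ℝ) = n * √n := by
    rw [Real.sqrt_eq_rpow, show (3 / 2 : ℝ) = 1 + 1 / 2 by norm_num, Real.rpow_add hn',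
      Real.rpow_one]
  have h2 : b / √(n : ℝ) = b * √n / n := by
    rw [div_eq_div_iff hs.ne' hn'.ne', mul_assoc, Real.mul_self_sqrt hn'.le]
  rw [h1, arrivalRate, h2]
  split_ifs
  · field_simp
  · field_simp
    ring

lemma gapRatio_eq_prod (hn : 0 < n) (i : Fin n) :
    gapRatio a b n i = ∏ j ∈ Finset.Ici i, arrivalRate a b n j / n :=
  Finset.prod_congr rfl fun j _ => gapFactor_eq hn j

lemma gapRatio_pos (hn : 0 < n) (hγ : ∀ i : Fin n, 0 < arrivalRate a b n i) (i : Fin n) :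
    0 < gapRatio a b n i := by
  rw [gapRatio_eq_prod hn]
  exact Finset.prod_pos fun j _ => div_pos (hγ j) (Nat.cast_pos.2 hn)

lemma gapRatio_eq (i : Fin n) :
    gapRatio a b n i = (1 - a / (n : ℝ) ^ (3 / 2 : ℝ) + b / √n * (if i.val = 0 then 1 else 0))
      * (1 - a / (n : ℝ) ^ (3 / 2 : ℝ)) ^ (n - 1 - i.val) := by
  rw [gapRatio, ← Finset.Ioi_insert, Finset.prod_insert (by simp), ← Fin.card_Ioi,
    ← Finset.prod_const]
  congr 1
  refine Finset.prod_congr rfl fun j hj => ?_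
  rw [if_neg (by have := Fin.lt_def.1 (Finset.mem_Ioi.1 hj); omega)]
  ring

/-- By `1 + x ≤ exp x` it suffices that the sum of `γⱼ / n - 1` over `j ≥ i` is negative. At the
lowest rank this sum is `(b - a) / √n`; at the others all its terms are negative. -/
lemma gapRatio_lt_one (hb : 0 < b) (hab : b < a) (hγ : ∀ i : Fin n, 0 < arrivalRate a b n i)
    (i : Fin n) : gapRatio a b n i < 1 := by
  have hn : 0 < n := i.pos
  have hn' : (0 : ℝ) < n := Nat.cast_pos.2 hn
  have hs : 0 < √(n : ℝ) := Real.sqrt_pos.2 hn'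
  have hle : gapRatio a b n i
      ≤ ∏ j ∈ Finset.Ici i, Real.exp (arrivalRate a b n j / n - 1) := by
    rw [gapRatio_eq_prod hn]
    refine Finset.prod_le_prod (fun j _ => (div_pos (hγ j) hn').le) fun j _ => ?_
    simpa using Real.add_one_le_exp (arrivalRate a b n j / n - 1)
  refine hle.trans_lt ?_
  rw [← Real.exp_sum, Real.exp_lt_one_iff]
  have hterm : ∀ j : Fin n, arrivalRate a b n j / n - 1
      = (if j.val = 0 then b / √n else 0) - a / √n / n := by
    intro j
    have h2 : b / √(n : ℝ) = b * √n / n := by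
      rw [div_eq_div_iff hs.ne' hn'.ne', mul_assoc, Real.mul_self_sqrt hn'.le]
    rw [h2, arrivalRate]
    split_ifs <;> field_simp <;> ring
  simp_rw [hterm]
  rw [← Finset.Ioi_insert, Finset.sum_insert (by simp)]
  have hrest : ∑ j ∈ Finset.Ioi i, ((if j.val = 0 then b / √(n : ℝ) else 0) - a / √n / n)
      = -((n - 1 - i.val : ℕ) * (a / √n / n)) := by
    rw [← Fin.card_Ioi, ← nsmul_eq_mul, ← Finset.sum_const, ← Finset.sum_neg_distrib]
    refine Finset.sum_congr rfl fun j hj => ?_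
    rw [if_neg (by have := Fin.lt_def.1 (Finset.mem_Ioi.1 hj); omega)]
    ring
  rw [hrest]
  have ha : 0 < a / √(n : ℝ) / n := by have := hb.trans hab; positivity
  split_ifs with h0
  · have hcast : ((n - 1 - i.val : ℕ) : ℝ) = n - 1 := by
      rw [h0, Nat.sub_zero, Nat.cast_sub (by omega), Nat.cast_one]
    rw [hcast]
    have h3 : b / √(n : ℝ) < a / √n := by gcongr
    have h4 : (n : ℝ) * (a / √n / n) = a / √n := by field_simp
    linarith
  · have : 0 ≤ ((n - 1 - i.val : ℕ) : ℝ) * (a / √n / n) := by positivity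
    linarith

/-- `log (1 + u) = u + o(u)`; the factor `c` may be unbounded because only `c * u` has to converge.
-/
lemma tendsto_mul_log_one_add {c u : ℕ → ℝ} {l : ℝ} (hu : Tendsto u atTop (𝓝 0))
    (hcu : Tendsto (fun n => c n * u n) atTop (𝓝 l)) :
    Tendsto (fun n => c n * Real.log (1 + u n)) atTop (𝓝 l) := by
  have hd : HasDerivAt Real.log 1 1 := by simpa using Real.hasDerivAt_log one_ne_zero
  have h1 := (hasDerivAt_iff_isLittleO_nhds_zero.1 hd).comp_tendsto hu
  have h2 : (fun n => c n * (Real.log (1 + u n) - u n)) =o[atTop] fun n => c n * u n := by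
    refine (Asymptotics.isBigO_refl c atTop).mul_isLittleO ?_
    simpa [Function.comp_def] using h1
  simpa [mul_sub] using (h2.tendsto_zero_of_tendsto hcu).add hcu

/-- The rates of the coordinates of the limit law. -/
noncomputable def limitRate (a b : ℝ) (i : ℕ) : ℝ := if i = 0 then a - b else a

lemma limitRate_pos (hb : 0 < b) (hab : b < a) (i : ℕ) : 0 < limitRate a b i := by
  rw [limitRate]
  split_ifs <;> linarith

/-- The rate of the exponential law whose integer part is geometric with ratio `gapRatio`. -/
noncomputable def gapRate (a b : ℝ) (n : ℕ) (i : Fin n) : ℝ := -Real.log (gapRatio a b n i)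

lemma gapRate_pos (hb : 0 < b) (hab : b < a) (hγ : ∀ i : Fin n, 0 < arrivalRate a b n i)
    (i : Fin n) : 0 < gapRate a b n i :=
  neg_pos.2 (Real.log_neg (gapRatio_pos i.pos hγ i) (gapRatio_lt_one hb hab hγ i))

lemma exp_neg_gapRate_mul (hγ : ∀ i : Fin n, 0 < arrivalRate a b n i) (i : Fin n) (k : ℕ) :
    Real.exp (-(gapRate a b n i * k)) = gapRatio a b n i ^ k := by
  rw [gapRate, neg_mul, neg_neg, mul_comm, Real.exp_nat_mul, Real.exp_log (gapRatio_pos i.pos hγ i)]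

/-- In the limit of `√n * log ρ`, the factor of rank `k` itself contributes `b` at the lowest rank
and zero elsewhere. The other `n - 1 - k` factors, each `1 - a / n ^ (3 / 2)`, contribute `-a`
together. -/
lemma tendsto_sqrt_mul_gapRate (a b : ℝ) (k : ℕ) :
    Tendsto (fun n : ℕ => if h : k < n then √n * gapRate a b n ⟨k, h⟩ else 0) atTop
      (𝓝 (limitRate a b k)) := by
  set e : ℝ := if k = 0 then 1 else 0
  have hsq : Tendsto (fun n : ℕ => √(n : ℝ)) atTop atTop :=
    Real.tendsto_sqrt_atTop.comp tendsto_natCast_atTop_atTop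
  have hinv : Tendsto (fun n : ℕ => ((n : ℝ))⁻¹) atTop (𝓝 0) := tendsto_inv_atTop_nhds_zero_nat
  have hx : Tendsto (fun n : ℕ => -(a / (n : ℝ) ^ (3 / 2 : ℝ))) atTop (𝓝 0) := by
    have := ((tendsto_rpow_atTop (show (0 : ℝ) < 3 / 2 by norm_num)).comp
      tendsto_natCast_atTop_atTop).const_div_atTop a
    simpa using this.neg
  have hpow : ∀ n : ℕ, 0 < n → (n : ℝ) ^ (3 / 2 : ℝ) = n * √n := fun n hn => by
    rw [Real.sqrt_eq_rpow, show (3 / 2 : ℝ) = 1 + 1 / 2 by norm_num,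
      Real.rpow_add (Nat.cast_pos.2 hn), Real.rpow_one]
  have h1 : Tendsto (fun n : ℕ => √(n : ℝ)
      * Real.log (1 + (-(a / (n : ℝ) ^ (3 / 2 : ℝ)) + b / √n * e))) atTop (𝓝 (b * e)) := by
    refine tendsto_mul_log_one_add ?_ ?_
    · simpa using hx.add ((hsq.const_div_atTop b).mul_const e)
    · have h : Tendsto (fun n : ℕ => -a * (n : ℝ)⁻¹ + b * e) atTop (𝓝 (-a * 0 + b * e)) :=
        (hinv.const_mul (-a)).add_const _
      rw [mul_zero, zero_add] at h
      refine h.congr' ?_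
      filter_upwards [eventually_gt_atTop 0] with n hn
      have hn' : (0 : ℝ) < n := Nat.cast_pos.2 hn
      have hs : 0 < √(n : ℝ) := Real.sqrt_pos.2 hn'
      rw [hpow n hn]
      field_simp
  have h2 : Tendsto (fun n : ℕ => √(n : ℝ) * (n - 1 - k)
      * Real.log (1 + -(a / (n : ℝ) ^ (3 / 2 : ℝ)))) atTop (𝓝 (-a)) := by
    refine tendsto_mul_log_one_add hx ?_
    have h : Tendsto (fun n : ℕ => -a + a * (1 + k) * (n : ℝ)⁻¹) atTop
        (𝓝 (-a + a * (1 + k) * 0)) := (hinv.const_mul _).const_add _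
    rw [mul_zero, add_zero] at h
    refine h.congr' ?_
    filter_upwards [eventually_gt_atTop 0] with n hn
    have hn' : (0 : ℝ) < n := Nat.cast_pos.2 hn
    have hs : 0 < √(n : ℝ) := Real.sqrt_pos.2 hn'
    rw [hpow n hn]
    field_simp
    ring
  have h3 := (h1.add h2).neg
  have hlim : -(b * e + -a) = limitRate a b k := by
    simp only [limitRate, e]
    split_ifs <;> ring
  rw [hlim] at h3
  have hp1 : ∀ᶠ n : ℕ in atTop, 0 < 1 + (-(a / (n : ℝ) ^ (3 / 2 : ℝ)) + b / √n * e) := by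
    have h : Tendsto (fun n : ℕ => 1 + (-(a / (n : ℝ) ^ (3 / 2 : ℝ)) + b / √n * e)) atTop
        (𝓝 1) := by
      simpa using (hx.add ((hsq.const_div_atTop b).mul_const e)).const_add 1
    exact h.eventually_const_lt one_pos
  have hp2 : ∀ᶠ n : ℕ in atTop, 0 < 1 + -(a / (n : ℝ) ^ (3 / 2 : ℝ)) := by
    have h : Tendsto (fun n : ℕ => 1 + -(a / (n : ℝ) ^ (3 / 2 : ℝ))) atTop (𝓝 1) := by
      simpa using hx.const_add 1
    exact h.eventually_const_lt one_pos
  refine h3.congr' ?_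
  filter_upwards [eventually_gt_atTop k, hp1, hp2] with n hk hq1 hq2
  have hcast : ((n - 1 - k : ℕ) : ℝ) = n - 1 - k := by
    rw [Nat.cast_sub (by omega), Nat.cast_sub (by omega), Nat.cast_one]
  rw [dif_pos hk, gapRate, gapRatio_eq, sub_eq_add_neg 1, add_assoc,
    Real.log_mul hq1.ne' (pow_pos hq2 _).ne', Real.log_pow, hcast]
  ring

end Parameters

/-! ### The stationary law of the gaps -/

section GapLaw

variable {a b : ℝ} {n : ℕ}

/-- The law of the coordinate `i` under `atlasMeasure`. -/
noncomputable def coordinateLaw (a b : ℝ) (i : ℕ) : Measure ℝ≥0 :=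
  (expMeasure (limitRate a b i)).map Real.toNNReal

lemma isProbabilityMeasure_coordinateLaw (hb : 0 < b) (hab : b < a) (i : ℕ) :
    IsProbabilityMeasure (coordinateLaw a b i) := by
  have := isProbabilityMeasure_expMeasure (limitRate_pos hb hab i)
  exact Measure.isProbabilityMeasure_map measurable_real_toNNReal.aemeasurable

lemma expMeasure_real_Ici {θ c : ℝ} (hθ : 0 < θ) (hc : 0 ≤ c) :
    (expMeasure θ).real (Set.Ici c) = Real.exp (-(θ * c)) := by
  have := isProbabilityMeasure_expMeasure hθ
  have h0 : expMeasure θ {c} = 0 :=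
    withDensity_absolutelyContinuous volume _ (measure_singleton c)
  have h1 : (expMeasure θ).real (Set.Ici c) = (expMeasure θ).real (Set.Iic c)ᶜ := by
    rw [Set.compl_Iic]
    refine measureReal_congr ?_
    have : ∀ᵐ x ∂expMeasure θ, x ≠ c := compl_mem_ae_iff.2 h0
    filter_upwards [this] with x hx
    exact propext ⟨fun h => lt_of_le_of_ne h hx.symm, fun h => le_of_lt h⟩
  rw [h1, probReal_compl_eq_one_sub measurableSet_Iic, ← cdf_eq_real, cdf_expMeasure_eq hθ,
    if_pos hc]
  ring

lemma coordinateLaw_real_le (hb : 0 < b) (hab : b < a) (i : ℕ) {c : ℝ} (hc : 0 ≤ c) :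
    (coordinateLaw a b i).real {x | c ≤ x} = Real.exp (-(limitRate a b i * c)) := by
  rw [coordinateLaw, map_measureReal_apply measurable_real_toNNReal
    (measurableSet_le measurable_const measurable_coe_nnreal_real)]
  have := isProbabilityMeasure_expMeasure (limitRate_pos hb hab i)
  rcases hc.eq_or_lt with rfl | hc
  · simp
  · rw [← expMeasure_real_Ici (limitRate_pos hb hab i) hc.le]
    congr 1
    ext x
    simp only [Set.mem_preimage, Set.mem_ofPred_eq, Set.mem_Ici, Real.coe_toNNReal', le_max_iff,
      not_le.2 hc, or_false]

/-- The integer gaps obtained by rounding the coordinates of a point of `ℝ₊^∞`. -/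
noncomputable def roundGaps (a b : ℝ) (n : ℕ) (x : ℕ → ℝ≥0) : Fin n → ℕ :=
  fun i => ⌊(x i : ℝ) * (limitRate a b i / gapRate a b n i)⌋₊

lemma measurable_roundGaps (a b : ℝ) (n : ℕ) : Measurable (roundGaps a b n) :=
  measurable_pi_lambda _ fun i => Nat.measurable_floor.comp
    ((measurable_coe_nnreal_real.comp (measurable_pi_apply i.val)).mul_const _)

lemma infinitePi_real_pi_fin {E : Type*} [MeasurableSpace E] (μ : ℕ → Measure E)
    [∀ i, IsProbabilityMeasure (μ i)] {t : Fin n → Set E} (ht : ∀ i, MeasurableSet (t i)) :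
    (Measure.infinitePi μ).real {x | ∀ i : Fin n, x i ∈ t i} = ∏ i : Fin n, (μ i).real (t i) := by
  set s : ℕ → Set E := fun k => if h : k < n then t ⟨k, h⟩ else Set.univ
  have hs : ∀ i : Fin n, s i = t i := fun i => dif_pos i.isLt
  have hset : {x : ℕ → E | ∀ i : Fin n, x i ∈ t i} = (Finset.range n : Set ℕ).pi s := by
    ext x
    simp only [Set.mem_ofPred_eq, Set.mem_pi, Finset.coe_range, Set.mem_Iio]
    refine ⟨fun h k hk => ?_, fun h i => by simpa [hs] using h i i.isLt⟩
    simpa [s, hk] using h ⟨k, hk⟩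
  rw [hset, measureReal_def, Measure.infinitePi_pi μ, ENNReal.toReal_prod, Finset.prod_range]
  · simp_rw [hs]
    rfl
  · intro k hk
    have hk' := Finset.mem_range.1 hk
    simpa [s, hk'] using ht ⟨k, hk'⟩

/-- The stationary law of the unscaled gaps. -/
noncomputable def gapLaw (a b : ℝ) (n : ℕ) : Measure (Fin n → ℕ) :=
  (atlasMeasure a b).map (roundGaps a b n)

/-- Positivity of the arrival rates plays no role here, so the family of laws is available for every
`n`. -/
lemma isProbabilityMeasure_gapLaw (hb : 0 < b) (hab : b < a) (n : ℕ) :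
    IsProbabilityMeasure (gapLaw a b n) := by
  have := isProbabilityMeasure_atlasMeasure hb hab
  exact Measure.isProbabilityMeasure_map (measurable_roundGaps a b n).aemeasurable

lemma le_floor_iff_gapRate_le (hb : 0 < b) (hab : b < a)
    (hγ : ∀ i : Fin n, 0 < arrivalRate a b n i) (i : Fin n) (k : ℕ) (x : ℝ≥0) :
    k ≤ ⌊(x : ℝ) * (limitRate a b i / gapRate a b n i)⌋₊
      ↔ gapRate a b n i * k / limitRate a b i ≤ x := by
  have h1 := limitRate_pos hb hab i
  have h2 := gapRate_pos hb hab hγ i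
  rw [Nat.le_floor_iff (by positivity), div_le_iff₀ h1, ← mul_div_assoc, le_div_iff₀ h2,
    mul_comm (k : ℝ)]

/-- Rescaling an `Exp(θ)` variable by `θ / g` gives rate `g`, and its integer part has the geometric
tail `exp (-(g * k))`. -/
lemma coordinateLaw_real_le_floor (hb : 0 < b) (hab : b < a)
    (hγ : ∀ i : Fin n, 0 < arrivalRate a b n i) (i : Fin n) (k : ℕ) :
    (coordinateLaw a b i).real {x | k ≤ ⌊(x : ℝ) * (limitRate a b i / gapRate a b n i)⌋₊}
      = gapRatio a b n i ^ k := by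
  have h1 := limitRate_pos hb hab i
  have h2 := gapRate_pos hb hab hγ i
  simp_rw [le_floor_iff_gapRate_le hb hab hγ]
  rw [coordinateLaw_real_le hb hab _ (by positivity), mul_div_cancel₀ _ h1.ne',
    exp_neg_gapRate_mul hγ]

lemma atlasMeasure_real_pi_fin (hb : 0 < b) (hab : b < a) {t : Fin n → Set ℝ≥0}
    (ht : ∀ i, MeasurableSet (t i)) :
    (atlasMeasure a b).real {x | ∀ i : Fin n, x i ∈ t i}
      = ∏ i : Fin n, (coordinateLaw a b i).real (t i) := by
  have := isProbabilityMeasure_coordinateLaw hb hab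
  exact infinitePi_real_pi_fin (coordinateLaw a b) ht

lemma measurableSet_floor {c : ℝ} (S : Set ℕ) : MeasurableSet {x : ℝ≥0 | ⌊(x : ℝ) * c⌋₊ ∈ S} :=
  (Nat.measurable_floor.comp (measurable_coe_nnreal_real.mul_const c)) (.of_discrete (s := S))

theorem gapLaw_real_Ici (hb : 0 < b) (hab : b < a) (hγ : ∀ i : Fin n, 0 < arrivalRate a b n i)
    (k : Fin n → ℕ) : (gapLaw a b n).real (Set.Ici k) = ∏ i, gapRatio a b n i ^ k i := by
  rw [gapLaw, map_measureReal_apply (measurable_roundGaps a b n) .of_discrete]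
  refine (atlasMeasure_real_pi_fin hb hab (t := fun i =>
    {x | k i ≤ ⌊(x : ℝ) * (limitRate a b i / gapRate a b n i)⌋₊})
    fun i => measurableSet_floor (Set.Ici (k i))).trans ?_
  exact Finset.prod_congr rfl fun i _ => coordinateLaw_real_le_floor hb hab hγ i (k i)

theorem gapLaw_real_singleton (hb : 0 < b) (hab : b < a)
    (hγ : ∀ i : Fin n, 0 < arrivalRate a b n i) (k : Fin n → ℕ) :
    (gapLaw a b n).real {k} = ∏ i, (1 - gapRatio a b n i) * gapRatio a b n i ^ k i := by
  rw [gapLaw, map_measureReal_apply (measurable_roundGaps a b n) .of_discrete]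
  have hset : roundGaps a b n ⁻¹' {k} = {x | ∀ i : Fin n, x i ∈
      {z : ℝ≥0 | ⌊(z : ℝ) * (limitRate a b i / gapRate a b n i)⌋₊ ∈ ({k i} : Set ℕ)}} := by
    ext x
    exact funext_iff
  rw [hset, atlasMeasure_real_pi_fin hb hab fun i => measurableSet_floor _]
  refine Finset.prod_congr rfl fun i _ => ?_
  have := isProbabilityMeasure_coordinateLaw hb hab i
  have hdiff : {z : ℝ≥0 | ⌊(z : ℝ) * (limitRate a b i / gapRate a b n i)⌋₊ ∈ ({k i} : Set ℕ)}
      = {z : ℝ≥0 | k i ≤ ⌊(z : ℝ) * (limitRate a b i / gapRate a b n i)⌋₊}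
        \ {z : ℝ≥0 | k i + 1 ≤ ⌊(z : ℝ) * (limitRate a b i / gapRate a b n i)⌋₊} := by
    ext z
    simp only [Set.mem_singleton_iff, Set.mem_ofPred_eq, Set.mem_sdiff]
    omega
  have hsub : {z : ℝ≥0 | k i + 1 ≤ ⌊(z : ℝ) * (limitRate a b i / gapRate a b n i)⌋₊}
      ⊆ {z | k i ≤ ⌊(z : ℝ) * (limitRate a b i / gapRate a b n i)⌋₊} :=
    fun z hz => (Nat.le_succ _).trans hz
  rw [hdiff, measureReal_sdiff hsub (measurableSet_floor (Set.Ici (k i + 1))), coordinateLaw_real_le_floor hb hab hγ,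
    coordinateLaw_real_le_floor hb hab hγ]
  ring

end GapLaw

/-! ### Gaps and configurations -/

section Gaps

variable {n : ℕ}

/-- The ordered configuration with given gaps. -/
def cumulative (g : Fin n → ℕ) : Fin n → ℕ := fun i => ∑ j ∈ Finset.Iic i, g j

/-- The gaps of a configuration. -/
def gaps (y : Fin n → ℕ) : Fin n → ℕ := fun i => y i - rankBelow y i

/-- The scaled gaps as a function of the gaps. -/
noncomputable def scaleGaps (n : ℕ) (g : Fin n → ℕ) : Fin n → ℝ≥0 :=
  fun i => (g i : ℝ≥0) / NNReal.sqrt n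

/-- The inverse of `scaleGaps`. -/
noncomputable def unscaleGaps (n : ℕ) (z : Fin n → ℝ≥0) : Fin n → ℕ :=
  fun i => ⌊z i * NNReal.sqrt n⌋₊

lemma scaledGaps_eq (y : Fin n → ℕ) : scaledGaps n y = scaleGaps n (gaps y) := rfl

lemma monotone_cumulative (g : Fin n → ℕ) : Monotone (cumulative g) := fun _ _ h =>
  Finset.sum_le_sum_of_subset (Finset.Iic_subset_Iic.2 h)

lemma cumulative_eq_rankBelow_add (g : Fin n → ℕ) (i : Fin n) :
    cumulative g i = rankBelow (cumulative g) i + g i := by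
  have h1 : rankBelow (cumulative g) i = ∑ j ∈ Finset.Iio i, g j := by
    rw [rankBelow]
    split_ifs with h
    · refine (Finset.sum_eq_zero fun j hj => ?_).symm
      have := Fin.lt_def.1 (Finset.mem_Iio.1 hj)
      omega
    · refine Finset.sum_congr ?_ fun _ _ => rfl
      ext j
      simp only [Finset.mem_Iic, Finset.mem_Iio, Fin.le_def, Fin.lt_def]
      omega
  rw [h1, cumulative, ← Finset.Iio_insert, Finset.sum_insert (by simp), add_comm]

lemma gaps_cumulative (g : Fin n → ℕ) : gaps (cumulative g) = g := by
  ext i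
  rw [gaps, cumulative_eq_rankBelow_add]
  omega

lemma rankBelow_le {y : Fin n → ℕ} (hy : Monotone y) (i : Fin n) : rankBelow y i ≤ y i := by
  rw [rankBelow]
  split_ifs
  · exact Nat.zero_le _
  · exact hy (Fin.le_def.2 (Nat.sub_le _ _))

lemma cumulative_gaps {y : Fin n → ℕ} (hy : Monotone y) : cumulative (gaps y) = y := by
  have h : ∀ k (hk : k < n), cumulative (gaps y) ⟨k, hk⟩ = y ⟨k, hk⟩ := by
    intro k
    induction k with
    | zero =>
      intro hk
      have h1 := cumulative_eq_rankBelow_add (gaps y) ⟨0, hk⟩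
      simpa [rankBelow, gaps] using h1
    | succ k ih =>
      intro hk
      have h1 := cumulative_eq_rankBelow_add (gaps y) ⟨k + 1, hk⟩
      have h2 := rankBelow_le hy ⟨k + 1, hk⟩
      have h3 : rankBelow (cumulative (gaps y)) ⟨k + 1, hk⟩ = rankBelow y ⟨k + 1, hk⟩ := by
        simpa [rankBelow] using ih (by omega)
      rw [h1, h3, gaps]
      omega
  exact funext fun i => h i i.isLt

lemma sqrt_natCast_pos (hn : 0 < n) : 0 < NNReal.sqrt (n : ℝ≥0) :=
  NNReal.sqrt_pos.2 (Nat.cast_pos.2 hn)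

lemma unscaleGaps_scaleGaps (hn : 0 < n) (g : Fin n → ℕ) : unscaleGaps n (scaleGaps n g) = g := by
  ext i
  rw [unscaleGaps, scaleGaps, div_mul_cancel₀ _ (sqrt_natCast_pos hn).ne', Nat.floor_natCast]

lemma scaleGaps_mem_scaledLattice (g : Fin n → ℕ) : scaleGaps n g ∈ scaledLattice n :=
  fun i => ⟨g i, rfl⟩

lemma scaleGaps_unscaleGaps {z : Fin n → ℝ≥0} (hz : z ∈ scaledLattice n) :
    scaleGaps n (unscaleGaps n z) = z := by
  ext i
  obtain ⟨k, hk⟩ := hz i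
  rw [scaleGaps, unscaleGaps, hk, div_mul_cancel₀ _ (sqrt_natCast_pos i.pos).ne',
    Nat.floor_natCast]

lemma measurable_unscaleGaps (n : ℕ) : Measurable (unscaleGaps n) :=
  measurable_pi_lambda _ fun i => Nat.measurable_floor.comp ((measurable_pi_apply i).mul_const _)

lemma measurable_cumulative_unscaleGaps (n : ℕ) :
    Measurable fun z : Fin n → ℝ≥0 => cumulative (unscaleGaps n z) :=
  (Measurable.of_discrete (f := cumulative)).comp (measurable_unscaleGaps n)

lemma measurableSet_scaledLattice (n : ℕ) : MeasurableSet (scaledLattice n) := by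
  have h : scaledLattice n = Set.range (scaleGaps n) := by
    ext z
    exact ⟨fun hz => ⟨_, scaleGaps_unscaleGaps hz⟩, by
      rintro ⟨g, rfl⟩; exact scaleGaps_mem_scaledLattice g⟩
  rw [h]
  exact (Set.countable_range _).measurableSet

end Gaps

/-! ### The stationary law -/

section Stationary

variable {a b : ℝ} {n : ℕ}

/-- The stationary law of the ordered queue lengths. -/
noncomputable def configLaw (a b : ℝ) (n : ℕ) : Measure (Fin n → ℕ) :=
  (gapLaw a b n).map cumulative

lemma ae_monotone_configLaw (a b : ℝ) (n : ℕ) : ∀ᵐ y ∂configLaw a b n, Monotone y := by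
  rw [configLaw, ae_map_iff Measurable.of_discrete.aemeasurable .of_discrete]
  exact .of_forall monotone_cumulative

lemma isProbabilityMeasure_configLaw (hb : 0 < b) (hab : b < a) (n : ℕ) :
    IsProbabilityMeasure (configLaw a b n) := by
  have := isProbabilityMeasure_gapLaw hb hab n
  exact Measure.isProbabilityMeasure_map Measurable.of_discrete.aemeasurable

/-- `ρᵢ` collects the factors of all ranks `j ≥ i`, so the factor of rank `j` occurs once for each
unit of the gaps up to `j`, that is `y j` times. -/
lemma prod_gapRatio_pow_gaps (hn : 0 < n) {y : Fin n → ℕ} (hy : Monotone y) :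
    ∏ i, gapRatio a b n i ^ gaps y i = ∏ i, (arrivalRate a b n i / n) ^ y i := by
  simp_rw [gapRatio_eq_prod hn, ← Finset.prod_pow]
  rw [Finset.prod_comm' (t' := Finset.univ) (s' := Finset.Iic) (by simp)]
  refine Finset.prod_congr rfl fun j _ => ?_
  rw [Finset.prod_pow_eq_pow_sum]
  exact congrArg _ (congrFun (cumulative_gaps hy) j)

lemma configLaw_real_singleton (hb : 0 < b) (hab : b < a)
    (hγ : ∀ i : Fin n, 0 < arrivalRate a b n i) (hn : 0 < n) {y : Fin n → ℕ} (hy : Monotone y) :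
    (configLaw a b n).real {y}
      = (∏ i, (1 - gapRatio a b n i)) * ∏ i, (arrivalRate a b n i / n) ^ y i := by
  have hpre : cumulative ⁻¹' {y} = {gaps y} := by
    ext g
    simp only [Set.mem_preimage, Set.mem_singleton_iff]
    exact ⟨fun h => by rw [← h, gaps_cumulative], fun h => by rw [h, cumulative_gaps hy]⟩
  rw [configLaw, map_measureReal_apply .of_discrete .of_discrete, hpre,
    gapLaw_real_singleton hb hab hγ, Finset.prod_mul_distrib, prod_gapRatio_pow_gaps hn hy]

/-- Raising `y i` by one multiplies the mass by `γᵢ / n`, the quotient of the rates of the arrival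
and of the departure that undoes it. -/
theorem isInvariantLaw_configLaw (hb : 0 < b) (hab : b < a)
    (hγ : ∀ i : Fin n, 0 < arrivalRate a b n i) (hn : 0 < n) :
    IsInvariantLaw (pauseRate a b n) (configLaw a b n) := by
  have := isProbabilityMeasure_configLaw hb hab n
  refine isInvariantLaw_of_detailed_balance (ae_monotone_configLaw a b n) fun y hy i hi => ?_
  have hn' : (n : ℝ) ≠ 0 := Nat.cast_ne_zero.2 hn.ne'
  have hprod : ∏ j, (arrivalRate a b n j / n) ^ (Function.update y i (y i + 1)) j
      = arrivalRate a b n i / n * ∏ j, (arrivalRate a b n j / n) ^ y j := by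
    rw [← Finset.mul_prod_erase _ _ (Finset.mem_univ i),
      ← Finset.mul_prod_erase _ (fun j => (arrivalRate a b n j / n) ^ y j) (Finset.mem_univ i),
      Function.update_self, pow_succ', mul_assoc]
    congr 2
    refine Finset.prod_congr rfl fun j hj => ?_
    rw [Function.update_of_ne (Finset.ne_of_mem_erase hj)]
  rw [configLaw_real_singleton hb hab hγ hn hy,
    configLaw_real_singleton hb hab hγ hn (monotone_step _ hy), step_inl hi, hprod]
  simp only [pauseRate, Sum.elim_inl, Sum.elim_inr]
  field_simp

lemma IsPauseSystem.ae_monotone {Ω : Type*} [MeasurableSpace Ω] {P : Measure Ω}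
    [IsProbabilityMeasure P] {A D : Fin n → Ω → Measure (ℝ≥0 × ℝ≥0)} {Y : ℝ≥0 → Ω → Fin n → ℕ}
    (h : IsPauseSystem P a b n A D Y) (hγ : ∀ i : Fin n, 0 < arrivalRate a b n i) (t : ℝ≥0) :
    ∀ᵐ ω ∂P, Monotone (Y t ω) :=
  (h.isSolution hγ).ae_mem_of_step_mem (S := {y | Monotone y}) (fun d _ hy => monotone_step d hy)
    h.ordered_initial t

/-- An ordered configuration is recovered from its scaled gaps, so equalities of laws pass from gaps
to configurations. -/
lemma map_eq_map_cumulative {Ω : Type*} [MeasurableSpace Ω] {P : Measure Ω} {Z : Ω → Fin n → ℕ}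
    (hZ : Measurable Z) (hmono : ∀ᵐ ω ∂P, Monotone (Z ω)) (hn : 0 < n) :
    P.map Z = (P.map fun ω => scaledGaps n (Z ω)).map fun z => cumulative (unscaleGaps n z) := by
  have hm : Measurable fun ω => scaledGaps n (Z ω) :=
    (Measurable.of_discrete (f := scaledGaps n)).comp hZ
  rw [Measure.map_map (measurable_cumulative_unscaleGaps n) hm]
  refine Measure.map_congr ?_
  filter_upwards [hmono] with ω hω
  simp only [Function.comp_apply, scaledGaps_eq, unscaleGaps_scaleGaps hn, cumulative_gaps hω]

/-- The stationary law of the scaled gaps. -/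
noncomputable def scaledGapLaw (a b : ℝ) (n : ℕ) : Measure (Fin n → ℝ≥0) :=
  (gapLaw a b n).map (scaleGaps n)

lemma isProbabilityMeasure_scaledGapLaw (hb : 0 < b) (hab : b < a) (n : ℕ) :
    IsProbabilityMeasure (scaledGapLaw a b n) := by
  have := isProbabilityMeasure_gapLaw hb hab n
  exact Measure.isProbabilityMeasure_map Measurable.of_discrete.aemeasurable

lemma map_scaledGaps_configLaw (a b : ℝ) (n : ℕ) :
    (configLaw a b n).map (scaledGaps n) = scaledGapLaw a b n := by
  rw [configLaw, Measure.map_map .of_discrete .of_discrete, scaledGapLaw]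
  congr 1
  ext g : 1
  rw [Function.comp_apply, scaledGaps_eq, gaps_cumulative]

lemma map_cumulative_scaledGapLaw (a b : ℝ) (hn : 0 < n) :
    (scaledGapLaw a b n).map (fun z => cumulative (unscaleGaps n z)) = configLaw a b n := by
  rw [scaledGapLaw, Measure.map_map (measurable_cumulative_unscaleGaps n) .of_discrete, configLaw]
  congr 1
  ext g : 1
  rw [Function.comp_apply, unscaleGaps_scaleGaps hn]

theorem isStationaryGapLaw_scaledGapLaw (hb : 0 < b) (hab : b < a)
    (hγ : ∀ i : Fin n, 0 < arrivalRate a b n i) (hn : 0 < n) :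
    IsStationaryGapLaw a b n ⟨scaledGapLaw a b n, isProbabilityMeasure_scaledGapLaw hb hab n⟩ := by
  refine ⟨?_, ?_⟩
  · rw [ProbabilityMeasure.coe_mk, scaledGapLaw, Measure.map_apply .of_discrete
      (measurableSet_scaledLattice n).compl]
    convert! measure_empty (μ := gapLaw a b n)
    ext g
    simp [scaleGaps_mem_scaledLattice g]
  · intro Ω _ P _ A D Y h h0 t
    rw [ProbabilityMeasure.coe_mk] at h0 ⊢
    have hY := h.isSolution hγ
    have hlaw : P.map (Y 0) = configLaw a b n := by
      rw [map_eq_map_cumulative (h.measurable 0) h.ordered_initial hn, h0,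
        map_cumulative_scaledGapLaw a b hn]
    have hinv := hY.map_eq_of_isInvariantLaw (hlaw ▸ isInvariantLaw_configLaw hb hab hγ hn) t
    have hcomp := Measure.map_map (Measurable.of_discrete (f := scaledGaps n)) (h.measurable t)
      (μ := P)
    rw [hinv, hlaw, map_scaledGaps_configLaw] at hcomp
    exact hcomp.symm

/-- `π` is lifted to ordered configurations and a system is started from the lift; stationarity
makes the lifted law invariant, and invariant laws are unique. -/
theorem IsStationaryGapLaw.eq_scaledGapLaw (hb : 0 < b) (hab : b < a)
    (hγ : ∀ i : Fin n, 0 < arrivalRate a b n i) (hn : 0 < n)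
    {π : ProbabilityMeasure (Fin n → ℝ≥0)} (hπ : IsStationaryGapLaw a b n π) :
    (π : Measure (Fin n → ℝ≥0)) = scaledGapLaw a b n := by
  have hm := measurable_cumulative_unscaleGaps n
  set ν : Measure (Fin n → ℕ) :=
    (π : Measure (Fin n → ℝ≥0)).map fun z => cumulative (unscaleGaps n z)
  have hνp : IsProbabilityMeasure ν := Measure.isProbabilityMeasure_map hm.aemeasurable
  have hν : ∀ᵐ y ∂ν, Monotone y := by
    rw [ae_map_iff hm.aemeasurable .of_discrete]
    exact .of_forall fun z => monotone_cumulative _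
  have hback : ν.map (scaledGaps n) = (π : Measure (Fin n → ℝ≥0)) := by
    rw [Measure.map_map .of_discrete hm]
    conv_rhs => rw [← Measure.map_id (μ := (π : Measure (Fin n → ℝ≥0)))]
    refine Measure.map_congr ?_
    have hlat : ∀ᵐ z ∂(π : Measure (Fin n → ℝ≥0)), z ∈ scaledLattice n := hπ.1
    filter_upwards [hlat] with z hz
    rw [Function.comp_apply, scaledGaps_eq, gaps_cumulative, scaleGaps_unscaleGaps hz, id]
  -- Without an actual system started from `ν`, stationarity of `π` could be an empty condition.
  obtain ⟨Ω, _, P, _, A, D, Y, h, h0⟩ := exists_isPauseSystem hγ ν hν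
  have hstat := hπ.2 Ω P A D Y h (by
    rw [← hback, ← h0, Measure.map_map .of_discrete (h.measurable 0)]
    rfl)
  have hmap : ∀ t, P.map (Y t) = P.map (Y 0) := fun t => by
    rw [map_eq_map_cumulative (h.measurable t) (h.ae_monotone hγ t) hn, hstat t, h0]
  have hinv := (h.isSolution hγ).isInvariantLaw_of_map_eq hmap
  rw [h0] at hinv
  have := isProbabilityMeasure_configLaw hb hab n
  have hpos : ∀ d, 0 < pauseRate a b n d := by
    rintro (i | i)
    · exact hγ i
    · exact Nat.cast_pos.2 hn
  rw [← hback, hinv.eq (isInvariantLaw_configLaw hb hab hγ hn) hpos, map_scaledGaps_configLaw]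

theorem scaledGapLaw_real_Ici (hb : 0 < b) (hab : b < a)
    (hγ : ∀ i : Fin n, 0 < arrivalRate a b n i) (hn : 0 < n) {z : Fin n → ℝ≥0}
    (hz : z ∈ scaledLattice n) :
    (scaledGapLaw a b n).real (Set.Ici z) = ∏ i, gapRatio a b n i ^ (√n * (z i : ℝ)) := by
  choose k hk using hz
  have hpre : scaleGaps n ⁻¹' Set.Ici z = Set.Ici k := by
    ext g
    simp only [Set.mem_preimage, Set.mem_Ici, Pi.le_def, scaleGaps, hk,
      div_le_div_iff_of_pos_right (sqrt_natCast_pos hn), Nat.cast_le]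
  rw [scaledGapLaw, map_measureReal_apply .of_discrete measurableSet_Ici, hpre,
    gapLaw_real_Ici hb hab hγ]
  refine Finset.prod_congr rfl fun i _ => ?_
  have hs : √(n : ℝ) ≠ 0 := (Real.sqrt_pos.2 (Nat.cast_pos.2 hn)).ne'
  rw [← Real.rpow_natCast, hk]
  congr 1
  simp only [NNReal.coe_div, NNReal.coe_natCast, Real.coe_sqrt]
  field_simp

end Stationary

/-! ### The limit of the stationary laws -/

section Limit

variable {a b : ℝ}

/-- Rounding down costs at most `1 / √n` after scaling, and the factor `limitRate / (√n * gapRate)`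
tends to one. -/
lemma tendsto_padZero_scaleGaps (hb : 0 < b) (hab : b < a) (x : ℕ → ℝ≥0) :
    Tendsto (fun n => padZero n (scaleGaps n (roundGaps a b n x))) atTop (𝓝 x) := by
  refine tendsto_pi_nhds.2 fun k => ?_
  rw [← NNReal.tendsto_coe]
  have hθ := limitRate_pos hb hab k
  have hlim := tendsto_sqrt_mul_gapRate a b k
  have hsq : Tendsto (fun n : ℕ => (√(n : ℝ))⁻¹) atTop (𝓝 0) :=
    tendsto_inv_atTop_zero.comp (Real.tendsto_sqrt_atTop.comp tendsto_natCast_atTop_atTop)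
  set u : ℕ → ℝ := fun n => if h : k < n then √n * gapRate a b n ⟨k, h⟩ else 0
  have hup : Tendsto (fun n => (x k : ℝ) * (limitRate a b k / u n)) atTop (𝓝 (x k)) := by
    have := (tendsto_const_nhds (x := limitRate a b k)).div hlim hθ.ne'
    rw [div_self hθ.ne'] at this
    simpa using this.const_mul (x k : ℝ)
  have hlow : Tendsto (fun n : ℕ => (x k : ℝ) * (limitRate a b k / u n) - (√(n : ℝ))⁻¹) atTop
      (𝓝 (x k)) := by simpa using hup.sub hsq
  -- Positivity of the `gapRate` of rank `k` for large `n` comes from its limit, so no assumption on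
  -- the arrival rates enters.
  have hev : ∀ᶠ n in atTop, k < n ∧ 0 < u n :=
    (eventually_gt_atTop k).and (hlim.eventually_const_lt hθ)
  have hval : ∀ n : ℕ, ∀ h : k < n, 0 < u n → ∃ v : ℝ, 0 ≤ v ∧
      v * (√(n : ℝ))⁻¹ = (x k : ℝ) * (limitRate a b k / u n) ∧
      (padZero n (scaleGaps n (roundGaps a b n x)) k : ℝ) = (⌊v⌋₊ : ℝ) * (√(n : ℝ))⁻¹ := by
    intro n h hu
    have hs : 0 < √(n : ℝ) := Real.sqrt_pos.2 (Nat.cast_pos.2 (by omega))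
    simp only [u, dif_pos h] at hu ⊢
    have hg : 0 < gapRate a b n ⟨k, h⟩ := pos_of_mul_pos_right hu hs.le
    refine ⟨(x k : ℝ) * (limitRate a b k / gapRate a b n ⟨k, h⟩), ?_, ?_, ?_⟩
    · have := (x k).2
      positivity
    · field_simp
    · simp only [padZero, dif_pos h, scaleGaps, roundGaps, NNReal.coe_div, NNReal.coe_natCast,
        Real.coe_sqrt, ← div_eq_mul_inv]
  refine tendsto_of_tendsto_of_tendsto_of_le_of_le' hlow hup ?_ ?_
  · filter_upwards [hev] with n hn
    obtain ⟨v, -, h1, h2⟩ := hval n hn.1 hn.2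
    rw [h2, ← h1, ← sub_one_mul]
    exact mul_le_mul_of_nonneg_right (Nat.sub_one_lt_floor v).le
      (inv_nonneg.2 (Real.sqrt_nonneg _))
  · filter_upwards [hev] with n hn
    obtain ⟨v, h0, h1, h2⟩ := hval n hn.1 hn.2
    rw [h2, ← h1]
    exact mul_le_mul_of_nonneg_right (Nat.floor_le h0) (inv_nonneg.2 (Real.sqrt_nonneg _))

/-- All the laws are images of `atlasMeasure`, so weak convergence reduces to pointwise convergence
of the maps and dominated convergence. -/
theorem tendsto_padLaw_scaledGapLaw (hb : 0 < b) (hab : b < a) :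
    Tendsto (fun n => padLaw n ⟨scaledGapLaw a b n, isProbabilityMeasure_scaledGapLaw hb hab n⟩)
      atTop (𝓝 (atlasLaw a b hb hab)) := by
  rw [ProbabilityMeasure.tendsto_iff_forall_integral_tendsto]
  intro f
  have := isProbabilityMeasure_atlasMeasure hb hab
  have hm : ∀ n, Measurable fun x => padZero n (scaleGaps n (roundGaps a b n x)) := fun n =>
    (measurable_padZero n).comp ((Measurable.of_discrete (f := scaleGaps n)).comp
      (measurable_roundGaps a b n))
  have hint : ∀ n, ∫ x, f x ∂(padLaw n ⟨scaledGapLaw a b n,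
      isProbabilityMeasure_scaledGapLaw hb hab n⟩ : Measure (ℕ → ℝ≥0))
      = ∫ x, f (padZero n (scaleGaps n (roundGaps a b n x))) ∂atlasMeasure a b := by
    intro n
    have hlaw : (padLaw n ⟨scaledGapLaw a b n,
        isProbabilityMeasure_scaledGapLaw hb hab n⟩ : Measure (ℕ → ℝ≥0))
        = (atlasMeasure a b).map fun x => padZero n (scaleGaps n (roundGaps a b n x)) := by
      refine (ProbabilityMeasure.toMeasure_map _ _).trans ?_
      rw [ProbabilityMeasure.coe_mk, scaledGapLaw, gapLaw,
        Measure.map_map .of_discrete (measurable_roundGaps a b n),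
        Measure.map_map (measurable_padZero n)
          ((Measurable.of_discrete (f := scaleGaps n)).comp (measurable_roundGaps a b n))]
      rfl
    rw [hlaw, integral_map (hm n).aemeasurable f.continuous.measurable.aestronglyMeasurable]
  simp_rw [hint]
  refine tendsto_integral_of_dominated_convergence (fun _ => ‖f‖)
    (fun n => (f.continuous.measurable.comp (hm n)).aestronglyMeasurable) (integrable_const _)
    (fun n => .of_forall fun x => f.norm_coe_le_norm _) (.of_forall fun x => ?_)
  exact (f.continuous.tendsto x).comp (tendsto_padZero_scaleGaps hb hab x)

end Limit

/-- For each `n` with positive arrival rates the scaled gap process has a unique stationary law,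
a product of geometric laws, and these laws converge weakly to a product of exponential laws. -/
theorem mainTheorem5 (a b : ℝ) (hb : 0 < b) (hab : b < a) :
    ∃ π : (n : ℕ) → ProbabilityMeasure (Fin n → ℝ≥0),
      (∀ n : ℕ, 0 < n → (∀ i : Fin n, 0 < arrivalRate a b n i) →
        IsStationaryGapLaw a b n (π n) ∧
        (∀ π' : ProbabilityMeasure (Fin n → ℝ≥0), IsStationaryGapLaw a b n π' → π' = π n) ∧
        ∀ z ∈ scaledLattice n,
          (π n : Measure (Fin n → ℝ≥0)).real (Set.Ici z)
            = ∏ i, gapRatio a b n i ^ (√n * (z i : ℝ))) ∧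
      Tendsto (fun n => padLaw n (π n)) atTop (𝓝 (atlasLaw a b hb hab)) :=
  ⟨fun n => ⟨scaledGapLaw a b n, isProbabilityMeasure_scaledGapLaw hb hab n⟩,
    fun _ hn hγ => ⟨isStationaryGapLaw_scaledGapLaw hb hab hγ hn,
      fun _ hπ => Subtype.ext (hπ.eq_scaledGapLaw hb hab hγ hn),
      fun _ hz => scaledGapLaw_real_Ici hb hab hγ hn hz⟩,
    tendsto_padLaw_scaledGapLaw hb hab⟩
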